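/- Let $(M^6,g,J)$ be a connected six-dimensional nearly Kähler manifold which is not Kähler; that is, $g$ is a smooth Riemannian metric, $J$ is a smooth almost complex structure with $g(JX,JY)=g(X,Y)$, the Levi-Civita connection $\nabla^g$ satisfies $(\nabla^g_XJ)Y+(\nabla^g_YJ)X=0$ for all vector fields $X,Y$, and $\nabla^gJ$ is not identically zero. Let $\Omega(X,Y)=g(X,JY)$ and let $\nabla$ be the canonical hermitian connection $\nabla_XY=\nabla^g_XY-\tfrac12J(\nabla^g_XJ)Y$. Then $\nabla g=\nabla J=0$ and there is a smooth complex $(3,0)$-form $\psi$ on $M$ with $\nabla\psi=0$ and with $|\psi(e_1,e_2,e_3)|=1$ for every unitary frame (that is, whenever $e_1,e_2,e_3,Je_1,Je_2,Je_3$ are orthonormal). Its real part is a generalized calibration, $\operatorname{Re}\psi(e_1,e_2,e_3)\le 1$ for all orthonormal $e_1,e_2,e_3\in T_xM$ and all $x\in M$ (a "special almost symplectic", or SAS, calibration). For this same $\psi$, every three-dimensional Lagrangian submanifold of $M$, that is, every smooth immersion $f:L^3\to M$ with $f^*\Omega=0$, has the following properties. 1. $L$ is an SAS calibrated submanifold: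 $L$ has an orientation such that $\operatorname{Re}\psi(df(e_1),df(e_2),df(e_3))=1$ for every $p\in L$ and every positively oriented basis $e_1,e_2,e_3$ of $T_pL$ that is orthonormal for the induced metric. 2. $L$ is minimal: the trace of its second fundamental form with respect to the induced metric vanishes. 3. Consequently $L$ is orientable. -/

import Mathlib

open Bundle Manifold Module
open scoped ContDiff Topology

set_option linter.unusedSectionVars false
set_option linter.unusedSimpArgs false

noncomputable section

namespace NearlyKahler

section Connections

variable {E : Type*} [NormedAddCommGroup E] [NormedSpace ℝ E] [FiniteDimensional ℝ E]
  [CompleteSpace E]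
  {H : Type*} [TopologicalSpace H] (I : ModelWithCorners ℝ E H)
  {M : Type*} [TopologicalSpace M] [ChartedSpace H M] [IsManifold I ∞ M]
  [RiemannianBundle (fun x : M ↦ TangentSpace I x)]
  [IsContMDiffRiemannianBundle I ∞ E (fun x : M ↦ TangentSpace I x)]

/-- The Koszul expression
`X g(Y,Z) + Y g(Z,X) - Z g(X,Y) + g([X,Y],Z) - g([Y,Z],X) + g([Z,X],Y)` at `x`, which equals
`2 g(∇_X Y, Z)` for the Levi-Civita connection `∇`. -/
def koszul (X Y Z : Π x : M, TangentSpace I x) (x : M) : ℝ :=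
  mvfderiv I (fun y ↦ inner ℝ (Y y) (Z y)) x (X x)
    + mvfderiv I (fun y ↦ inner ℝ (Z y) (X y)) x (Y x)
    - mvfderiv I (fun y ↦ inner ℝ (X y) (Y y)) x (Z x)
    + inner ℝ (VectorField.mlieBracket I X Y x) (Z x)
    - inner ℝ (VectorField.mlieBracket I Y Z x) (X x)
    + inner ℝ (VectorField.mlieBracket I Z X x) (Y x)

variable {I}

lemma mdifferentiableAt_inner {x : M} {Y Z : Π x : M, TangentSpace I x}
    (hY : MDiffAt (T% Y) x) (hZ : MDiffAt (T% Z) x) :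
    MDifferentiableAt I 𝓘(ℝ, ℝ) (fun y ↦ inner ℝ (Y y) (Z y)) x :=
  MDifferentiableAt.inner_bundle (F := E) (E := fun x : M ↦ TangentSpace I x) hY hZ

lemma koszul_tensorial_left {x : M} {Y Z : Π x : M, TangentSpace I x}
    (hY : MDiffAt (T% Y) x) (hZ : MDiffAt (T% Z) x) :
    TensorialAt I E (fun X ↦ koszul I X Y Z x) x where
  smul {f X} hf hX := by
    have e1 : (fun y ↦ inner ℝ (Z y) ((f • X) y)) = fun y ↦ f y * inner ℝ (Z y) (X y) := by
      ext y; simp [inner_smul_right]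
    have e2 : (fun y ↦ inner ℝ ((f • X) y) (Y y)) = fun y ↦ f y * inner ℝ (X y) (Y y) := by
      ext y; simp [inner_smul_left]
    simp only [koszul, e1, e2, mvfderiv_fun_mul hf (mdifferentiableAt_inner hZ hX),
      mvfderiv_fun_mul hf (mdifferentiableAt_inner hX hY), VectorField.mlieBracket_smul_left hf hX,
      VectorField.mlieBracket_smul_right hf hX]
    simp [inner_add_left, inner_smul_left, inner_smul_right, real_inner_comm]
    ring
  add {X X'} hX hX' := by
    have e1 : (fun y ↦ inner ℝ (Z y) ((X + X') y)) =
        fun y ↦ inner ℝ (Z y) (X y) + inner ℝ (Z y) (X' y) := by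
      ext y; simp [inner_add_right]
    have e2 : (fun y ↦ inner ℝ ((X + X') y) (Y y)) =
        fun y ↦ inner ℝ (X y) (Y y) + inner ℝ (X' y) (Y y) := by
      ext y; simp [inner_add_left]
    simp only [koszul, e1, e2, mvfderiv_fun_add (mdifferentiableAt_inner hZ hX) (mdifferentiableAt_inner hZ hX'),
      mvfderiv_fun_add (mdifferentiableAt_inner hX hY) (mdifferentiableAt_inner hX' hY),
      VectorField.mlieBracket_add_left hX hX', VectorField.mlieBracket_add_right hX hX']
    simp [inner_add_left, inner_add_right]
    ring

lemma koszul_tensorial_right {x : M} {X Y : Π x : M, TangentSpace I x}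
    (hX : MDiffAt (T% X) x) (hY : MDiffAt (T% Y) x) :
    TensorialAt I E (fun Z ↦ koszul I X Y Z x) x where
  smul {f Z} hf hZ := by
    have e1 : (fun y ↦ inner ℝ (Y y) ((f • Z) y)) = fun y ↦ f y * inner ℝ (Y y) (Z y) := by
      ext y; simp [inner_smul_right]
    have e2 : (fun y ↦ inner ℝ ((f • Z) y) (X y)) = fun y ↦ f y * inner ℝ (Z y) (X y) := by
      ext y; simp [inner_smul_left]
    simp only [koszul, e1, e2, mvfderiv_fun_mul hf (mdifferentiableAt_inner hY hZ),
      mvfderiv_fun_mul hf (mdifferentiableAt_inner hZ hX), VectorField.mlieBracket_smul_left hf hZ,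
      VectorField.mlieBracket_smul_right hf hZ]
    simp [inner_add_left, inner_smul_left, inner_smul_right, real_inner_comm]
    ring
  add {Z Z'} hZ hZ' := by
    have e1 : (fun y ↦ inner ℝ (Y y) ((Z + Z') y)) =
        fun y ↦ inner ℝ (Y y) (Z y) + inner ℝ (Y y) (Z' y) := by
      ext y; simp [inner_add_right]
    have e2 : (fun y ↦ inner ℝ ((Z + Z') y) (X y)) =
        fun y ↦ inner ℝ (Z y) (X y) + inner ℝ (Z' y) (X y) := by
      ext y; simp [inner_add_left]
    simp only [koszul, e1, e2, mvfderiv_fun_add (mdifferentiableAt_inner hY hZ) (mdifferentiableAt_inner hY hZ'),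
      mvfderiv_fun_add (mdifferentiableAt_inner hZ hX) (mdifferentiableAt_inner hZ' hX),
      VectorField.mlieBracket_add_left hZ hZ', VectorField.mlieBracket_add_right hZ hZ']
    simp [inner_add_left, inner_add_right]
    ring

open Classical in
variable (I) in
/-- The bilinear form `(u, w) ↦ 2 g(∇_u Y, w)` on `T_x M`, for a vector field `Y` that is
differentiable at `x` (and `0` otherwise). -/
def koszulForm (Y : Π x : M, TangentSpace I x) (x : M) :
    TangentSpace I x →L[ℝ] TangentSpace I x →L[ℝ] ℝ :=
  if hY : MDiffAt (T% Y) x then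
    TensorialAt.mkHom₂ (fun X Z ↦ koszul I X Y Z x) x
      (fun _ hZ ↦ koszul_tensorial_left hY hZ) (fun _ hX ↦ koszul_tensorial_right hX hY)
  else 0

lemma koszulForm_apply {x : M} {X Y Z : Π x : M, TangentSpace I x} (hX : MDiffAt (T% X) x)
    (hY : MDiffAt (T% Y) x) (hZ : MDiffAt (T% Z) x) :
    koszulForm I Y x (X x) (Z x) = koszul I X Y Z x := by
  rw [koszulForm, dif_pos hY, TensorialAt.mkHom₂_apply _ _ hX hZ]

instance (x : M) : FiniteDimensional ℝ (TangentSpace I x) :=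
  inferInstanceAs (FiniteDimensional ℝ E)

instance (x : M) : CompleteSpace (TangentSpace I x) := FiniteDimensional.complete ℝ _

variable (I) in
/-- `u ↦ ∇_u Y` at `x`, obtained from the Koszul form by raising an index. -/
def leviCivitaFun (Y : Π x : M, TangentSpace I x) (x : M) : TangentSpace I x →L[ℝ] TangentSpace I x :=
  LinearMap.toContinuousLinearMap
    { toFun := fun u ↦ (InnerProductSpace.toDual ℝ (TangentSpace I x)).symm
        ((1 / 2 : ℝ) • koszulForm I Y x u)
      map_add' := by intro u v; simp
      map_smul' := by intro c u; simp [smul_comm c] }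

lemma inner_leviCivitaFun (Y : Π x : M, TangentSpace I x) (x : M) (u w : TangentSpace I x) :
    inner ℝ (leviCivitaFun I Y x u) w = 1 / 2 * koszulForm I Y x u w := by
  simp [leviCivitaFun, real_inner_smul_left]

lemma inner_leviCivitaFun_apply {x : M} {X Y Z : Π x : M, TangentSpace I x} (hX : MDiffAt (T% X) x)
    (hY : MDiffAt (T% Y) x) (hZ : MDiffAt (T% Z) x) :
    inner ℝ (leviCivitaFun I Y x (X x)) (Z x) = 1 / 2 * koszul I X Y Z x := by
  rw [inner_leviCivitaFun, koszulForm_apply hX hY hZ]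

lemma isCovariantDerivativeOn_leviCivitaFun : IsCovariantDerivativeOn E (leviCivitaFun I : (Π x : M, TangentSpace I x) → _) where
  add {Y Y' x} hY hY' _ := by
    ext u
    refine ext_inner_right ℝ fun w ↦ ?_
    have hu := FiberBundle.mdifferentiableAt_extend I E u
    have hw := FiberBundle.mdifferentiableAt_extend I E w
    have e1 : (fun y ↦ inner ℝ ((Y + Y') y) (FiberBundle.extend E w y)) =
        fun y ↦ inner ℝ (Y y) (FiberBundle.extend E w y)
          + inner ℝ (Y' y) (FiberBundle.extend E w y) := by
      ext y; simp [inner_add_left]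
    have e2 : (fun y ↦ inner ℝ (FiberBundle.extend E u y) ((Y + Y') y)) =
        fun y ↦ inner ℝ (FiberBundle.extend E u y) (Y y)
          + inner ℝ (FiberBundle.extend E u y) (Y' y) := by
      ext y; simp [inner_add_right]
    have h1 := inner_leviCivitaFun_apply hu (mdifferentiableAt_add_section hY hY') hw
    have h2 := inner_leviCivitaFun_apply hu hY hw
    have h3 := inner_leviCivitaFun_apply hu hY' hw
    simp only [FiberBundle.extend_apply_self, add_apply, inner_add_left] at *
    rw [h1, h2, h3]
    simp only [koszul, e1, e2, mvfderiv_fun_add (mdifferentiableAt_inner hY hw)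
      (mdifferentiableAt_inner hY' hw), mvfderiv_fun_add (mdifferentiableAt_inner hu hY)
      (mdifferentiableAt_inner hu hY'), VectorField.mlieBracket_add_left hY hY',
      VectorField.mlieBracket_add_right hY hY']
    simp [inner_add_left, inner_add_right]
    ring
  leibniz {Y f x} hY hf _ := by
    ext u
    refine ext_inner_right ℝ fun w ↦ ?_
    have hu := FiberBundle.mdifferentiableAt_extend I E u
    have hw := FiberBundle.mdifferentiableAt_extend I E w
    have e1 : (fun y ↦ inner ℝ ((f • Y) y) (FiberBundle.extend E w y)) =
        fun y ↦ f y * inner ℝ (Y y) (FiberBundle.extend E w y) := by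
      ext y; simp [inner_smul_left]
    have e2 : (fun y ↦ inner ℝ (FiberBundle.extend E u y) ((f • Y) y)) =
        fun y ↦ f y * inner ℝ (FiberBundle.extend E u y) (Y y) := by
      ext y; simp [inner_smul_right]
    have h1 := inner_leviCivitaFun_apply hu (hf.smul_section hY) hw
    have h2 := inner_leviCivitaFun_apply hu hY hw
    simp only [FiberBundle.extend_apply_self, add_apply, inner_add_left,
      smul_apply, ContinuousLinearMap.smulRight_apply,
      real_inner_smul_left] at *
    rw [h1, h2]
    simp only [koszul, e1, e2, mvfderiv_fun_mul hf (mdifferentiableAt_inner hY hw),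
      mvfderiv_fun_mul hf (mdifferentiableAt_inner hu hY), VectorField.mlieBracket_smul_left hf hY,
      VectorField.mlieBracket_smul_right hf hY]
    simp [inner_add_left, inner_smul_left, inner_smul_right, real_inner_comm]
    ring

variable (I M) in
/-- The Levi-Civita connection of the Riemannian metric of `M`. The value `leviCivita I M Y x u` is
`∇_u Y` at `x`; the two theorems below say that it is torsion-free and metric. -/
def leviCivita : CovariantDerivative I E (fun x : M ↦ TangentSpace I x) where
  toFun := leviCivitaFun I
  isCovariantDerivativeOnUniv := isCovariantDerivativeOn_leviCivitaFun

theorem leviCivita_torsion : (leviCivita I M).torsion = 0 := by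
  rw [CovariantDerivative.torsion_eq_zero_iff]
  intro X Y x hX hY
  refine ext_inner_right ℝ fun w ↦ ?_
  have hw := FiberBundle.mdifferentiableAt_extend I E w
  have h1 := inner_leviCivitaFun_apply hX hY hw
  have h2 := inner_leviCivitaFun_apply hY hX hw
  simp only [FiberBundle.extend_apply_self] at h1 h2
  change inner ℝ (leviCivitaFun I Y x (X x) - leviCivitaFun I X x (Y x)) w = _
  rw [inner_sub_left, h1, h2]
  simp only [koszul, FiberBundle.extend_apply_self, real_inner_comm]
  rw [VectorField.mlieBracket_swap_apply (V := Y) (W := X),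
    VectorField.mlieBracket_swap_apply (V := FiberBundle.extend E w) (W := Y),
    VectorField.mlieBracket_swap_apply (V := FiberBundle.extend E w) (W := X)]
  simp [inner_neg_left, real_inner_comm]
  ring


/-- `D` is a metric connection: `u g(Y,Z) = g(D_u Y, Z) + g(Y, D_u Z)`. -/
def IsMetricConnection (D : CovariantDerivative I E (fun x : M ↦ TangentSpace I x)) : Prop :=
  ∀ (x : M) (Y Z : Π x : M, TangentSpace I x), MDiffAt (T% Y) x → MDiffAt (T% Z) x →
    ∀ u : TangentSpace I x,
      mvfderiv I (fun y ↦ inner ℝ (Y y) (Z y)) x u =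
        inner ℝ (D Y x u) (Z x) + inner ℝ (Y x) (D Z x u)

theorem leviCivita_isMetricConnection : IsMetricConnection (leviCivita I M) := by
  intro x Y Z hY hZ u
  have hu := FiberBundle.mdifferentiableAt_extend I E u
  have h1 := inner_leviCivitaFun_apply hu hY hZ
  have h2 := inner_leviCivitaFun_apply hu hZ hY
  simp only [FiberBundle.extend_apply_self] at h1 h2
  change _ = inner ℝ (leviCivitaFun I Y x u) (Z x) + inner ℝ (Y x) (leviCivitaFun I Z x u)
  rw [real_inner_comm _ (Y x), h1, h2]
  simp only [koszul, FiberBundle.extend_apply_self]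
  rw [VectorField.mlieBracket_swap_apply (V := Z) (W := Y),
    VectorField.mlieBracket_swap_apply (V := Z) (W := FiberBundle.extend E u),
    VectorField.mlieBracket_swap_apply (V := Y) (W := FiberBundle.extend E u)]
  simp [inner_neg_left, real_inner_comm]
  ring

end Connections

section AlmostHermitian

variable {E : Type*} [NormedAddCommGroup E] [NormedSpace ℝ E] [FiniteDimensional ℝ E]
  [CompleteSpace E]
  {H : Type*} [TopologicalSpace H] (I : ModelWithCorners ℝ E H)
  (M : Type*) [TopologicalSpace M] [ChartedSpace H M] [IsManifold I ∞ M]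
  [RiemannianBundle (fun x : M ↦ TangentSpace I x)]
  [IsContMDiffRiemannianBundle I ∞ E (fun x : M ↦ TangentSpace I x)]

/-- An almost hermitian structure on the Riemannian manifold `(M, g)`: a smooth field `J` of
endomorphisms of the tangent spaces with `J² = -1` and `g(JX, JY) = g(X, Y)`. -/
structure AlmostHermitianStructure where
  /-- The almost complex structure. -/
  J (x : M) : TangentSpace I x →L[ℝ] TangentSpace I x
  contMDiff : ContMDiff I (I.prod 𝓘(ℝ, E →L[ℝ] E)) ∞
    (fun x ↦ TotalSpace.mk' (E →L[ℝ] E)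
      (E := fun x : M ↦ TangentSpace I x →L[ℝ] TangentSpace I x) x (J x))
  sq (x : M) (v : TangentSpace I x) : J x (J x v) = -v
  inner_map (x : M) (u v : TangentSpace I x) : inner ℝ (J x u) (J x v) = inner ℝ u v

namespace AlmostHermitianStructure

variable {I M} (S : AlmostHermitianStructure I M)

/-- The vector field `JY`. -/
def mapField (Y : Π x : M, TangentSpace I x) (x : M) : TangentSpace I x := S.J x (Y x)

lemma mdifferentiableAt_mapField {Y : Π x : M, TangentSpace I x} {x : M}
    (hY : MDiffAt (T% Y) x) : MDiffAt (T% (S.mapField Y)) x :=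
  MDifferentiableAt.clm_bundle_apply (F₁ := E) (F₂ := E)
    (E₁ := fun x : M ↦ TangentSpace I x) (E₂ := fun x : M ↦ TangentSpace I x)
    (S.contMDiff.mdifferentiableAt (by simp)) hY

/-- `u ↦ (D_u J) Y = D_u (JY) - J (D_u Y)` at `x`, for a connection `D`. -/
def covDerivJ (D : CovariantDerivative I E (fun x : M ↦ TangentSpace I x))
    (Y : Π x : M, TangentSpace I x) (x : M) : TangentSpace I x →L[ℝ] TangentSpace I x :=
  D (S.mapField Y) x - S.J x ∘L D Y x

/-- The almost complex structure is parallel for the connection `D`. -/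
def IsParallelJ (D : CovariantDerivative I E (fun x : M ↦ TangentSpace I x)) : Prop :=
  ∀ (x : M) (Y : Π x : M, TangentSpace I x), MDiffAt (T% Y) x → S.covDerivJ D Y x = 0

/-- Nearly Kähler: `(∇_X J) Y + (∇_Y J) X = 0` for the Levi-Civita connection. -/
def IsNearlyKahler : Prop :=
  ∀ (x : M) (X Y : Π x : M, TangentSpace I x), MDiffAt (T% X) x → MDiffAt (T% Y) x →
    S.covDerivJ (leviCivita I M) Y x (X x) + S.covDerivJ (leviCivita I M) X x (Y x) = 0

/-- Kähler: `J` is parallel for the Levi-Civita connection. -/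
def IsKahler : Prop := S.IsParallelJ (leviCivita I M)

/-- The Kähler form `Ω(X, Y) = g(X, JY)`. -/
def kahlerForm (x : M) (u v : TangentSpace I x) : ℝ := inner ℝ u (S.J x v)

/-- The canonical hermitian connection `D_X Y = ∇_X Y - (1/2) J (∇_X J) Y`, where `∇` is the
Levi-Civita connection. -/
def canonicalConnection : CovariantDerivative I E (fun x : M ↦ TangentSpace I x) where
  toFun Y x := leviCivita I M Y x - (1 / 2 : ℝ) • (S.J x ∘L S.covDerivJ (leviCivita I M) Y x)
  isCovariantDerivativeOnUniv :=
    { add := by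
        intro Y Y' x hY hY' _
        have e : S.mapField (Y + Y') = S.mapField Y + S.mapField Y' := by
          ext y; simp [mapField]
        ext u
        simp only [covDerivJ, e, (leviCivita I M).isCovariantDerivativeOnUniv.add hY hY',
          (leviCivita I M).isCovariantDerivativeOnUniv.add (S.mdifferentiableAt_mapField hY)
            (S.mdifferentiableAt_mapField hY')]
        simp
        module
      leibniz := by
        intro Y f x hY hf _
        have e : S.mapField (f • Y) = f • S.mapField Y := by
          ext y; simp [mapField]
        ext u
        simp only [covDerivJ, e, (leviCivita I M).isCovariantDerivativeOnUniv.leibniz hY hf,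
          (leviCivita I M).isCovariantDerivativeOnUniv.leibniz
            (S.mdifferentiableAt_mapField hY) hf]
        simp [mapField, S.sq]
        module }

/-- `ψ` is a smooth complex `(n,0)`-form of unit length which is parallel for the connection `D`,
where `D` is itself compatible with `g` and `J`. In other words, `(g, J, ψ)` is a parallel
`SU(n)`-structure (for `dim M = 2n`). The normalisation says that `ψ` has modulus one
on every unitary frame `e₁, …, eₙ`, i.e. `(-1)^{n(n-1)/2} (i/2)^n ψ ∧ ψ̄` is the volume form. -/
structure IsParallelVolumeForm (D : CovariantDerivative I E (fun x : M ↦ TangentSpace I x))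
    {n : ℕ} (ψ : Π x : M, TangentSpace I x [⋀^Fin n]→ₗ[ℝ] ℂ) : Prop where
  isMetricConnection : IsMetricConnection D
  isParallelJ : S.IsParallelJ D
  contMDiff : ∀ (x : M) (X : Fin n → Π x : M, TangentSpace I x),
    (∀ i, ContMDiffAt I I.tangent ∞ (fun y ↦ (⟨y, X i y⟩ : TangentBundle I M)) x) →
    ContMDiffAt I 𝓘(ℝ, ℂ) ∞ (fun y ↦ ψ y (fun i ↦ X i y)) x
  parallel : ∀ (x : M) (X : Fin n → Π x : M, TangentSpace I x),
    (∀ i, MDiffAt (T% (X i)) x) → ∀ u : TangentSpace I x,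
    mvfderiv I (fun y ↦ ψ y (fun i ↦ X i y)) x u =
      ∑ i, ψ x (Function.update (fun j ↦ X j x) i (D (X i) x u))
  type_n_zero : ∀ (x : M) (v : Fin n → TangentSpace I x) (i : Fin n),
    ψ x (Function.update v i (S.J x (v i))) = Complex.I * ψ x v
  norm_eq_one : ∀ (x : M) (e : Fin n → TangentSpace I x),
    Orthonormal ℝ (Sum.elim e (fun i ↦ S.J x (e i))) → ‖ψ x e‖ = 1

end AlmostHermitianStructure

variable {I M}

/-- The real part of a complex-valued form. -/
def reForm {n : ℕ} (ψ : Π x : M, TangentSpace I x [⋀^Fin n]→ₗ[ℝ] ℂ) (x : M) :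
    TangentSpace I x [⋀^Fin n]→ₗ[ℝ] ℝ :=
  Complex.reLm.compAlternatingMap (ψ x)

/-- A generalized calibration: a `k`-form which is at most `1` on every oriented `k`-plane,
evaluated on an orthonormal basis of the plane. (Both orientations of a plane occur.) -/
def IsGeneralizedCalibration {k : ℕ} (φ : Π x : M, TangentSpace I x [⋀^Fin k]→ₗ[ℝ] ℝ) : Prop :=
  ∀ (x : M) (e : Fin k → TangentSpace I x), Orthonormal ℝ e → φ x e ≤ 1

end AlmostHermitian

section Submanifolds

variable {E : Type*} [NormedAddCommGroup E] [NormedSpace ℝ E] [FiniteDimensional ℝ E]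
  [CompleteSpace E]
  {H : Type*} [TopologicalSpace H] {I : ModelWithCorners ℝ E H}
  {M : Type*} [TopologicalSpace M] [ChartedSpace H M] [IsManifold I ∞ M]
  [RiemannianBundle (fun x : M ↦ TangentSpace I x)]
  [IsContMDiffRiemannianBundle I ∞ E (fun x : M ↦ TangentSpace I x)]
  {E' : Type*} [NormedAddCommGroup E'] [NormedSpace ℝ E']
  {H' : Type*} [TopologicalSpace H'] (I' : ModelWithCorners ℝ E' H')
  (L : Type*) [TopologicalSpace L] [ChartedSpace H' L] [IsManifold I' ∞ L]

/-- An orientation of the `k`-dimensional manifold `L`: an orientation of each tangent space which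
near every point is the orientation defined by a smooth local frame. -/
structure ManifoldOrientation (k : ℕ) where
  /-- The orientation of the tangent space at each point. -/
  orientation (p : L) : Orientation ℝ (TangentSpace I' p) (Fin k)
  locally_frame (p : L) : ∃ U ∈ 𝓝 p, ∃ (s : Fin k → Π q : L, TangentSpace I' q)
    (hs : IsLocalFrameOn I' E' ∞ s U),
    ∀ (q : L) (hq : q ∈ U), (hs.toBasisAt hq).orientation = orientation q

/-- The `k`-dimensional manifold `L` is orientable. -/
def IsOrientable (k : ℕ) : Prop := Nonempty (ManifoldOrientation I' L k)

variable {I' L}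

/-- The immersed submanifold `f : L → M` with the orientation `o` is calibrated by `φ`:
`φ(T_p L) = 1` at every point, where `φ` is evaluated on a positively oriented basis of `T_p L` that
is orthonormal for the induced metric. -/
def IsCalibratedBy {k : ℕ} (φ : Π x : M, TangentSpace I x [⋀^Fin k]→ₗ[ℝ] ℝ) (f : L → M)
    (o : ManifoldOrientation I' L k) : Prop :=
  ∀ (p : L) (b : Basis (Fin k) ℝ (TangentSpace I' p)), b.orientation = o.orientation p →
    Orthonormal ℝ (fun i ↦ mfderiv I' I f p (b i)) →
    φ (f p) (fun i ↦ mfderiv I' I f p (b i)) = 1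

/-- `f : L → M` is a smooth immersion which is Lagrangian: the pullback of the Kähler form
vanishes and (the last condition) `2 dim L = dim M`. -/
structure IsLagrangianImmersion (S : AlmostHermitianStructure I M) (f : L → M) : Prop where
  contMDiff : ContMDiff I' I ∞ f
  injective_mfderiv (p : L) : Function.Injective (mfderiv I' I f p)
  pullback_eq_zero (p : L) (u v : TangentSpace I' p) :
    S.kahlerForm (f p) (mfderiv I' I f p u) (mfderiv I' I f p v) = 0
  finrank_eq : 2 * finrank ℝ E' = finrank ℝ E

/-- The covariant derivative `D_u W` at `p` of a vector field `W` along the map `f : L → M`, in the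
pullback to `L` of the connection `D`. If `W = ∑ wᵃ eₐ(f)` in the local frame `eₐ` of `TM` given by
the trivialization at `f p`, it is `∑ dwᵃ(u) eₐ + ∑ wᵃ(p) D_{df(u)} eₐ`. -/
def covDerivAlong (D : CovariantDerivative I E (fun x : M ↦ TangentSpace I x)) (f : L → M)
    (W : Π q : L, TangentSpace I (f q)) (p : L) (u : TangentSpace I' p) : TangentSpace I (f p) :=
  (trivializationAt E (fun x : M ↦ TangentSpace I x) (f p)).symmL ℝ (f p)
      (mvfderiv I' (fun q ↦
        (trivializationAt E (fun x : M ↦ TangentSpace I x) (f p) ⟨f q, W q⟩).2) p u)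
    + D (FiberBundle.extend E (W p)) (f p) (mfderiv I' I f p u)

/-- The second fundamental form `α(u, v)` at `p` of the immersion `f : L → M`: the component of
`∇_u (df(V))` normal to `L`, where `V` is any vector field on `L` extending `v`
and `∇` is the Levi-Civita connection of `M`. -/
def secondFundamentalForm (f : L → M) (p : L) (u v : TangentSpace I' p) : TangentSpace I (f p) :=
  (LinearMap.range (mfderiv I' I f p).toLinearMap)ᗮ.starProjection
    (covDerivAlong (leviCivita I M) f
      (fun q ↦ mfderiv I' I f q (FiberBundle.extend E' v q)) p u)

/-- The immersion `f : L → M` is minimal: its mean curvature vector, the trace of the second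
fundamental form with respect to the induced metric, vanishes. -/
def IsMinimalImmersion (I : ModelWithCorners ℝ E H) {M : Type*} [TopologicalSpace M]
    [ChartedSpace H M] [IsManifold I ∞ M] [RiemannianBundle (fun x : M ↦ TangentSpace I x)]
    [IsContMDiffRiemannianBundle I ∞ E (fun x : M ↦ TangentSpace I x)]
    (I' : ModelWithCorners ℝ E' H') [IsManifold I' ∞ L] (f : L → M) : Prop :=
  ∀ (p : L) (k : ℕ) (b : Basis (Fin k) ℝ (TangentSpace I' p)),
    Orthonormal ℝ (fun i ↦ mfderiv I' I f p (b i)) →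
    ∑ i, secondFundamentalForm (I := I) (I' := I') f p (b i) (b i) = 0

end Submanifolds

end NearlyKahler

end

open NearlyKahler

noncomputable section

namespace NearlyKahler

section Germs

variable {E : Type*} [NormedAddCommGroup E] [NormedSpace ℝ E]
  {H : Type*} [TopologicalSpace H] {I : ModelWithCorners ℝ E H}
  {M : Type*} [TopologicalSpace M] [ChartedSpace H M]
  {F : Type*} [NormedAddCommGroup F] [NormedSpace ℝ F]

lemma mvfderiv_congr_of_eventuallyEq {h k : M → F} {x : M} (e : h =ᶠ[𝓝 x] k) :
    (mvfderiv I h x : TangentSpace I x → F) = mvfderiv I k x := by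
  have := e.mfderiv_eq (I := I) (I' := 𝓘(ℝ, F))
  funext u
  exact congrArg (fun T ↦ T u) this

end Germs

section Coordinates

variable {E : Type*} [NormedAddCommGroup E] [NormedSpace ℝ E]
  {H : Type*} [TopologicalSpace H] {I : ModelWithCorners ℝ E H}
  {M : Type*} [TopologicalSpace M] [ChartedSpace H M] [IsManifold I ∞ M]
  {F : Type*} [NormedAddCommGroup F] [NormedSpace ℝ F]

lemma trivializationAt_snd_eq_mvfderiv {x y : M} (hy : y ∈ (chartAt H x).source)
    (u : TangentSpace I y) :
    (trivializationAt E (fun x : M ↦ TangentSpace I x) x ⟨y, u⟩).2 =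
      mvfderiv I (extChartAt I x) y u := by
  have h := TangentBundle.continuousLinearMapAt_trivializationAt (I := I) hy
  have h' := congrArg (fun T ↦ T u) h
  simp only [Trivialization.continuousLinearMapAt_apply] at h'
  rw [Trivialization.linearMapAt_apply, if_pos (by simpa using hy)] at h'
  exact h'

lemma mvfderiv_extChartAt_extend {x y : M} (hy : y ∈ (chartAt H x).source)
    (v : TangentSpace I x) :
    mvfderiv I (extChartAt I x) y (FiberBundle.extend E v y) =
      mvfderiv I (extChartAt I x) x v := by
  rw [← trivializationAt_snd_eq_mvfderiv hy, ← trivializationAt_snd_eq_mvfderiv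
    (mem_chart_source H x)]
  have : y ∈ (trivializationAt E (fun x : M ↦ TangentSpace I x) x).baseSet := by simpa using hy
  simp only [FiberBundle.extend]
  rw [Trivialization.apply_mk_symm _ this]

lemma eventually_contMDiffAt_extend {x : M} (v : TangentSpace I x) :
    ∀ᶠ y in 𝓝 x, ContMDiffAt I I.tangent ∞
      (fun z ↦ (⟨z, FiberBundle.extend E v z⟩ : TangentBundle I M)) y := by
  obtain ⟨s, hs, h⟩ := FiberBundle.exists_contMDiffOn_extend (k := ∞) I E v
  filter_upwards [eventually_mem_nhds_iff.2 hs] with y hy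
  exact h.contMDiffAt hy

lemma eventually_mdifferentiableAt_extend {x : M} (v : TangentSpace I x) :
    ∀ᶠ y in 𝓝 x, MDiffAt (T% (FiberBundle.extend E v)) y := by
  filter_upwards [eventually_contMDiffAt_extend v] with y hy
  exact hy.mdifferentiableAt (by simp)

variable [I.Boundaryless]

lemma mvfderiv_apply_extend {x y : M} (hy : y ∈ (chartAt H x).source) (v : TangentSpace I x)
    {h : M → F} (hh : MDifferentiableAt I 𝓘(ℝ, F) h y) :
    mvfderiv I h y (FiberBundle.extend E v y) =
      fderiv ℝ (h ∘ (extChartAt I x).symm) (extChartAt I x y)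
        (mvfderiv I (extChartAt I x) x v) := by
  have hy' : y ∈ (extChartAt I x).source := by simpa using hy
  rw [← mvfderiv_extChartAt_extend hy v]
  have hs : MDifferentiableAt 𝓘(ℝ, E) I (extChartAt I x).symm (extChartAt I x y) := by
    have := mdifferentiableWithinAt_extChartAt_symm (I := I) ((extChartAt I x).map_source hy')
    rwa [I.range_eq_univ, mdifferentiableWithinAt_univ] at this
  have hc : MDifferentiableAt I 𝓘(ℝ, E) (extChartAt I x) y := mdifferentiableAt_extChartAt hy
  have hh' : MDifferentiableAt I 𝓘(ℝ, F) h ((extChartAt I x).symm (extChartAt I x y)) := by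
    rwa [(extChartAt I x).left_inv hy']
  have hg : MDifferentiableAt 𝓘(ℝ, E) 𝓘(ℝ, F) (h ∘ (extChartAt I x).symm)
    (extChartAt I x y) := hh'.comp _ hs
  have e : h =ᶠ[𝓝 y] (h ∘ (extChartAt I x).symm) ∘ extChartAt I x := by
    filter_upwards [extChartAt_source_mem_nhds' hy'] with z hz
    simp only [Function.comp_apply, (extChartAt I x).left_inv hz]
  have key : mfderiv I 𝓘(ℝ, F) h y = (mfderiv 𝓘(ℝ, E) 𝓘(ℝ, F) (h ∘ (extChartAt I x).symm)
      (extChartAt I x y)).comp (mfderiv I 𝓘(ℝ, E) (extChartAt I x) y) := by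
    rw [e.mfderiv_eq]
    exact mfderiv_comp y hg hc
  rw [mfderiv_eq_fderiv] at key
  exact congrArg (fun T ↦ T (FiberBundle.extend E v y)) key

lemma contDiffAt_comp_extChartAt_symm {x : M} {h : M → F} {n : ℕ}
    (hh : ContMDiffAt I 𝓘(ℝ, F) n h x) :
    ContDiffAt ℝ n (h ∘ (extChartAt I x).symm) (extChartAt I x x) := by
  have hs : ContMDiffAt 𝓘(ℝ, E) I n (extChartAt I x).symm (extChartAt I x x) := by
    have : IsManifold I n M := IsManifold.of_le (n := ∞) (mod_cast le_top)
    have := contMDiffWithinAt_extChartAt_symm_range (I := I) (n := n) x (mem_extChartAt_target x)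
    rwa [I.range_eq_univ, contMDiffWithinAt_univ] at this
  have hh' : ContMDiffAt I 𝓘(ℝ, F) n h ((extChartAt I x).symm (extChartAt I x x)) := by
    rwa [extChartAt_to_inv]
  exact (hh'.comp _ hs).contDiffAt

lemma eventually_mvfderiv_extend_eq {x : M} {h : M → F} (hh : ContMDiffAt I 𝓘(ℝ, F) 2 h x)
    (w : TangentSpace I x) :
    (fun y ↦ mvfderiv I h y (FiberBundle.extend E w y)) =ᶠ[𝓝 x]
      (fun z ↦ fderiv ℝ (h ∘ (extChartAt I x).symm) z (mvfderiv I (extChartAt I x) x w)) ∘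
        extChartAt I x := by
  filter_upwards [(chartAt H x).open_source.mem_nhds (mem_chart_source H x),
    (contMDiffAt_iff_contMDiffAt_nhds (by simp)).1 hh] with y hy hy'
  exact mvfderiv_apply_extend hy w (hy'.mdifferentiableAt (by simp))

lemma differentiableAt_fderiv_apply {x : M} {h : M → F} (hh : ContMDiffAt I 𝓘(ℝ, F) 2 h x) (a : E) :
    DifferentiableAt ℝ (fun z ↦ fderiv ℝ (h ∘ (extChartAt I x).symm) z a) (extChartAt I x x) :=
  ((((contDiffAt_comp_extChartAt_symm (n := 2) hh).fderiv_right (m := 1)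
    (by norm_num)).differentiableAt (by simp)).clm_apply (differentiableAt_const a))

lemma mdifferentiableAt_mvfderiv_extend {x : M} {h : M → F}
    (hh : ContMDiffAt I 𝓘(ℝ, F) 2 h x) (w : TangentSpace I x) :
    MDifferentiableAt I 𝓘(ℝ, F) (fun y ↦ mvfderiv I h y (FiberBundle.extend E w y)) x := by
  refine MDifferentiableAt.congr_of_eventuallyEq ?_ (eventually_mvfderiv_extend_eq hh w)
  exact MDifferentiableAt.comp x (differentiableAt_fderiv_apply hh _).mdifferentiableAt
    (mdifferentiableAt_extChartAt (mem_chart_source H x))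

lemma mvfderiv_mvfderiv_extend_eq {x : M} {h : M → F} (hh : ContMDiffAt I 𝓘(ℝ, F) 2 h x)
    (v w : TangentSpace I x) :
    mvfderiv I (fun y ↦ mvfderiv I h y (FiberBundle.extend E w y)) x v =
      fderiv ℝ (fderiv ℝ (h ∘ (extChartAt I x).symm)) (extChartAt I x x)
        (mvfderiv I (extChartAt I x) x v) (mvfderiv I (extChartAt I x) x w) := by
  have h1 := mvfderiv_apply_extend (mem_chart_source H x) v (mdifferentiableAt_mvfderiv_extend hh w)
  rw [FiberBundle.extend_apply_self] at h1
  rw [h1]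
  have e : (fun y ↦ mvfderiv I h y (FiberBundle.extend E w y)) ∘ (extChartAt I x).symm
      =ᶠ[𝓝 (extChartAt I x x)]
      fun z ↦ fderiv ℝ (h ∘ (extChartAt I x).symm) z (mvfderiv I (extChartAt I x) x w) := by
    have := (continuousAt_extChartAt_symm (I := I) x).eventually
      (by rw [extChartAt_to_inv]; exact eventually_mvfderiv_extend_eq hh w)
    filter_upwards [this, extChartAt_target_mem_nhds (I := I) x] with z hz hz'
    simp only [Function.comp_apply, (extChartAt I x).right_inv hz'] at hz ⊢
    exact hz
  rw [e.fderiv_eq, fderiv_clm_apply (((contDiffAt_comp_extChartAt_symm (n := 2) hh).fderiv_right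
    (m := 1) (by norm_num)).differentiableAt (by simp)) (differentiableAt_const _)]
  simp

/-- Coordinate vector fields commute as derivations. -/
lemma mvfderiv_mvfderiv_extend_comm {x : M} {h : M → F} (hh : ContMDiffAt I 𝓘(ℝ, F) 2 h x)
    (v w : TangentSpace I x) :
    mvfderiv I (fun y ↦ mvfderiv I h y (FiberBundle.extend E w y)) x v =
      mvfderiv I (fun y ↦ mvfderiv I h y (FiberBundle.extend E v y)) x w := by
  rw [mvfderiv_mvfderiv_extend_eq hh, mvfderiv_mvfderiv_extend_eq hh]
  exact ((contDiffAt_comp_extChartAt_symm (n := 2) hh).isSymmSndFDerivAt (by simp)).eq _ _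

/-- The constant vector field `a` on a vector space. -/
def constField (a : E) : Π z : E, TangentSpace 𝓘(ℝ, E) z := fun _ ↦ a

lemma mlieBracket_constField (a b : E) :
    VectorField.mlieBracket 𝓘(ℝ, E) (constField a) (constField b) = 0 := by
  funext z
  rw [← VectorField.mlieBracketWithin_univ, VectorField.mlieBracketWithin_eq_lieBracketWithin]
  change fderivWithin ℝ (fun _ : E ↦ b) Set.univ z a - fderivWithin ℝ (fun _ : E ↦ a) Set.univ z b
    = 0
  simp

lemma extend_eq_mpullback {x : M} (v : TangentSpace I x) {y : M}
    (hy : y ∈ (chartAt H x).source) :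
    FiberBundle.extend E v y = VectorField.mpullback I 𝓘(ℝ, E) (extChartAt I x)
      (constField (mvfderiv I (extChartAt I x) x v)) y := by
  have hi : (mfderiv I 𝓘(ℝ, E) (extChartAt I x) y).IsInvertible :=
    isInvertible_mfderiv_extChartAt (by simpa using hy)
  rw [VectorField.mpullback_apply]
  exact (hi.inverse_apply_eq.2 (mvfderiv_extChartAt_extend hy v).symm).symm

/-- Coordinate vector fields have vanishing Lie brackets. -/
lemma eventually_mlieBracket_extend_eq_zero [CompleteSpace E] {x : M} (v w : TangentSpace I x) :
    ∀ᶠ y in 𝓝 x, VectorField.mlieBracket I (FiberBundle.extend E v) (FiberBundle.extend E w) y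
      = 0 := by
  filter_upwards [(chartAt H x).open_source.mem_nhds (mem_chart_source H x)] with y hy
  have hn := (chartAt H x).open_source.mem_nhds hy
  have e1 := Filter.eventually_of_mem hn fun z ↦ extend_eq_mpullback v (y := z)
  have e2 := Filter.eventually_of_mem hn fun z ↦ extend_eq_mpullback w (y := z)
  have : IsManifold I (minSmoothness ℝ 3) M := by simp; infer_instance
  have hc : ∀ (a z : E), MDiffAt (T% (constField a)) z := fun a z ↦
    ((contMDiffAt_vectorSpace_iff_contDiffAt (n := 1)).2
      (contDiffAt_const (c := a))).mdifferentiableAt (by simp)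
  rw [Filter.EventuallyEq.mlieBracket_vectorField_eq e1 e2,
    ← VectorField.mpullback_mlieBracket (n := 2) (hc _ _) (hc _ _) (contMDiffAt_extChartAt' hy)
      (by simp), mlieBracket_constField, VectorField.mpullback_zero]
  rfl

end Coordinates

end NearlyKahler

end
noncomputable section

namespace NearlyKahler

section Along

variable {E : Type*} [NormedAddCommGroup E] [NormedSpace ℝ E] [FiniteDimensional ℝ E]
  {H : Type*} [TopologicalSpace H] {I : ModelWithCorners ℝ E H}
  {M : Type*} [TopologicalSpace M] [ChartedSpace H M] [IsManifold I ∞ M]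
  {E' : Type*} [NormedAddCommGroup E'] [NormedSpace ℝ E']
  {H' : Type*} [TopologicalSpace H'] {I' : ModelWithCorners ℝ E' H'}
  {L : Type*} [TopologicalSpace L] [ChartedSpace H' L]
  {G : Type*} [NormedAddCommGroup G] [NormedSpace ℝ G]

variable (I I') in
/-- The vector field `W` along `f` is differentiable at `p`. -/
def DifferentiableAlongAt (f : L → M) (W : Π q : L, TangentSpace I (f q)) (p : L) : Prop :=
  MDifferentiableAt I' 𝓘(ℝ, E) (fun q ↦
    (trivializationAt E (fun x : M ↦ TangentSpace I x) (f p) ⟨f q, W q⟩).2) p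

lemma DifferentiableAlongAt.comp {f : L → M} {p : L} (hf : MDifferentiableAt I' I f p)
    {Y : Π x : M, TangentSpace I x} (hY : MDiffAt (T% Y) (f p)) :
    DifferentiableAlongAt I I' f (fun q ↦ Y (f q)) p := by
  have h := (mdifferentiableAt_section I _).1 hY
  exact MDifferentiableAt.comp (g := fun y ↦
    (trivializationAt E (fun x : M ↦ TangentSpace I x) (f p) ⟨y, Y y⟩).2) p h hf

lemma mdifferentiableAt_trivializationAt_snd {Y : Π x : M, TangentSpace I x} {x : M}
    (hY : MDiffAt (T% Y) x) : MDifferentiableAt I 𝓘(ℝ, E) (fun y ↦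
      (trivializationAt E (fun x : M ↦ TangentSpace I x) x ⟨y, Y y⟩).2) x :=
  (mdifferentiableAt_section I _).1 hY

lemma extend_eq_symmL {x : M} (v : TangentSpace I x) {y : M}
    (hy : y ∈ (trivializationAt E (fun x : M ↦ TangentSpace I x) x).baseSet) :
    FiberBundle.extend E v y = (trivializationAt E (fun x : M ↦ TangentSpace I x) x).symmL ℝ y
      ((trivializationAt E (fun x : M ↦ TangentSpace I x) x).continuousLinearMapAt ℝ x v) := by
  rw [Trivialization.continuousLinearMapAt_apply_of_mem _ _
    (FiberBundle.mem_baseSet_trivializationAt' x)]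
  exact (Trivialization.symmL_apply _ hy _).symm

lemma extend_add {x : M} (v w : TangentSpace I x) :
    ∀ᶠ y in 𝓝 x, FiberBundle.extend E (v + w) y =
      (FiberBundle.extend E v + FiberBundle.extend E w) y := by
  filter_upwards [(trivializationAt E (fun x : M ↦ TangentSpace I x) x).open_baseSet.mem_nhds
    (FiberBundle.mem_baseSet_trivializationAt' x)] with y hy
  rw [Pi.add_apply, extend_eq_symmL _ hy, extend_eq_symmL _ hy, extend_eq_symmL _ hy, map_add,
    map_add]

lemma extend_smul {x : M} (c : ℝ) (v : TangentSpace I x) :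
    ∀ᶠ y in 𝓝 x, FiberBundle.extend E (c • v) y = (c • FiberBundle.extend E v) y := by
  filter_upwards [(trivializationAt E (fun x : M ↦ TangentSpace I x) x).open_baseSet.mem_nhds
    (FiberBundle.mem_baseSet_trivializationAt' x)] with y hy
  rw [Pi.smul_apply, extend_eq_symmL _ hy, extend_eq_symmL _ hy, map_smul, map_smul]

lemma eq_sum_smul_extend {ι : Type*} [Fintype ι] (β : Basis ι ℝ E) {x y : M}
    (hy : y ∈ (trivializationAt E (fun x : M ↦ TangentSpace I x) x).baseSet)
    (w : TangentSpace I y) :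
    w = ∑ a, β.repr (trivializationAt E (fun x : M ↦ TangentSpace I x) x ⟨y, w⟩).2 a •
      FiberBundle.extend E
        ((trivializationAt E (fun x : M ↦ TangentSpace I x) x).symmL ℝ x (β a)) y := by
  simp only [extend_eq_symmL _ hy, Trivialization.continuousLinearMapAt_symmL _
    (FiberBundle.mem_baseSet_trivializationAt' x)]
  conv_lhs => rw [← Trivialization.symmL_continuousLinearMapAt (R := ℝ)
    (trivializationAt E (fun x : M ↦ TangentSpace I x) x) hy w,
    Trivialization.continuousLinearMapAt_apply_of_mem _ _ hy]
  conv_lhs => rw [← β.sum_repr (trivializationAt E (fun x : M ↦ TangentSpace I x) x ⟨y, w⟩).2]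
  simp only [map_sum, map_smul]

lemma mvfderiv_sum {ι : Type*} (s : Finset ι) {h : ι → L → G} {p : L}
    (hh : ∀ i ∈ s, MDifferentiableAt I' 𝓘(ℝ, G) (h i) p) (u : TangentSpace I' p) :
    MDifferentiableAt I' 𝓘(ℝ, G) (fun q ↦ ∑ i ∈ s, h i q) p ∧
    mvfderiv I' (fun q ↦ ∑ i ∈ s, h i q) p u = ∑ i ∈ s, mvfderiv I' (h i) p u := by
  classical
  induction s using Finset.induction_on with
  | empty => simpa using ⟨mdifferentiableAt_const, by rw [mvfderiv_const]; rfl⟩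
  | insert a s ha ih =>
    obtain ⟨h1, h2⟩ := ih fun i hi ↦ hh i (Finset.mem_insert_of_mem hi)
    have h0 := hh a (Finset.mem_insert_self a s)
    simp only [Finset.sum_insert ha]
    refine ⟨h0.add h1, ?_⟩
    rw [mvfderiv_fun_add h0 h1, add_apply, h2]

lemma mvfderiv_clm_comp {F : Type*} [NormedAddCommGroup F] [NormedSpace ℝ F] (c : F →L[ℝ] G)
    {h : L → F} {p : L} (hh : MDifferentiableAt I' 𝓘(ℝ, F) h p) (u : TangentSpace I' p) :
    MDifferentiableAt I' 𝓘(ℝ, G) (fun q ↦ c (h q)) p ∧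
    mvfderiv I' (fun q ↦ c (h q)) p u = c (mvfderiv I' h p u) := by
  have hc : MDifferentiableAt 𝓘(ℝ, F) 𝓘(ℝ, G) c (h p) := c.mdifferentiableAt
  refine ⟨hc.comp p hh, ?_⟩
  have := mfderiv_comp p hc hh
  rw [ContinuousLinearMap.mfderiv_eq] at this
  exact congrArg (fun T ↦ T u) this

variable (D : CovariantDerivative I E (fun x : M ↦ TangentSpace I x))

/-- The derivative at `x` of the vector field that extends `v` and is constant in the
trivialization at `x`; it depends linearly on `v`. -/
def covDerivExtend (x : M) :
    TangentSpace I x →ₗ[ℝ] (TangentSpace I x →L[ℝ] TangentSpace I x) where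
  toFun v := D (FiberBundle.extend E v) x
  map_add' v w := by
    have hv := FiberBundle.mdifferentiableAt_extend I E v
    have hw := FiberBundle.mdifferentiableAt_extend I E w
    rw [← D.isCovariantDerivativeOnUniv.add hv hw]
    exact D.isCovariantDerivativeOnUniv.congr_of_eventuallyEq
      (FiberBundle.mdifferentiableAt_extend I E _) (mdifferentiableAt_add_section hv hw)
      Filter.univ_mem (extend_add v w)
  map_smul' c v := by
    have hv := FiberBundle.mdifferentiableAt_extend I E v
    rw [RingHom.id_apply, ← D.isCovariantDerivativeOnUniv.smul_const c hv]
    exact D.isCovariantDerivativeOnUniv.congr_of_eventuallyEq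
      (FiberBundle.mdifferentiableAt_extend I E _)
      ((mdifferentiableAt_const (c := c)).smul_section hv) Filter.univ_mem (extend_smul c v)

lemma covDerivExtend_apply {x : M} (v : TangentSpace I x) :
    D (FiberBundle.extend E v) x = covDerivExtend D x v := rfl

lemma covDerivAlong_id {Y : Π x : M, TangentSpace I x} {x : M} (hY : MDiffAt (T% Y) x)
    (u : TangentSpace I x) :
    covDerivAlong (I := I) (I' := I) D (fun y ↦ y) Y x u = D Y x u := by
  set e := trivializationAt E (fun x : M ↦ TangentSpace I x) x with he
  have hx : x ∈ e.baseSet := FiberBundle.mem_baseSet_trivializationAt' x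
  have hD := D.isCovariantDerivativeOnUniv
  have key : TensorialAt I E (fun Y : Π x : M, TangentSpace I x ↦
      D Y x u - e.symmL ℝ x (mvfderiv I (fun y ↦ (e ⟨y, Y y⟩).2) x u)
        - covDerivExtend D x (Y x) u) x :=
    { smul := by
        intro g Y hg hY
        have h1 : (fun y ↦ (e ⟨y, (g • Y) y⟩).2) =ᶠ[𝓝 x] fun y ↦ g y • (e ⟨y, Y y⟩).2 := by
          filter_upwards [e.open_baseSet.mem_nhds hx] with y hy
          simp only [← Trivialization.continuousLinearMapAt_apply_of_mem (R := ℝ) _ hy]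
          simp
        rw [mvfderiv_congr_of_eventuallyEq h1,
          mvfderiv_fun_smul hg (mdifferentiableAt_trivializationAt_snd hY), hD.leibniz hY hg,
          Pi.smul_apply', map_smul]
        simp only [add_apply, smul_apply, map_add, map_smul,
          ContinuousLinearMap.smulRight_apply]
        have h2 : e.symmL ℝ x (e ⟨x, Y x⟩).2 = Y x := by
          rw [← Trivialization.continuousLinearMapAt_apply_of_mem (R := ℝ) _ hx,
            Trivialization.symmL_continuousLinearMapAt (R := ℝ) _ hx]
        rw [h2]
        module
      add := by
        intro Y Y' hY hY'
        have h1 : (fun y ↦ (e ⟨y, (Y + Y') y⟩).2) =ᶠ[𝓝 x]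
            fun y ↦ (e ⟨y, Y y⟩).2 + (e ⟨y, Y' y⟩).2 := by
          filter_upwards [e.open_baseSet.mem_nhds hx] with y hy
          simp only [← Trivialization.continuousLinearMapAt_apply_of_mem (R := ℝ) _ hy]
          simp
        rw [mvfderiv_congr_of_eventuallyEq h1,
          mvfderiv_fun_add (mdifferentiableAt_trivializationAt_snd hY)
            (mdifferentiableAt_trivializationAt_snd hY'), hD.add hY hY',
          Pi.add_apply, map_add]
        simp only [add_apply, map_add]
        module }
  have h2 := key.pointwise hY (FiberBundle.mdifferentiableAt_extend I E (Y x))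
    (FiberBundle.extend_apply_self E (Y x)).symm
  have h3 : (fun y ↦ (e ⟨y, FiberBundle.extend E (Y x) y⟩).2) =ᶠ[𝓝 x]
      fun _ ↦ (e ⟨x, Y x⟩).2 := by
    filter_upwards [e.open_baseSet.mem_nhds hx] with y hy
    simp only [FiberBundle.extend]
    rw [Trivialization.apply_mk_symm _ hy]
  rw [FiberBundle.extend_apply_self, mvfderiv_congr_of_eventuallyEq h3, mvfderiv_const,
    zero_apply, map_zero, sub_zero, covDerivExtend_apply, sub_self] at h2
  have h4 : mfderiv I I (fun y : M ↦ y) x u = u := by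
    rw [show (fun y : M ↦ y) = id from rfl, mfderiv_id]
    rfl
  rw [covDerivAlong, h4]
  rw [sub_sub, sub_eq_zero] at h2
  exact h2.symm

lemma isLinearMap_of_leibniz {f : L → M} {p : L} (hf : MDifferentiableAt I' I f p)
    {φ : Π q : L, TangentSpace I (f q) →ₗ[ℝ] G} {φ' : TangentSpace I (f p) → G}
    {u : TangentSpace I' p}
    (hφ : ∀ v : TangentSpace I (f p),
      MDifferentiableAt I' 𝓘(ℝ, G) (fun q ↦ φ q (FiberBundle.extend E v (f q))) p ∧
      mvfderiv I' (fun q ↦ φ q (FiberBundle.extend E v (f q))) p u =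
        φ' v + φ p (D (FiberBundle.extend E v) (f p) (mfderiv I' I f p u))) :
    IsLinearMap ℝ φ' where
  map_add v w := by
    have e : (fun q ↦ φ q (FiberBundle.extend E (v + w) (f q))) =ᶠ[𝓝 p]
        fun q ↦ φ q (FiberBundle.extend E v (f q)) + φ q (FiberBundle.extend E w (f q)) := by
      filter_upwards [hf.continuousAt.eventually (extend_add v w)] with q hq
      rw [hq, Pi.add_apply, map_add]
    have h := (hφ (v + w)).2
    rw [mvfderiv_congr_of_eventuallyEq e, mvfderiv_fun_add (hφ v).1 (hφ w).1, add_apply, (hφ v).2,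
      (hφ w).2, covDerivExtend_apply, covDerivExtend_apply, covDerivExtend_apply, map_add,
      add_apply, map_add] at h
    rw [← sub_eq_zero] at h ⊢
    rw [← neg_eq_zero, ← h]
    abel
  map_smul c v := by
    have e : (fun q ↦ φ q (FiberBundle.extend E (c • v) (f q))) =ᶠ[𝓝 p]
        fun q ↦ c • φ q (FiberBundle.extend E v (f q)) := by
      filter_upwards [hf.continuousAt.eventually (extend_smul c v)] with q hq
      rw [hq, Pi.smul_apply, map_smul]
    have h := (hφ (c • v)).2
    rw [mvfderiv_congr_of_eventuallyEq e, mvfderiv_fun_smul mdifferentiableAt_const (hφ v).1,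
      mvfderiv_const, covDerivExtend_apply, map_smul] at h
    simp only [add_apply, smul_apply, (hφ v).2, covDerivExtend_apply, map_smul, smul_add,
      ContinuousLinearMap.smulRight_apply, zero_apply, zero_smul, add_zero] at h
    exact (add_right_cancel h).symm

/-- The Leibniz rule for the contraction of a one-form and a vector field along a map `f`, if it
holds for the vector fields that are constant in the trivialization at `f p`. -/
lemma mvfderiv_apply_along {f : L → M} {p : L} (hf : MDifferentiableAt I' I f p)
    {φ : Π q : L, TangentSpace I (f q) →ₗ[ℝ] G} {φ' : TangentSpace I (f p) → G}
    {u : TangentSpace I' p}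
    (hφ : ∀ v : TangentSpace I (f p),
      MDifferentiableAt I' 𝓘(ℝ, G) (fun q ↦ φ q (FiberBundle.extend E v (f q))) p ∧
      mvfderiv I' (fun q ↦ φ q (FiberBundle.extend E v (f q))) p u =
        φ' v + φ p (D (FiberBundle.extend E v) (f p) (mfderiv I' I f p u)))
    {W : Π q : L, TangentSpace I (f q)} (hW : DifferentiableAlongAt I I' f W p) :
    MDifferentiableAt I' 𝓘(ℝ, G) (fun q ↦ φ q (W q)) p ∧
      mvfderiv I' (fun q ↦ φ q (W q)) p u = φ' (W p) + φ p (covDerivAlong D f W p u) := by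
  set e := trivializationAt E (fun x : M ↦ TangentSpace I x) (f p) with he
  have hp : f p ∈ e.baseSet := FiberBundle.mem_baseSet_trivializationAt' (f p)
  let β := Module.finBasis ℝ E
  let ε : Fin (finrank ℝ E) → TangentSpace I (f p) := fun a ↦ e.symmL ℝ (f p) (β a)
  let c : Fin (finrank ℝ E) → E →L[ℝ] ℝ := fun a ↦ LinearMap.toContinuousLinearMap (β.coord a)
  have e1 : (fun q ↦ φ q (W q)) =ᶠ[𝓝 p] fun q ↦ ∑ a, c a (e ⟨f q, W q⟩).2 •
      φ q (FiberBundle.extend E (ε a) (f q)) := by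
    filter_upwards [hf.continuousAt.preimage_mem_nhds (e.open_baseSet.mem_nhds hp)] with q hq
    conv_lhs => rw [eq_sum_smul_extend β hq (W q)]
    rw [map_sum]
    exact Finset.sum_congr rfl fun a _ ↦ by rw [map_smul]; rfl
  have h1 := fun a ↦ mvfderiv_clm_comp (c a) hW u
  obtain ⟨h3, h4⟩ := mvfderiv_sum Finset.univ (h := fun a q ↦ c a (e ⟨f q, W q⟩).2 •
    φ q (FiberBundle.extend E (ε a) (f q))) (fun a _ ↦ (h1 a).1.smul (hφ (ε a)).1) u
  refine ⟨h3.congr_of_eventuallyEq e1, ?_⟩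
  have hW0 : W p = ∑ a, c a (e ⟨f p, W p⟩).2 • ε a := by
    conv_lhs => rw [eq_sum_smul_extend β hp (W p)]
    simp only [FiberBundle.extend_apply_self]
    rfl
  have hD : D (FiberBundle.extend E (W p)) (f p) =
      ∑ a, c a (e ⟨f p, W p⟩).2 • D (FiberBundle.extend E (ε a)) (f p) := by
    simp only [covDerivExtend_apply]
    conv_lhs => rw [hW0]
    simp only [map_sum, map_smul]
  have hd : e.symmL ℝ (f p) (mvfderiv I' (fun q ↦ (e ⟨f q, W q⟩).2) p u) =
      ∑ a, c a (mvfderiv I' (fun q ↦ (e ⟨f q, W q⟩).2) p u) • ε a := by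
    conv_lhs => rw [← β.sum_repr (mvfderiv I' (fun q ↦ (e ⟨f q, W q⟩).2) p u)]
    simp only [map_sum, map_smul]
    rfl
  rw [mvfderiv_congr_of_eventuallyEq e1, h4, show covDerivAlong D f W p u = e.symmL ℝ (f p)
    (mvfderiv I' (fun q ↦ (e ⟨f q, W q⟩).2) p u) + D (FiberBundle.extend E (W p)) (f p)
      (mfderiv I' I f p u) from rfl, hD, hd]
  have hφ' : φ' (W p) = ∑ a, c a (e ⟨f p, W p⟩).2 • φ' (ε a) := by
    change (isLinearMap_of_leibniz D hf hφ).mk' φ' (W p) =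
      ∑ a, c a (e ⟨f p, W p⟩).2 • (isLinearMap_of_leibniz D hf hφ).mk' φ' (ε a)
    conv_lhs => rw [hW0]
    simp only [map_sum, map_smul]
  rw [hφ']
  simp only [sum_apply, smul_apply, map_add, map_sum,
    map_smul, ← Finset.sum_add_distrib]
  refine Finset.sum_congr rfl fun a _ ↦ ?_
  rw [mvfderiv_fun_smul (h1 a).1 (hφ (ε a)).1]
  simp only [add_apply, smul_apply,
    ContinuousLinearMap.smulRight_apply, (h1 a).2, (hφ (ε a)).2, FiberBundle.extend_apply_self]
  module

end Along

end NearlyKahler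

end
noncomputable section

namespace NearlyKahler

section PointwiseAlgebra

variable {V : Type*} [NormedAddCommGroup V] [InnerProductSpace ℝ V]

local notation "⟪" x ", " y "⟫" => inner ℝ x y

/-- `J` is an orthogonal complex structure on the euclidean space `V`. -/
structure IsOrthogonalComplexStructure (J : V →ₗ[ℝ] V) : Prop where
  sq (v : V) : J (J v) = -v
  inner_map (u v : V) : ⟪J u, J v⟫ = ⟪u, v⟫

/-- The trilinear form `⟪B u v, w⟫` is alternating and of type `(3,0) + (0,3)`. -/
structure IsNearlyKahlerTensor (J : V →ₗ[ℝ] V) (B : V →ₗ[ℝ] V →ₗ[ℝ] V) : Prop where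
  swap (u v : V) : B u v = -B v u
  skew (u v w : V) : ⟪B u v, w⟫ = -⟪B u w, v⟫
  map_right (u v : V) : B u (J v) = -J (B u v)

/-- `e₁, e₂, e₃` is a unitary frame. -/
def IsUnitaryFrame (J : V →ₗ[ℝ] V) (e : Fin 3 → V) : Prop :=
  Orthonormal ℝ (Sum.elim e fun i ↦ J (e i))

variable {J : V →ₗ[ℝ] V} {B : V →ₗ[ℝ] V →ₗ[ℝ] V}

namespace IsOrthogonalComplexStructure

variable (hJ : IsOrthogonalComplexStructure J)
include hJ

lemma inner_left (u v : V) : ⟪J u, v⟫ = -⟪u, J v⟫ := by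
  rw [← hJ.inner_map u (J v), hJ.sq, inner_neg_right, neg_neg]

lemma inner_self (u : V) : ⟪u, J u⟫ = 0 := by
  have := hJ.inner_left u u
  rw [real_inner_comm] at this
  linarith

end IsOrthogonalComplexStructure

namespace IsUnitaryFrame

variable {e : Fin 3 → V} (he : IsUnitaryFrame J e)
include he

lemma inner_eq (i j : Fin 3) : ⟪e i, e j⟫ = if i = j then 1 else 0 := by
  simpa using orthonormal_iff_ite.1 he (Sum.inl i) (Sum.inl j)

lemma inner_map (i j : Fin 3) : ⟪e i, J (e j)⟫ = 0 := by
  simpa using orthonormal_iff_ite.1 he (Sum.inl i) (Sum.inr j)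

lemma map_inner (i j : Fin 3) : ⟪J (e i), e j⟫ = 0 := by
  simpa using orthonormal_iff_ite.1 he (Sum.inr i) (Sum.inl j)

lemma map_inner_map (i j : Fin 3) : ⟪J (e i), J (e j)⟫ = if i = j then 1 else 0 := by
  simpa using orthonormal_iff_ite.1 he (Sum.inr i) (Sum.inr j)

end IsUnitaryFrame

/-- The vector with real coordinates `x, y` in a unitary frame. -/
def ofCoords (J : V →ₗ[ℝ] V) (e : Fin 3 → V) (x y : Fin 3 → ℝ) : V :=
  x 0 • e 0 + x 1 • e 1 + x 2 • e 2 + (y 0 • J (e 0) + y 1 • J (e 1) + y 2 • J (e 2))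

lemma IsUnitaryFrame.eq_ofCoords [FiniteDimensional ℝ V] (hV : finrank ℝ V = 6) {e : Fin 3 → V}
    (he : IsUnitaryFrame J e) (v : V) :
    v = ofCoords J e (fun i ↦ ⟪e i, v⟫) (fun i ↦ ⟪J (e i), v⟫) := by
  have he' : Orthonormal ℝ (Sum.elim e fun i ↦ J (e i)) := he
  have hspan := he'.linearIndependent.span_eq_top_of_card_eq_finrank' (by simp [hV])
  let b := OrthonormalBasis.mk he' hspan.ge
  have := b.sum_repr' v
  conv_lhs => rw [← this]
  simp only [b, ofCoords, Fin.sum_univ_three, Fintype.sum_sum_type, OrthonormalBasis.coe_mk,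
    Sum.elim_inl, Sum.elim_inr]

lemma IsUnitaryFrame.inner_ofCoords {e : Fin 3 → V} (he : IsUnitaryFrame J e)
    (x y z w : Fin 3 → ℝ) :
    ⟪ofCoords J e x y, ofCoords J e z w⟫ =
      x 0 * z 0 + x 1 * z 1 + x 2 * z 2 + (y 0 * w 0 + y 1 * w 1 + y 2 * w 2) := by
  simp only [ofCoords, inner_add_left, inner_add_right, real_inner_smul_left,
    real_inner_smul_right, he.inner_eq, he.inner_map, he.map_inner, he.map_inner_map]
  simp
  ring

lemma IsOrthogonalComplexStructure.map_ofCoords (hJ : IsOrthogonalComplexStructure J)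
    (e : Fin 3 → V) (x y : Fin 3 → ℝ) : J (ofCoords J e x y) = ofCoords J e (-y) x := by
  simp only [ofCoords, map_add, map_smul, hJ.sq, Pi.neg_apply]
  module

namespace IsNearlyKahlerTensor

variable (hB : IsNearlyKahlerTensor J B) (hJ : IsOrthogonalComplexStructure J)
include hB

lemma self (u : V) : B u u = 0 := by
  have := hB.swap u u
  rw [eq_neg_iff_add_eq_zero, ← two_smul ℝ] at this
  exact (smul_eq_zero.1 this).resolve_left two_ne_zero

lemma map_left (u v : V) : B (J u) v = -J (B u v) := by
  rw [hB.swap, hB.map_right, hB.swap v u, map_neg, neg_neg]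

lemma inner_right (u v : V) : ⟪B u v, v⟫ = 0 := by
  have := hB.skew u v v
  linarith

lemma inner_left (u v : V) : ⟪B u v, u⟫ = 0 := by
  rw [hB.swap, inner_neg_left, hB.inner_right, neg_zero]

include hJ

lemma inner_map_shift (u v w : V) : ⟪B u v, J w⟫ = ⟪B u (J v), w⟫ := by
  rw [hB.map_right, inner_neg_left, hJ.inner_left, neg_neg]

lemma inner_map_right (u v : V) : ⟪B u v, J v⟫ = 0 := by
  rw [hB.skew, hB.map_right, inner_neg_left, hJ.inner_left, inner_map_shift hB hJ,
    hB.map_right, inner_neg_left, hJ.inner_left, neg_neg]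
  have h1 := hB.skew u v (J v)
  have h2 := inner_map_shift hB hJ u v v
  linarith

lemma inner_map_left (u v : V) : ⟪B u v, J u⟫ = 0 := by
  rw [hB.swap, inner_neg_left, inner_map_right hB hJ, neg_zero]

/-- The value of `B` in the coordinates given by a unitary frame. -/
lemma apply_ofCoords [FiniteDimensional ℝ V] (hV : finrank ℝ V = 6) {e : Fin 3 → V}
    (he : IsUnitaryFrame J e) (x y z w : Fin 3 → ℝ) :
    ∀ α β : ℝ, α = ⟪B (e 0) (e 1), e 2⟫ → β = ⟪B (e 0) (e 1), J (e 2)⟫ →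
    B (ofCoords J e x y) (ofCoords J e z w) =
    ofCoords J e
      ![α * (x 1 * z 2 - x 2 * z 1 - y 1 * w 2 + y 2 * w 1)
          + β * (x 1 * w 2 - x 2 * w 1 + y 1 * z 2 - y 2 * z 1),
        α * (x 2 * z 0 - x 0 * z 2 - y 2 * w 0 + y 0 * w 2)
          + β * (x 2 * w 0 - x 0 * w 2 + y 2 * z 0 - y 0 * z 2),
        α * (x 0 * z 1 - x 1 * z 0 - y 0 * w 1 + y 1 * w 0)
          + β * (x 0 * w 1 - x 1 * w 0 + y 0 * z 1 - y 1 * z 0)]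
      ![β * (x 1 * z 2 - x 2 * z 1 - y 1 * w 2 + y 2 * w 1)
          - α * (x 1 * w 2 - x 2 * w 1 + y 1 * z 2 - y 2 * z 1),
        β * (x 2 * z 0 - x 0 * z 2 - y 2 * w 0 + y 0 * w 2)
          - α * (x 2 * w 0 - x 0 * w 2 + y 2 * z 0 - y 0 * z 2),
        β * (x 0 * z 1 - x 1 * z 0 - y 0 * w 1 + y 1 * w 0)
          - α * (x 0 * w 1 - x 1 * w 0 + y 0 * z 1 - y 1 * z 0)] := by
  intro α β hα hβ
  have h01 : B (e 0) (e 1) = α • e 2 + β • J (e 2) := by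
    conv_lhs => rw [he.eq_ofCoords hV (B (e 0) (e 1))]
    simp only [ofCoords, real_inner_comm _ (e _), real_inner_comm _ (J (e _)), ← hα, ← hβ,
      hB.inner_left, hB.inner_right, inner_map_left hB hJ, inner_map_right hB hJ]
    module
  have h12 : B (e 1) (e 2) = α • e 0 + β • J (e 0) := by
    have a1 : ⟪B (e 1) (e 2), e 0⟫ = α := by
      rw [hB.skew, hB.swap, inner_neg_left, neg_neg, hα]
    have a2 : ⟪B (e 1) (e 2), J (e 0)⟫ = β := by
      rw [hB.skew, hB.map_right, hB.swap, map_neg, neg_neg, hβ, hJ.inner_left, neg_neg]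
    conv_lhs => rw [he.eq_ofCoords hV (B (e 1) (e 2))]
    simp only [ofCoords, real_inner_comm _ (e _), real_inner_comm _ (J (e _)), a1, a2,
      hB.inner_left, hB.inner_right, inner_map_left hB hJ, inner_map_right hB hJ]
    module
  have h20 : B (e 2) (e 0) = α • e 1 + β • J (e 1) := by
    have a1 : ⟪B (e 2) (e 0), e 1⟫ = α := by
      rw [hB.swap, inner_neg_left, hB.skew, neg_neg, hα]
    have a2 : ⟪B (e 2) (e 0), J (e 1)⟫ = β := by
      rw [hB.swap, inner_neg_left, hB.skew, neg_neg, hB.map_right, inner_neg_left, hJ.inner_left,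
        neg_neg, hβ]
    conv_lhs => rw [he.eq_ofCoords hV (B (e 2) (e 0))]
    simp only [ofCoords, real_inner_comm _ (e _), real_inner_comm _ (J (e _)), a1, a2,
      hB.inner_left, hB.inner_right, inner_map_left hB hJ, inner_map_right hB hJ]
    module
  simp only [ofCoords, map_add, map_smul, LinearMap.add_apply, LinearMap.smul_apply, hB.map_left,
    hB.map_right, hB.self, hB.swap (e 1) (e 0), hB.swap (e 2) (e 1), hB.swap (e 0) (e 2), h01, h12,
    h20, map_neg, hJ.sq, Matrix.cons_val, map_zero]
  module

/-- In dimension six, `B` has constant type. -/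
lemma exists_constantType [FiniteDimensional ℝ V] (hV : finrank ℝ V = 6) {e : Fin 3 → V}
    (he : IsUnitaryFrame J e) (a b c d : V) :
    ⟪B a b, B c d⟫ = (⟪B (e 0) (e 1), e 2⟫ ^ 2 + ⟪B (e 0) (e 1), J (e 2)⟫ ^ 2) *
      (⟪a, c⟫ * ⟪b, d⟫ - ⟪a, d⟫ * ⟪b, c⟫ - ⟪a, J c⟫ * ⟪b, J d⟫ + ⟪a, J d⟫ * ⟪b, J c⟫) := by
  generalize hα : ⟪B (e 0) (e 1), e 2⟫ = α
  generalize hβ : ⟪B (e 0) (e 1), J (e 2)⟫ = β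
  obtain ⟨x, y, rfl⟩ : ∃ x y, a = ofCoords J e x y := ⟨_, _, he.eq_ofCoords hV a⟩
  obtain ⟨z, w, rfl⟩ : ∃ x y, b = ofCoords J e x y := ⟨_, _, he.eq_ofCoords hV b⟩
  obtain ⟨p, q, rfl⟩ : ∃ x y, c = ofCoords J e x y := ⟨_, _, he.eq_ofCoords hV c⟩
  obtain ⟨r, s, rfl⟩ : ∃ x y, d = ofCoords J e x y := ⟨_, _, he.eq_ofCoords hV d⟩
  simp only [apply_ofCoords hB hJ hV he _ _ _ _ α β hα.symm hβ.symm, hJ.map_ofCoords,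
    he.inner_ofCoords, Matrix.cons_val, Pi.neg_apply]
  ring

end IsNearlyKahlerTensor

end PointwiseAlgebra

end NearlyKahler

end
noncomputable section

namespace NearlyKahler

section PointwiseForms

variable {V : Type*} [NormedAddCommGroup V] [InnerProductSpace ℝ V]

local notation "⟪" x ", " y "⟫" => inner ℝ x y

variable {J : V →ₗ[ℝ] V} {B : V →ₗ[ℝ] V →ₗ[ℝ] V}

lemma exists_unit_orthogonal [FiniteDimensional ℝ V] (s : Finset V) (hs : s.card < finrank ℝ V) :
    ∃ v : V, ‖v‖ = 1 ∧ ∀ x ∈ s, ⟪x, v⟫ = 0 := by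
  have h1 : Submodule.span ℝ (s : Set V) ≠ ⊤ := by
    intro h
    have := finrank_span_finset_le_card (R := ℝ) s
    rw [Set.finrank, h, finrank_top] at this
    omega
  have h2 : (Submodule.span ℝ (s : Set V))ᗮ ≠ ⊥ := by
    rwa [Ne, Submodule.orthogonal_eq_bot_iff]
  obtain ⟨v, hv, hv0⟩ := Submodule.exists_mem_ne_zero_of_ne_bot h2
  refine ⟨(‖v‖⁻¹ : ℝ) • v, norm_smul_inv_norm hv0, fun x hx ↦ ?_⟩
  rw [real_inner_smul_right, (Submodule.mem_orthogonal _ _).1 hv x (Submodule.subset_span hx),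
    mul_zero]

lemma IsOrthogonalComplexStructure.isUnitaryFrame (hJ : IsOrthogonalComplexStructure J)
    {e : Fin 3 → V} (he : Orthonormal ℝ e) (he' : ∀ i j, ⟪e i, J (e j)⟫ = 0) :
    IsUnitaryFrame J e := by
  rw [IsUnitaryFrame, orthonormal_iff_ite]
  rw [orthonormal_iff_ite] at he
  rintro (i | i) (j | j)
  · simpa using he i j
  · simpa using he' i j
  · simpa [hJ.inner_left] using he' i j
  · simpa [hJ.inner_map] using he i j

lemma IsOrthogonalComplexStructure.exists_isUnitaryFrame [FiniteDimensional ℝ V]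
    (hJ : IsOrthogonalComplexStructure J) (hV : finrank ℝ V = 6) {u : V} (hu : ‖u‖ = 1) :
    ∃ e : Fin 3 → V, e 0 = u ∧ IsUnitaryFrame J e := by
  classical
  obtain ⟨v, hv, hv'⟩ := exists_unit_orthogonal {u, J u}
    (by rw [hV]; exact Finset.card_le_two.trans_lt (by norm_num))
  obtain ⟨w, hw, hw'⟩ := exists_unit_orthogonal {u, J u, v, J v}
    (by rw [hV]; exact Finset.card_le_four.trans_lt (by norm_num))
  simp only [Finset.mem_insert, Finset.mem_singleton, forall_eq_or_imp, forall_eq] at hv' hw'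
  refine ⟨![u, v, w], rfl, hJ.isUnitaryFrame ?_ ?_⟩
  · rw [orthonormal_iff_ite]
    intro i j
    fin_cases i <;> fin_cases j <;>
      simp [hu, hv, hw, hv', hw', real_inner_comm u, real_inner_comm v, real_inner_comm w]
  · have h1 : ∀ a b : V, ⟪J a, b⟫ = 0 → ⟪b, J a⟫ = 0 := fun a b h ↦ by rwa [real_inner_comm]
    have h2 : ∀ a b : V, ⟪J a, b⟫ = 0 → ⟪a, J b⟫ = 0 := fun a b h ↦ by
      rw [hJ.inner_left] at h
      linarith
    intro i j
    fin_cases i <;> fin_cases j <;>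
      simp [hJ.inner_self, h1 _ _ hv'.2, h2 _ _ hv'.2, h1 _ _ hw'.2.1, h2 _ _ hw'.2.1,
        h1 _ _ hw'.2.2.2, h2 _ _ hw'.2.2.2]

namespace IsNearlyKahlerTensor

/-- The complex `(3,0)`-form whose imaginary part is `⟪B u v, w⟫`. -/
def complexForm (hB : IsNearlyKahlerTensor J B) (hJ : IsOrthogonalComplexStructure J) :
    V [⋀^Fin 3]→ₗ[ℝ] ℂ where
  toFun m := (⟪B (m 0) (m 1), J (m 2)⟫ : ℂ) + (⟪B (m 0) (m 1), m 2⟫ : ℂ) * Complex.I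
  map_update_add' m i x y := by
    rename_i inst
    obtain rfl : inst = instDecidableEqFin 3 := Subsingleton.elim _ _
    obtain rfl | rfl | rfl : i = 0 ∨ i = 1 ∨ i = 2 := by omega
    all_goals
      simp only [Function.update_self, ne_eq, Fin.reduceEq, not_false_eq_true,
        Function.update_of_ne, map_add, LinearMap.add_apply, inner_add_left, inner_add_right,
        Complex.ofReal_add]
      ring
  map_update_smul' m i c x := by
    rename_i inst
    obtain rfl : inst = instDecidableEqFin 3 := Subsingleton.elim _ _
    obtain rfl | rfl | rfl : i = 0 ∨ i = 1 ∨ i = 2 := by omega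
    all_goals
      simp only [Function.update_self, ne_eq, Fin.reduceEq, not_false_eq_true,
        Function.update_of_ne, map_smul, LinearMap.smul_apply, real_inner_smul_left,
        real_inner_smul_right, Complex.ofReal_mul, Complex.real_smul]
      ring
  map_eq_zero_of_eq' m i j h hij := by
    have h' : m 0 = m 1 ∨ m 0 = m 2 ∨ m 1 = m 2 := by
      revert h hij
      fin_cases i <;> fin_cases j <;> intro h hij <;>
        first
        | exact (hij rfl).elim
        | exact Or.inl h
        | exact Or.inl h.symm
        | exact Or.inr (Or.inl h)
        | exact Or.inr (Or.inl h.symm)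
        | exact Or.inr (Or.inr h)
        | exact Or.inr (Or.inr h.symm)
    rcases h' with h | h | h
    · simp [h, hB.self]
    · simp [h, hB.inner_left, hB.inner_map_left hJ]
    · simp [h, hB.inner_right, hB.inner_map_right hJ]

variable (hB : IsNearlyKahlerTensor J B) (hJ : IsOrthogonalComplexStructure J)

lemma complexForm_apply (m : Fin 3 → V) : hB.complexForm hJ m =
    (⟪B (m 0) (m 1), J (m 2)⟫ : ℂ) + (⟪B (m 0) (m 1), m 2⟫ : ℂ) * Complex.I := rfl

lemma complexForm_update (m : Fin 3 → V) (i : Fin 3) :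
    hB.complexForm hJ (Function.update m i (J (m i))) = Complex.I * hB.complexForm hJ m := by
  have e : ∀ a b : ℝ, -(b : ℂ) + (a : ℂ) * Complex.I = Complex.I * (a + b * Complex.I) := by
    intro a b
    linear_combination -(b : ℂ) * Complex.I_mul_I
  rw [complexForm_apply, complexForm_apply, ← e]
  fin_cases i <;>
    simp [Function.update, hB.map_left, hB.map_right, hJ.inner_left, hJ.inner_map, hJ.sq]

lemma norm_complexForm_sq (m : Fin 3 → V) : ‖hB.complexForm hJ m‖ ^ 2 =
    ⟪B (m 0) (m 1), J (m 2)⟫ ^ 2 + ⟪B (m 0) (m 1), m 2⟫ ^ 2 := by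
  rw [complexForm_apply, Complex.sq_norm, Complex.normSq_add_mul_I]

lemma norm_complexForm_sq_eq [FiniteDimensional ℝ V] (hV : finrank ℝ V = 6) {N : ℝ}
    (hN : ∀ a b c d, ⟪B a b, B c d⟫ = N * (⟪a, c⟫ * ⟪b, d⟫ - ⟪a, d⟫ * ⟪b, c⟫
      - ⟪a, J c⟫ * ⟪b, J d⟫ + ⟪a, J d⟫ * ⟪b, J c⟫)) {e : Fin 3 → V} (he : IsUnitaryFrame J e) :
    ‖hB.complexForm hJ e‖ ^ 2 = N := by
  have h1 := hB.exists_constantType hJ hV he (e 0) (e 1) (e 0) (e 1)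
  rw [hN] at h1
  simp only [he.inner_eq, he.inner_map] at h1
  rw [norm_complexForm_sq, add_comm]
  simpa using h1.symm

lemma norm_complexForm_sq_le {N : ℝ} (hN0 : 0 ≤ N)
    (hN : ∀ a b c d, ⟪B a b, B c d⟫ = N * (⟪a, c⟫ * ⟪b, d⟫ - ⟪a, d⟫ * ⟪b, c⟫
      - ⟪a, J c⟫ * ⟪b, J d⟫ + ⟪a, J d⟫ * ⟪b, J c⟫)) {e : Fin 3 → V} (he : Orthonormal ℝ e) :
    ‖hB.complexForm hJ e‖ ^ 2 ≤ N := by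
  rw [norm_complexForm_sq]
  rw [orthonormal_iff_ite] at he
  have h1 := hN (e 0) (e 1) (e 0) (e 1)
  simp only [he, hJ.inner_self, zero_ne_one, one_ne_zero, if_true, if_false] at h1
  set b := B (e 0) (e 1)
  set w := e 2
  have hw : ⟪w, w⟫ = 1 := by simpa using he 2 2
  have h2 : ⟪e 1, J (e 0)⟫ = -⟪e 0, J (e 1)⟫ := by
    rw [real_inner_comm, hJ.inner_left]
  have hb : ⟪b, b⟫ ≤ N := by
    rw [h1, h2]
    nlinarith [sq_nonneg (⟪e 0, J (e 1)⟫)]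
  have h3 := real_inner_self_nonneg (x := b - ⟪b, w⟫ • w - ⟪b, J w⟫ • J w)
  have h4 : ⟪J w, w⟫ = 0 := by rw [real_inner_comm]; exact hJ.inner_self w
  simp only [inner_sub_left, inner_sub_right, real_inner_smul_left, real_inner_smul_right, hw, h4,
    hJ.inner_map, hJ.inner_self, real_inner_comm b] at h3
  nlinarith

include hB hJ in
/-- In dimension six, a tensor of the same type as `B ≠ 0` that is orthogonal to both `B` and `JB`
is zero. -/
lemma eq_zero_of_inner_eq_zero [FiniteDimensional ℝ V] (hV : finrank ℝ V = 6)
    {B' : V →ₗ[ℝ] V →ₗ[ℝ] V} (hB' : IsNearlyKahlerTensor J B') (h0 : B ≠ 0)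
    (h1 : ∀ u v, ⟪B' u v, B u v⟫ = 0) (h2 : ∀ u v, ⟪B' u v, J (B u v)⟫ = 0) : B' = 0 := by
  have hu : ∃ u : V, ‖u‖ = 1 := by
    obtain ⟨u, hu, -⟩ := exists_unit_orthogonal (V := V) ∅ (by simp [hV])
    exact ⟨u, hu⟩
  obtain ⟨u, hu⟩ := hu
  obtain ⟨e, -, he⟩ := hJ.exists_isUnitaryFrame hV hu
  have key : ∀ {C : V →ₗ[ℝ] V →ₗ[ℝ] V}, IsNearlyKahlerTensor J C →
      ⟪C (e 0) (e 1), e 2⟫ = 0 → ⟪C (e 0) (e 1), J (e 2)⟫ = 0 → C = 0 := by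
    intro C hC ha hb
    refine LinearMap.ext fun x ↦ LinearMap.ext fun y ↦ ?_
    rw [he.eq_ofCoords hV x, he.eq_ofCoords hV y,
      hC.apply_ofCoords hJ hV he _ _ _ _ 0 0 ha.symm hb.symm]
    simp [ofCoords]
  have hval : ∀ {C : V →ₗ[ℝ] V →ₗ[ℝ] V}, IsNearlyKahlerTensor J C → C (e 0) (e 1) =
      ofCoords J e ![0, 0, ⟪C (e 0) (e 1), e 2⟫] ![0, 0, ⟪C (e 0) (e 1), J (e 2)⟫] := by
    intro C hC
    conv_lhs => rw [he.eq_ofCoords hV (C (e 0) (e 1))]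
    simp [ofCoords, real_inner_comm _ (e _), real_inner_comm _ (J (e _)),
      hC.inner_left, hC.inner_right, hC.inner_map_left hJ, hC.inner_map_right hJ]
  have e1 := h1 (e 0) (e 1)
  have e2 := h2 (e 0) (e 1)
  rw [hval hB, hval hB', hJ.map_ofCoords, he.inner_ofCoords] at e2
  rw [hval hB, hval hB', he.inner_ofCoords] at e1
  have h3 : ⟪B (e 0) (e 1), e 2⟫ ^ 2 + ⟪B (e 0) (e 1), J (e 2)⟫ ^ 2 ≠ 0 := by
    intro h
    exact h0 (key hB (by nlinarith) (by nlinarith))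
  simp at e1 e2
  refine key hB' ?_ ?_
  · refine (mul_eq_zero.1 (?_ : _ * (⟪B (e 0) (e 1), e 2⟫ ^ 2 +
      ⟪B (e 0) (e 1), J (e 2)⟫ ^ 2) = 0)).resolve_right h3
    linear_combination ⟪B (e 0) (e 1), e 2⟫ * e1 - ⟪B (e 0) (e 1), J (e 2)⟫ * e2
  · refine (mul_eq_zero.1 (?_ : _ * (⟪B (e 0) (e 1), e 2⟫ ^ 2 +
      ⟪B (e 0) (e 1), J (e 2)⟫ ^ 2) = 0)).resolve_right h3
    linear_combination ⟪B (e 0) (e 1), J (e 2)⟫ * e1 + ⟪B (e 0) (e 1), e 2⟫ * e2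

end IsNearlyKahlerTensor

/-- A one-form `C` with values in the three-forms of type `(3,0) + (0,3)` whose alternation vanishes depends
antilinearly on its first argument. -/
lemma map_left_of_alternation_eq_zero (hJ : IsOrthogonalComplexStructure J)
    {C : V → V → V → V → ℝ} (h12 : ∀ a b c d, C a b c d = -C a c b d)
    (h23 : ∀ a b c d, C a b c d = -C a b d c) (hJ12 : ∀ a b c d, C a (J b) c d = C a b (J c) d)
    (hneg : ∀ a b c d, C a (-b) c d = -C a b c d)
    (hC : ∀ a b c d, C a b c d - C b a c d + C c a b d - C d a b c = 0) (a b c d : V) :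
    C (J a) b c d = C a (J b) c d := by
  have hJ23 : ∀ a b c d, C a b (J c) d = C a b c (J d) := fun a b c d ↦ by
    rw [h23 a b c (J d), ← hJ12 a b d c, h23 a (J b) d c, neg_neg, hJ12]
  have hJ2 : ∀ a b c d, C a (J b) (J c) d = -C a b c d := fun a b c d ↦ by
    rw [← hJ12, hJ.sq, hneg]
  have hJ3 : ∀ a b c d, C a b (J c) (J d) = -C a b c d := fun a b c d ↦ by
    rw [← hJ23, ← hJ12, ← hJ12, hJ.sq, hneg]
  set P : V → V → V → V → ℝ := fun b a c d ↦ C b a c d + C (J b) (J a) c d with hP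
  have P12 : ∀ b a c d, P b a c d = -P b c a d := fun b a c d ↦ by
    simp only [hP]
    rw [h12 b a, hJ12 (J b), h12 (J b) a]
    ring
  have PE : ∀ a b c d, P b a c d = P c a b d := fun a b c d ↦ by
    have e1 := hC a b c d
    have e2 := hC a (J b) (J c) d
    rw [hJ2, hJ3, ← hJ12 (J b), ← hJ12 (J c)] at e2
    simp only [hP]
    linarith
  have P0 : ∀ a b c d, P b a c d = 0 := fun a b c d ↦ by
    have e1 := PE a b c d
    have e2 := P12 c a b d
    have e3 := PE b a c d
    have e4 := P12 b a c d
    have e5 := PE c b a d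
    have e6 := P12 a c b d
    linarith
  have h := P0 (J b) a c d
  simp only [hP, hJ.sq, hneg] at h
  linarith

end PointwiseForms

end NearlyKahler

end
noncomputable section

namespace NearlyKahler

section CovariantTensors

variable {E : Type*} [NormedAddCommGroup E] [NormedSpace ℝ E] [FiniteDimensional ℝ E]
  {H : Type*} [TopologicalSpace H] {I : ModelWithCorners ℝ E H}
  {M : Type*} [TopologicalSpace M] [ChartedSpace H M] [IsManifold I ∞ M]
  {E' : Type*} [NormedAddCommGroup E'] [NormedSpace ℝ E']
  {H' : Type*} [TopologicalSpace H'] {I' : ModelWithCorners ℝ E' H'}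
  {L : Type*} [TopologicalSpace L] [ChartedSpace H' L]

variable (D : CovariantDerivative I E (fun x : M ↦ TangentSpace I x))

/-- `C` is the covariant derivative at `x` of the covariant two-tensor `A`. -/
def HasCovDerivAt₂ (A : Π x : M, TangentSpace I x →ₗ[ℝ] TangentSpace I x →ₗ[ℝ] ℝ) (x : M)
    (C : TangentSpace I x → TangentSpace I x → TangentSpace I x → ℝ) : Prop :=
  ∀ b c : TangentSpace I x,
    MDifferentiableAt I 𝓘(ℝ, ℝ)
      (fun y ↦ A y (FiberBundle.extend E b y) (FiberBundle.extend E c y)) x ∧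
    ∀ a : TangentSpace I x,
      mvfderiv I (fun y ↦ A y (FiberBundle.extend E b y) (FiberBundle.extend E c y)) x a =
        C a b c + A x (D (FiberBundle.extend E b) x a) c + A x b (D (FiberBundle.extend E c) x a)

/-- `C` is the covariant derivative at `x` of the covariant three-tensor `A`. -/
def HasCovDerivAt₃
    (A : Π x : M, TangentSpace I x →ₗ[ℝ] TangentSpace I x →ₗ[ℝ] TangentSpace I x →ₗ[ℝ] ℝ) (x : M)
    (C : TangentSpace I x → TangentSpace I x → TangentSpace I x → TangentSpace I x → ℝ) : Prop :=
  ∀ b c d : TangentSpace I x,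
    MDifferentiableAt I 𝓘(ℝ, ℝ) (fun y ↦ A y (FiberBundle.extend E b y)
      (FiberBundle.extend E c y) (FiberBundle.extend E d y)) x ∧
    ∀ a : TangentSpace I x,
      mvfderiv I (fun y ↦ A y (FiberBundle.extend E b y) (FiberBundle.extend E c y)
        (FiberBundle.extend E d y)) x a =
        C a b c d + A x (D (FiberBundle.extend E b) x a) c d
          + A x b (D (FiberBundle.extend E c) x a) d + A x b c (D (FiberBundle.extend E d) x a)

variable {D}

lemma mvfderiv_comp_apply {G : Type*} [NormedAddCommGroup G] [NormedSpace ℝ G] {f : L → M} {p : L}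
    {h : M → G} (hh : MDifferentiableAt I 𝓘(ℝ, G) h (f p)) (hf : MDifferentiableAt I' I f p)
    (u : TangentSpace I' p) :
    mvfderiv I' (fun q ↦ h (f q)) p u = mvfderiv I h (f p) (mfderiv I' I f p u) := by
  have := mfderiv_comp p hh hf
  exact congrArg (fun T ↦ T u) this

lemma HasCovDerivAt₂.along {A : Π x : M, TangentSpace I x →ₗ[ℝ] TangentSpace I x →ₗ[ℝ] ℝ}
    {f : L → M} {p : L} (hf : MDifferentiableAt I' I f p)
    {C : TangentSpace I (f p) → TangentSpace I (f p) → TangentSpace I (f p) → ℝ}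
    (h : HasCovDerivAt₂ D A (f p) C) {W₁ W₂ : Π q : L, TangentSpace I (f q)}
    (h₁ : DifferentiableAlongAt I I' f W₁ p) (h₂ : DifferentiableAlongAt I I' f W₂ p) :
    MDifferentiableAt I' 𝓘(ℝ, ℝ) (fun q ↦ A (f q) (W₁ q) (W₂ q)) p ∧
    ∀ u : TangentSpace I' p, mvfderiv I' (fun q ↦ A (f q) (W₁ q) (W₂ q)) p u =
      C (mfderiv I' I f p u) (W₁ p) (W₂ p) + A (f p) (covDerivAlong D f W₁ p u) (W₂ p)
        + A (f p) (W₁ p) (covDerivAlong D f W₂ p u) := by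
  have step1 : ∀ (u : TangentSpace I' p) (c : TangentSpace I (f p)),
      MDifferentiableAt I' 𝓘(ℝ, ℝ) (fun q ↦ A (f q) (W₁ q) (FiberBundle.extend E c (f q))) p ∧
      mvfderiv I' (fun q ↦ A (f q) (W₁ q) (FiberBundle.extend E c (f q))) p u =
        C (mfderiv I' I f p u) (W₁ p) c
          + A (f p) (W₁ p) (D (FiberBundle.extend E c) (f p) (mfderiv I' I f p u))
          + A (f p) (covDerivAlong D f W₁ p u) c := by
    intro u c
    have := mvfderiv_apply_along D hf (u := u)
      (φ := fun q ↦ (A (f q)).flip (FiberBundle.extend E c (f q)))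
      (φ' := fun b ↦ C (mfderiv I' I f p u) b c
          + A (f p) b (D (FiberBundle.extend E c) (f p) (mfderiv I' I f p u)))
      (fun b ↦ ⟨(h b c).1.comp p hf, by
        have e := mvfderiv_comp_apply (h b c).1 hf u
        rw [(h b c).2] at e
        simp only [LinearMap.flip_apply, FiberBundle.extend_apply_self]
        rw [e]
        ring⟩) h₁
    simpa only [LinearMap.flip_apply, FiberBundle.extend_apply_self] using this
  have step2 := fun u : TangentSpace I' p ↦ mvfderiv_apply_along D hf (u := u)
    (φ := fun q ↦ A (f q) (W₁ q))
    (φ' := fun c ↦ C (mfderiv I' I f p u) (W₁ p) c + A (f p) (covDerivAlong D f W₁ p u) c)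
    (fun c ↦ ⟨(step1 u c).1, by rw [(step1 u c).2]; ring⟩) h₂
  exact ⟨(step2 0).1, fun u ↦ (step2 u).2⟩

variable {A : Π x : M, TangentSpace I x →ₗ[ℝ] TangentSpace I x →ₗ[ℝ] TangentSpace I x →ₗ[ℝ] ℝ}

lemma HasCovDerivAt₃.along {f : L → M} {p : L} (hf : MDifferentiableAt I' I f p)
    {C : TangentSpace I (f p) → TangentSpace I (f p) → TangentSpace I (f p) →
      TangentSpace I (f p) → ℝ}
    (h : HasCovDerivAt₃ D A (f p) C) {W₁ W₂ W₃ : Π q : L, TangentSpace I (f q)}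
    (h₁ : DifferentiableAlongAt I I' f W₁ p) (h₂ : DifferentiableAlongAt I I' f W₂ p)
    (h₃ : DifferentiableAlongAt I I' f W₃ p) :
    MDifferentiableAt I' 𝓘(ℝ, ℝ) (fun q ↦ A (f q) (W₁ q) (W₂ q) (W₃ q)) p ∧
    ∀ u : TangentSpace I' p, mvfderiv I' (fun q ↦ A (f q) (W₁ q) (W₂ q) (W₃ q)) p u =
      C (mfderiv I' I f p u) (W₁ p) (W₂ p) (W₃ p)
        + A (f p) (covDerivAlong D f W₁ p u) (W₂ p) (W₃ p)
        + A (f p) (W₁ p) (covDerivAlong D f W₂ p u) (W₃ p)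
        + A (f p) (W₁ p) (W₂ p) (covDerivAlong D f W₃ p u) := by
  have step1 : ∀ (u : TangentSpace I' p) (c d : TangentSpace I (f p)),
      MDifferentiableAt I' 𝓘(ℝ, ℝ) (fun q ↦ A (f q) (W₁ q) (FiberBundle.extend E c (f q))
        (FiberBundle.extend E d (f q))) p ∧
      mvfderiv I' (fun q ↦ A (f q) (W₁ q) (FiberBundle.extend E c (f q))
        (FiberBundle.extend E d (f q))) p u =
        C (mfderiv I' I f p u) (W₁ p) c d
          + A (f p) (W₁ p) (D (FiberBundle.extend E c) (f p) (mfderiv I' I f p u)) d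
          + A (f p) (W₁ p) c (D (FiberBundle.extend E d) (f p) (mfderiv I' I f p u))
          + A (f p) (covDerivAlong D f W₁ p u) c d := by
    intro u c d
    have := mvfderiv_apply_along D hf (u := u)
      (φ := fun q ↦ ((A (f q)).flip (FiberBundle.extend E c (f q))).flip
        (FiberBundle.extend E d (f q)))
      (φ' := fun b ↦ C (mfderiv I' I f p u) b c d
          + A (f p) b (D (FiberBundle.extend E c) (f p) (mfderiv I' I f p u)) d
          + A (f p) b c (D (FiberBundle.extend E d) (f p) (mfderiv I' I f p u)))
      (fun b ↦ ⟨(h b c d).1.comp p hf, by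
        have e := mvfderiv_comp_apply (h b c d).1 hf u
        rw [(h b c d).2] at e
        simp only [LinearMap.flip_apply, FiberBundle.extend_apply_self]
        rw [e]
        ring⟩) h₁
    simpa only [LinearMap.flip_apply, FiberBundle.extend_apply_self] using this
  have step2 : ∀ (u : TangentSpace I' p) (d : TangentSpace I (f p)),
      MDifferentiableAt I' 𝓘(ℝ, ℝ)
        (fun q ↦ A (f q) (W₁ q) (W₂ q) (FiberBundle.extend E d (f q))) p ∧
      mvfderiv I' (fun q ↦ A (f q) (W₁ q) (W₂ q) (FiberBundle.extend E d (f q))) p u =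
        C (mfderiv I' I f p u) (W₁ p) (W₂ p) d
          + A (f p) (W₁ p) (W₂ p) (D (FiberBundle.extend E d) (f p) (mfderiv I' I f p u))
          + A (f p) (covDerivAlong D f W₁ p u) (W₂ p) d
          + A (f p) (W₁ p) (covDerivAlong D f W₂ p u) d := by
    intro u d
    have := mvfderiv_apply_along D hf (u := u)
      (φ := fun q ↦ (A (f q) (W₁ q)).flip (FiberBundle.extend E d (f q)))
      (φ' := fun c ↦ C (mfderiv I' I f p u) (W₁ p) c d
          + A (f p) (W₁ p) c (D (FiberBundle.extend E d) (f p) (mfderiv I' I f p u))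
          + A (f p) (covDerivAlong D f W₁ p u) c d)
      (fun c ↦ ⟨(step1 u c d).1, by
        simp only [LinearMap.flip_apply, FiberBundle.extend_apply_self]
        rw [(step1 u c d).2]
        ring⟩) h₂
    simpa only [LinearMap.flip_apply, FiberBundle.extend_apply_self] using this
  have step3 := fun u : TangentSpace I' p ↦ mvfderiv_apply_along D hf (u := u)
    (φ := fun q ↦ A (f q) (W₁ q) (W₂ q))
    (φ' := fun d ↦ C (mfderiv I' I f p u) (W₁ p) (W₂ p) d
      + A (f p) (covDerivAlong D f W₁ p u) (W₂ p) d
      + A (f p) (W₁ p) (covDerivAlong D f W₂ p u) d)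
    (fun d ↦ ⟨(step2 u d).1, by rw [(step2 u d).2]; ring⟩) h₃
  exact ⟨(step3 0).1, fun u ↦ (step3 u).2⟩

lemma mfderiv_fun_id_apply {x : M} (u : TangentSpace I x) : mfderiv I I (fun y : M ↦ y) x u = u := by
  rw [show (fun y : M ↦ y) = id from rfl, mfderiv_id]
  rfl

lemma HasCovDerivAt₃.apply {x : M}
    {C : TangentSpace I x → TangentSpace I x → TangentSpace I x → TangentSpace I x → ℝ}
    (h : HasCovDerivAt₃ D A x C) {X Y Z : Π x : M, TangentSpace I x} (hX : MDiffAt (T% X) x)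
    (hY : MDiffAt (T% Y) x) (hZ : MDiffAt (T% Z) x) :
    MDifferentiableAt I 𝓘(ℝ, ℝ) (fun y ↦ A y (X y) (Y y) (Z y)) x ∧
    ∀ u : TangentSpace I x, mvfderiv I (fun y ↦ A y (X y) (Y y) (Z y)) x u =
      C u (X x) (Y x) (Z x) + A x (D X x u) (Y x) (Z x) + A x (X x) (D Y x u) (Z x)
        + A x (X x) (Y x) (D Z x u) := by
  have := HasCovDerivAt₃.along (I' := I) (f := fun y : M ↦ y) mdifferentiableAt_id h
    (W₁ := X) (W₂ := Y) (W₃ := Z) (.comp mdifferentiableAt_id hX) (.comp mdifferentiableAt_id hY)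
    (.comp mdifferentiableAt_id hZ)
  refine ⟨this.1, fun u ↦ ?_⟩
  rw [this.2, covDerivAlong_id D hX, covDerivAlong_id D hY, covDerivAlong_id D hZ,
    mfderiv_fun_id_apply]

lemma HasCovDerivAt₃.isLinearMap {x : M}
    {C : TangentSpace I x → TangentSpace I x → TangentSpace I x → TangentSpace I x → ℝ}
    (h : HasCovDerivAt₃ D A x C) (a b c : TangentSpace I x) : IsLinearMap ℝ (C a b c) := by
  have h1 : IsLinearMap ℝ (fun d ↦ C a b c d + A x (D (FiberBundle.extend E b) x a) c d
      + A x b (D (FiberBundle.extend E c) x a) d) :=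
    isLinearMap_of_leibniz (I' := I) D (f := fun y : M ↦ y) (p := x) (u := a) mdifferentiableAt_id
      (φ := fun y ↦ A y (FiberBundle.extend E b y) (FiberBundle.extend E c y)) fun d ↦
        ⟨(h b c d).1, by rw [(h b c d).2, mfderiv_fun_id_apply]; simp⟩
  constructor
  · intro d d'
    have := h1.map_add d d'
    simp only [map_add] at this
    linarith
  · intro r d
    have := h1.map_smul r d
    simp only [map_smul, smul_eq_mul] at this ⊢
    linarith

end CovariantTensors

end NearlyKahler

end
noncomputable section

namespace NearlyKahler

namespace AlmostHermitianStructure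

variable {E : Type*} [NormedAddCommGroup E] [NormedSpace ℝ E] [FiniteDimensional ℝ E]
  [CompleteSpace E]
  {H : Type*} [TopologicalSpace H] {I : ModelWithCorners ℝ E H}
  {M : Type*} [TopologicalSpace M] [ChartedSpace H M] [IsManifold I ∞ M]
  [RiemannianBundle (fun x : M ↦ TangentSpace I x)]
  [IsContMDiffRiemannianBundle I ∞ E (fun x : M ↦ TangentSpace I x)]
  (S : AlmostHermitianStructure I M)

lemma isOrthogonalComplexStructure (x : M) :
    IsOrthogonalComplexStructure (S.J x).toLinearMap where
  sq := S.sq x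
  inner_map := S.inner_map x

lemma tensorialAt_covDerivJ (D : CovariantDerivative I E (fun x : M ↦ TangentSpace I x)) (x : M) :
    TensorialAt I E (fun Y ↦ S.covDerivJ D Y x) x where
  smul {f Y} hf hY := by
    have e : S.mapField (f • Y) = f • S.mapField Y := by
      ext y; simp [mapField]
    ext u
    simp only [covDerivJ, e, D.isCovariantDerivativeOnUniv.leibniz hY hf,
      D.isCovariantDerivativeOnUniv.leibniz (S.mdifferentiableAt_mapField hY) hf]
    simp [mapField]
    module
  add {Y Y'} hY hY' := by
    have e : S.mapField (Y + Y') = S.mapField Y + S.mapField Y' := by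
      ext y; simp [mapField]
    ext u
    simp only [covDerivJ, e, D.isCovariantDerivativeOnUniv.add hY hY',
      D.isCovariantDerivativeOnUniv.add (S.mdifferentiableAt_mapField hY)
        (S.mdifferentiableAt_mapField hY')]
    simp
    module

/-- The tensor `(u, v) ↦ (∇_u J) v`, where `∇` is the Levi-Civita connection. -/
def nablaJ (x : M) : TangentSpace I x →ₗ[ℝ] TangentSpace I x →ₗ[ℝ] TangentSpace I x :=
  LinearMap.mk₂ ℝ (fun u v ↦ TensorialAt.mkHom (fun Y ↦ S.covDerivJ (leviCivita I M) Y x) x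
    (S.tensorialAt_covDerivJ _ x) v u) (by simp) (by simp) (by simp) (by simp)

lemma nablaJ_apply {x : M} {Y : Π x : M, TangentSpace I x} (hY : MDiffAt (T% Y) x)
    (u : TangentSpace I x) : S.nablaJ x u (Y x) = S.covDerivJ (leviCivita I M) Y x u := by
  rw [nablaJ, LinearMap.mk₂_apply, TensorialAt.mkHom_apply _ hY]

lemma leviCivita_mapField {x : M} {Y : Π x : M, TangentSpace I x} (hY : MDiffAt (T% Y) x)
    (u : TangentSpace I x) : leviCivita I M (S.mapField Y) x u =
      S.nablaJ x u (Y x) + S.J x (leviCivita I M Y x u) := by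
  rw [S.nablaJ_apply hY, covDerivJ]
  simp

lemma canonicalConnection_apply {x : M} {Y : Π x : M, TangentSpace I x} (hY : MDiffAt (T% Y) x)
    (u : TangentSpace I x) : S.canonicalConnection Y x u =
      leviCivita I M Y x u - (1 / 2 : ℝ) • S.J x (S.nablaJ x u (Y x)) := by
  rw [S.nablaJ_apply hY]
  rfl

lemma nablaJ_map_right (x : M) (u v : TangentSpace I x) :
    S.nablaJ x u (S.J x v) = -S.J x (S.nablaJ x u v) := by
  have hV := FiberBundle.mdifferentiableAt_extend I E v
  have h1 := S.leviCivita_mapField (S.mdifferentiableAt_mapField hV) u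
  have e : S.mapField (S.mapField (FiberBundle.extend E v)) = (-1 : ℝ) • FiberBundle.extend E v := by
    ext y
    simp [mapField, S.sq]
  rw [e, (leviCivita I M).isCovariantDerivativeOnUniv.smul_const _ hV, S.leviCivita_mapField hV] at h1
  simp only [mapField, FiberBundle.extend_apply_self, smul_apply, map_add, S.sq] at h1
  rw [eq_neg_iff_add_eq_zero]
  have h2 := sub_eq_zero.2 h1.symm
  rw [← h2]
  module

lemma nablaJ_skew (x : M) (u v w : TangentSpace I x) :
    inner ℝ (S.nablaJ x u v) w = -inner ℝ (S.nablaJ x u w) v := by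
  have hV := FiberBundle.mdifferentiableAt_extend I E v
  have hW := FiberBundle.mdifferentiableAt_extend I E w
  have hm := leviCivita_isMetricConnection (I := I) (M := M)
  have h1 := hm x _ _ (S.mdifferentiableAt_mapField hV) hW u
  have h2 := hm x _ _ hV (S.mdifferentiableAt_mapField hW) u
  have e : (fun y ↦ inner ℝ (S.mapField (FiberBundle.extend E v) y) (FiberBundle.extend E w y)) =
      fun y ↦ -inner ℝ (FiberBundle.extend E v y) (S.mapField (FiberBundle.extend E w) y) := by
    ext y
    exact (S.isOrthogonalComplexStructure y).inner_left _ _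
  have hJ := (S.isOrthogonalComplexStructure x).inner_left
  simp only [ContinuousLinearMap.coe_coe] at hJ
  rw [e, mvfderiv_fun_neg, neg_apply, h2, S.leviCivita_mapField hV, S.leviCivita_mapField hW] at h1
  simp only [mapField, FiberBundle.extend_apply_self, inner_add_left, inner_add_right, hJ] at h1
  rw [real_inner_comm v (S.nablaJ x u w)]
  linarith

variable {S}

lemma IsNearlyKahler.isNearlyKahlerTensor (hS : S.IsNearlyKahler) (x : M) :
    IsNearlyKahlerTensor (S.J x).toLinearMap (S.nablaJ x) where
  swap u v := by
    have hU := FiberBundle.mdifferentiableAt_extend I E u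
    have hV := FiberBundle.mdifferentiableAt_extend I E v
    have h := hS x _ _ hU hV
    rw [← S.nablaJ_apply hU, ← S.nablaJ_apply hV] at h
    simp only [FiberBundle.extend_apply_self] at h
    exact eq_neg_of_add_eq_zero_left h
  skew := S.nablaJ_skew x
  map_right := S.nablaJ_map_right x

variable (S) in
lemma isParallelJ_canonicalConnection : S.IsParallelJ S.canonicalConnection := by
  intro x Y hY
  ext u
  simp only [covDerivJ, sub_apply, ContinuousLinearMap.comp_apply, zero_apply]
  rw [S.canonicalConnection_apply (S.mdifferentiableAt_mapField hY), S.canonicalConnection_apply hY,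
    S.leviCivita_mapField hY]
  simp only [mapField, S.nablaJ_map_right, map_neg, S.sq, map_sub, map_smul]
  module

lemma canonicalConnection_mapField {x : M} {Y : Π x : M, TangentSpace I x} (hY : MDiffAt (T% Y) x)
    (u : TangentSpace I x) : S.canonicalConnection (S.mapField Y) x u =
      S.J x (S.canonicalConnection Y x u) := by
  have h := congrArg (fun T ↦ T u) (S.isParallelJ_canonicalConnection x Y hY)
  simpa [covDerivJ, sub_eq_zero] using h

lemma IsNearlyKahler.isMetricConnection (hS : S.IsNearlyKahler) :
    IsMetricConnection S.canonicalConnection := by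
  intro x Y Z hY hZ u
  have hB := hS.isNearlyKahlerTensor x
  have hJ := S.isOrthogonalComplexStructure x
  rw [leviCivita_isMetricConnection x Y Z hY hZ u, S.canonicalConnection_apply hY,
    S.canonicalConnection_apply hZ, inner_sub_left, inner_sub_right, real_inner_smul_left,
    real_inner_smul_right]
  have h1 := hJ.inner_left (S.nablaJ x u (Y x)) (Z x)
  have h2 := hJ.inner_left (S.nablaJ x u (Z x)) (Y x)
  have h3 := hB.inner_map_shift hJ u (Y x) (Z x)
  have h4 := hB.skew u (S.J x (Y x)) (Z x)
  simp only [ContinuousLinearMap.coe_coe] at h1 h2 h3 h4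
  rw [real_inner_comm] at h2
  rw [h1, h2, h3]
  linarith

lemma IsNearlyKahler.canonicalConnection_torsion (hS : S.IsNearlyKahler) {x : M}
    {X Y : Π x : M, TangentSpace I x} (hX : MDiffAt (T% X) x) (hY : MDiffAt (T% Y) x)
    (hXY : VectorField.mlieBracket I X Y x = 0) :
    S.canonicalConnection Y x (X x) - S.canonicalConnection X x (Y x) =
      -S.J x (S.nablaJ x (X x) (Y x)) := by
  have h := (CovariantDerivative.torsion_eq_zero_iff _).1 (leviCivita_torsion (I := I) (M := M)) hX hY
  rw [hXY] at h
  rw [S.canonicalConnection_apply hY, S.canonicalConnection_apply hX,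
    (hS.isNearlyKahlerTensor x).swap (Y x) (X x), map_neg, ← sub_eq_zero]
  rw [← h]
  module

variable (S) in
/-- The Kähler form as a two-tensor. -/
def kahlerTensor (x : M) : TangentSpace I x →ₗ[ℝ] TangentSpace I x →ₗ[ℝ] ℝ :=
  (innerₗ (TangentSpace I x)).compl₂ (S.J x).toLinearMap

lemma kahlerTensor_apply (x : M) (u v : TangentSpace I x) :
    S.kahlerTensor x u v = inner ℝ u (S.J x v) := rfl

variable (S) in
/-- The three-form `A(u, v, w) = g((∇_u J) v, w)`. -/
def torsionForm (x : M) :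
    TangentSpace I x →ₗ[ℝ] TangentSpace I x →ₗ[ℝ] TangentSpace I x →ₗ[ℝ] ℝ :=
  (S.nablaJ x).compr₂ (innerₗ (TangentSpace I x))

lemma torsionForm_apply (x : M) (u v w : TangentSpace I x) :
    S.torsionForm x u v w = inner ℝ (S.nablaJ x u v) w := rfl

lemma mvfderiv_kahlerTensor {x : M} {Y Z : Π x : M, TangentSpace I x} (hY : MDiffAt (T% Y) x)
    (hZ : MDiffAt (T% Z) x) :
    MDifferentiableAt I 𝓘(ℝ, ℝ) (fun y ↦ S.kahlerTensor y (Y y) (Z y)) x ∧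
    ∀ u : TangentSpace I x, mvfderiv I (fun y ↦ S.kahlerTensor y (Y y) (Z y)) x u =
      S.torsionForm x u (Z x) (Y x) + S.kahlerTensor x (leviCivita I M Y x u) (Z x)
        + S.kahlerTensor x (Y x) (leviCivita I M Z x u) := by
  have hJZ := S.mdifferentiableAt_mapField hZ
  refine ⟨mdifferentiableAt_inner hY hJZ, fun u ↦ ?_⟩
  have h := leviCivita_isMetricConnection x Y (S.mapField Z) hY hJZ u
  rw [S.leviCivita_mapField hZ, inner_add_right, real_inner_comm _ (Y x)] at h
  simp only [kahlerTensor_apply, torsionForm_apply]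
  refine h.trans ?_
  simp only [mapField]
  ring

lemma hasCovDerivAt_kahlerTensor (x : M) : HasCovDerivAt₂ (leviCivita I M) S.kahlerTensor x
    (fun u v w ↦ S.torsionForm x u w v) := by
  intro b c
  have := mvfderiv_kahlerTensor (S := S) (FiberBundle.mdifferentiableAt_extend I E b)
    (FiberBundle.mdifferentiableAt_extend I E c)
  simpa only [FiberBundle.extend_apply_self] using this

lemma contMDiffAt_mapField {Y : Π x : M, TangentSpace I x} {x : M}
    (hY : ContMDiffAt I I.tangent ∞ (fun y ↦ (⟨y, Y y⟩ : TangentBundle I M)) x) :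
    ContMDiffAt I I.tangent ∞ (fun y ↦ (⟨y, S.mapField Y y⟩ : TangentBundle I M)) x :=
  ContMDiffAt.clm_bundle_apply (F₁ := E) (F₂ := E)
    (E₁ := fun x : M ↦ TangentSpace I x) (E₂ := fun x : M ↦ TangentSpace I x)
    S.contMDiff.contMDiffAt hY

lemma contMDiffAt_inner {Y Z : Π x : M, TangentSpace I x} {x : M}
    (hY : ContMDiffAt I I.tangent ∞ (fun y ↦ (⟨y, Y y⟩ : TangentBundle I M)) x)
    (hZ : ContMDiffAt I I.tangent ∞ (fun y ↦ (⟨y, Z y⟩ : TangentBundle I M)) x) :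
    ContMDiffAt I 𝓘(ℝ, ℝ) ∞ (fun y ↦ inner ℝ (Y y) (Z y)) x :=
  ContMDiffAt.inner_bundle (F := E) (E := fun x : M ↦ TangentSpace I x) hY hZ

lemma contMDiffAt_kahlerTensor {Y Z : Π x : M, TangentSpace I x} {x : M}
    (hY : ContMDiffAt I I.tangent ∞ (fun y ↦ (⟨y, Y y⟩ : TangentBundle I M)) x)
    (hZ : ContMDiffAt I I.tangent ∞ (fun y ↦ (⟨y, Z y⟩ : TangentBundle I M)) x) :
    ContMDiffAt I 𝓘(ℝ, ℝ) ∞ (fun y ↦ S.kahlerTensor y (Y y) (Z y)) x :=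
  contMDiffAt_inner hY (contMDiffAt_mapField hZ)

lemma contMDiffAt_mvfderiv_apply {h : M → ℝ} {X : Π x : M, TangentSpace I x} {x : M}
    (hh : ContMDiffAt I 𝓘(ℝ, ℝ) ∞ h x)
    (hX : ContMDiffAt I I.tangent ∞ (fun y ↦ (⟨y, X y⟩ : TangentBundle I M)) x) :
    ContMDiffAt I 𝓘(ℝ, ℝ) ∞ (fun y ↦ mvfderiv I h y (X y)) x := by
  have hb := ContMDiffAt.clm_apply_of_inCoordinates (hh.mfderiv_const (m := ∞) (by simp)) hX hh
  rw [contMDiffAt_totalSpace] at hb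
  have h2 := hb.2
  simp at h2
  exact h2

lemma contMDiffAt_mlieBracket {X Y : Π x : M, TangentSpace I x} {x : M}
    (hX : ContMDiffAt I I.tangent ∞ (fun y ↦ (⟨y, X y⟩ : TangentBundle I M)) x)
    (hY : ContMDiffAt I I.tangent ∞ (fun y ↦ (⟨y, Y y⟩ : TangentBundle I M)) x) :
    ContMDiffAt I I.tangent ∞
      (fun y ↦ (⟨y, VectorField.mlieBracket I X Y y⟩ : TangentBundle I M)) x := by
  have : IsManifold I (∞ + 1) M := by simpa
  have : IsManifold I (minSmoothness ℝ 2) M := by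
    rw [minSmoothness_of_isRCLikeNormedField]
    exact IsManifold.of_le (n := ∞) (by norm_cast)
  have : IsManifold I (minSmoothness ℝ 3) M := by
    rw [minSmoothness_of_isRCLikeNormedField]
    exact IsManifold.of_le (n := ∞) (by norm_cast)
  exact ContMDiffAt.mlieBracket_vectorField (n := ⊤) (m := ⊤) hX hY (by simp)

lemma contMDiffAt_koszul {X Y Z : Π x : M, TangentSpace I x} {x : M}
    (hX : ContMDiffAt I I.tangent ∞ (fun y ↦ (⟨y, X y⟩ : TangentBundle I M)) x)
    (hY : ContMDiffAt I I.tangent ∞ (fun y ↦ (⟨y, Y y⟩ : TangentBundle I M)) x)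
    (hZ : ContMDiffAt I I.tangent ∞ (fun y ↦ (⟨y, Z y⟩ : TangentBundle I M)) x) :
    ContMDiffAt I 𝓘(ℝ, ℝ) ∞ (fun y ↦ koszul I X Y Z y) x := by
  unfold koszul
  exact (((((contMDiffAt_mvfderiv_apply (contMDiffAt_inner hY hZ) hX).add
    (contMDiffAt_mvfderiv_apply (contMDiffAt_inner hZ hX) hY)).sub
    (contMDiffAt_mvfderiv_apply (contMDiffAt_inner hX hY) hZ)).add
    (contMDiffAt_inner (contMDiffAt_mlieBracket hX hY) hZ)).sub
    (contMDiffAt_inner (contMDiffAt_mlieBracket hY hZ) hX)).add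
    (contMDiffAt_inner (contMDiffAt_mlieBracket hZ hX) hY)

lemma torsionForm_eq_koszul {X Y Z : Π x : M, TangentSpace I x} {x : M}
    (hX : MDiffAt (T% X) x) (hY : MDiffAt (T% Y) x) (hZ : MDiffAt (T% Z) x) :
    S.torsionForm x (X x) (Y x) (Z x) =
      1 / 2 * (koszul I X (S.mapField Y) Z x + koszul I X Y (S.mapField Z) x) := by
  have h1 := inner_leviCivitaFun_apply hX (S.mdifferentiableAt_mapField hY) hZ
  have h2 := inner_leviCivitaFun_apply hX hY (S.mdifferentiableAt_mapField hZ)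
  have h3 := S.leviCivita_mapField hY (X x)
  change leviCivitaFun I (S.mapField Y) x (X x) = _ + S.J x (leviCivitaFun I Y x (X x)) at h3
  have h4 := (S.isOrthogonalComplexStructure x).inner_left (leviCivitaFun I Y x (X x)) (Z x)
  simp only [ContinuousLinearMap.coe_coe] at h4
  rw [h3, inner_add_left, h4] at h1
  simp only [mapField] at h2
  rw [torsionForm_apply]
  linarith

lemma eventually_mdifferentiableAt {X : Π x : M, TangentSpace I x} {x : M}
    (hX : ContMDiffAt I I.tangent ∞ (fun y ↦ (⟨y, X y⟩ : TangentBundle I M)) x) :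
    ∀ᶠ y in 𝓝 x, MDiffAt (T% X) y := by
  have h1 : ContMDiffAt I I.tangent 1 (fun y ↦ (⟨y, X y⟩ : TangentBundle I M)) x :=
    hX.of_le (by simp)
  filter_upwards [(contMDiffAt_iff_contMDiffAt_nhds (by simp)).1 h1] with y hy
  exact hy.mdifferentiableAt (by simp)

lemma contMDiffAt_torsionForm {X Y Z : Π x : M, TangentSpace I x} {x : M}
    (hX : ContMDiffAt I I.tangent ∞ (fun y ↦ (⟨y, X y⟩ : TangentBundle I M)) x)
    (hY : ContMDiffAt I I.tangent ∞ (fun y ↦ (⟨y, Y y⟩ : TangentBundle I M)) x)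
    (hZ : ContMDiffAt I I.tangent ∞ (fun y ↦ (⟨y, Z y⟩ : TangentBundle I M)) x) :
    ContMDiffAt I 𝓘(ℝ, ℝ) ∞ (fun y ↦ S.torsionForm y (X y) (Y y) (Z y)) x := by
  have h : ContMDiffAt I 𝓘(ℝ, ℝ) ∞ (fun y ↦
      1 / 2 * (koszul I X (S.mapField Y) Z y + koszul I X Y (S.mapField Z) y)) x :=
    contMDiffAt_const.mul ((contMDiffAt_koszul hX (contMDiffAt_mapField hY) hZ).add
      (contMDiffAt_koszul hX hY (contMDiffAt_mapField hZ)))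
  refine h.congr_of_eventuallyEq ?_
  filter_upwards [eventually_mdifferentiableAt hX, eventually_mdifferentiableAt hY,
    eventually_mdifferentiableAt hZ] with y h1 h2 h3
  exact torsionForm_eq_koszul h1 h2 h3

end AlmostHermitianStructure

end NearlyKahler

end
noncomputable section

namespace NearlyKahler

namespace AlmostHermitianStructure

variable {E : Type*} [NormedAddCommGroup E] [NormedSpace ℝ E] [FiniteDimensional ℝ E]
  [CompleteSpace E]
  {H : Type*} [TopologicalSpace H] {I : ModelWithCorners ℝ E H}
  {M : Type*} [TopologicalSpace M] [ChartedSpace H M] [IsManifold I ∞ M]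
  [RiemannianBundle (fun x : M ↦ TangentSpace I x)]
  [IsContMDiffRiemannianBundle I ∞ E (fun x : M ↦ TangentSpace I x)]
  {S : AlmostHermitianStructure I M}

lemma torsionForm_map_left (hS : S.IsNearlyKahler) (x : M) (u v w : TangentSpace I x) :
    S.torsionForm x (S.J x u) v w = S.torsionForm x u (S.J x v) w := by
  have hB := hS.isNearlyKahlerTensor x
  have h1 := hB.map_left u v
  have h2 := hB.map_right u v
  simp only [ContinuousLinearMap.coe_coe] at h1 h2
  rw [torsionForm_apply, torsionForm_apply, h1, h2]

lemma torsionForm_map_right (hS : S.IsNearlyKahler) (x : M) (u v w : TangentSpace I x) :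
    S.torsionForm x u v (S.J x w) = S.torsionForm x u (S.J x v) w :=
  (hS.isNearlyKahlerTensor x).inner_map_shift (S.isOrthogonalComplexStructure x) u v w

lemma torsionForm_swap_left (hS : S.IsNearlyKahler) (x : M) (u v w : TangentSpace I x) :
    S.torsionForm x u v w = -S.torsionForm x v u w := by
  rw [torsionForm_apply, (hS.isNearlyKahlerTensor x).swap, inner_neg_left, torsionForm_apply]

lemma torsionForm_swap_right (x : M) (u v w : TangentSpace I x) :
    S.torsionForm x u v w = -S.torsionForm x u w v := S.nablaJ_skew x u v w

lemma kahlerTensor_swap (x : M) (u v : TangentSpace I x) :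
    S.kahlerTensor x u v = -S.kahlerTensor x v u := by
  have := (S.isOrthogonalComplexStructure x).inner_left v u
  rw [real_inner_comm] at this
  simp only [kahlerTensor_apply]
  simp only [ContinuousLinearMap.coe_coe] at this
  linarith

variable (S) in
/-- The covariant derivative of the torsion form for the canonical hermitian connection. -/
def nablaTorsion (x : M) (a b c d : TangentSpace I x) : ℝ :=
  mvfderiv I (fun y ↦ S.torsionForm y (FiberBundle.extend E b y) (FiberBundle.extend E c y)
      (FiberBundle.extend E d y)) x a
    - S.torsionForm x (S.canonicalConnection (FiberBundle.extend E b) x a) c d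
    - S.torsionForm x b (S.canonicalConnection (FiberBundle.extend E c) x a) d
    - S.torsionForm x b c (S.canonicalConnection (FiberBundle.extend E d) x a)

lemma hasCovDerivAt_torsionForm (x : M) :
    HasCovDerivAt₃ S.canonicalConnection S.torsionForm x (S.nablaTorsion x) := by
  intro b c d
  refine ⟨?_, fun a ↦ by rw [nablaTorsion]; ring⟩
  exact (contMDiffAt_torsionForm (eventually_contMDiffAt_extend b).self_of_nhds
    (eventually_contMDiffAt_extend c).self_of_nhds
    (eventually_contMDiffAt_extend d).self_of_nhds).mdifferentiableAt (by simp)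

lemma nablaTorsion_swap_left (hS : S.IsNearlyKahler) (x : M) (a b c d : TangentSpace I x) :
    S.nablaTorsion x a b c d = -S.nablaTorsion x a c b d := by
  simp only [nablaTorsion]
  rw [funext fun y ↦ torsionForm_swap_left hS y (FiberBundle.extend E b y)
    (FiberBundle.extend E c y) (FiberBundle.extend E d y), mvfderiv_fun_neg, neg_apply,
    torsionForm_swap_left hS x _ c d, torsionForm_swap_left hS x b _ d,
    torsionForm_swap_left hS x b c]
  ring

lemma nablaTorsion_swap_right (x : M) (a b c d : TangentSpace I x) :
    S.nablaTorsion x a b c d = -S.nablaTorsion x a b d c := by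
  simp only [nablaTorsion]
  rw [funext fun y ↦ torsionForm_swap_right y (FiberBundle.extend E b y)
    (FiberBundle.extend E c y) (FiberBundle.extend E d y), mvfderiv_fun_neg, neg_apply,
    torsionForm_swap_right x _ c d, torsionForm_swap_right x b _ d,
    torsionForm_swap_right x b c]
  ring

lemma nablaTorsion_map_left (hS : S.IsNearlyKahler) (x : M) (a b c d : TangentSpace I x) :
    S.nablaTorsion x a (S.J x b) c d = S.nablaTorsion x a b (S.J x c) d := by
  have hb := FiberBundle.mdifferentiableAt_extend I E b
  have hc := FiberBundle.mdifferentiableAt_extend I E c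
  have hd := FiberBundle.mdifferentiableAt_extend I E d
  have h1 := ((hasCovDerivAt_torsionForm (S := S) x).apply (S.mdifferentiableAt_mapField hb)
    hc hd).2 a
  have h2 := ((hasCovDerivAt_torsionForm (S := S) x).apply hb (S.mdifferentiableAt_mapField hc)
    hd).2 a
  have e : (fun y ↦ S.torsionForm y (S.mapField (FiberBundle.extend E b) y)
      (FiberBundle.extend E c y) (FiberBundle.extend E d y)) =
      fun y ↦ S.torsionForm y (FiberBundle.extend E b y)
      (S.mapField (FiberBundle.extend E c) y) (FiberBundle.extend E d y) :=
    funext fun y ↦ torsionForm_map_left hS y _ _ _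
  rw [e, h2, canonicalConnection_mapField hb, canonicalConnection_mapField hc] at h1
  simp only [mapField, FiberBundle.extend_apply_self, torsionForm_map_left hS] at h1
  linarith

/-- The exterior derivative of a three-form on commuting fields, in terms of the canonical
hermitian connection. -/
lemma alternation_mvfderiv (hS : S.IsNearlyKahler)
    {F : Π x : M, TangentSpace I x →ₗ[ℝ] TangentSpace I x →ₗ[ℝ] TangentSpace I x →ₗ[ℝ] ℝ} {x : M}
    {C : TangentSpace I x → TangentSpace I x → TangentSpace I x → TangentSpace I x → ℝ}
    (h : HasCovDerivAt₃ S.canonicalConnection F x C)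
    (h12 : ∀ u v w, F x u v w = -F x v u w) (h23 : ∀ u v w, F x u v w = -F x u w v)
    {X : Fin 4 → Π x : M, TangentSpace I x} (hX : ∀ i, MDiffAt (T% (X i)) x)
    (hXX : ∀ i j, VectorField.mlieBracket I (X i) (X j) x = 0) :
    mvfderiv I (fun y ↦ F y (X 1 y) (X 2 y) (X 3 y)) x (X 0 x)
      - mvfderiv I (fun y ↦ F y (X 0 y) (X 2 y) (X 3 y)) x (X 1 x)
      + mvfderiv I (fun y ↦ F y (X 0 y) (X 1 y) (X 3 y)) x (X 2 x)
      - mvfderiv I (fun y ↦ F y (X 0 y) (X 1 y) (X 2 y)) x (X 3 x) =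
    C (X 0 x) (X 1 x) (X 2 x) (X 3 x) - C (X 1 x) (X 0 x) (X 2 x) (X 3 x)
      + C (X 2 x) (X 0 x) (X 1 x) (X 3 x) - C (X 3 x) (X 0 x) (X 1 x) (X 2 x)
      - (F x (S.J x (S.nablaJ x (X 0 x) (X 1 x))) (X 2 x) (X 3 x)
        - F x (S.J x (S.nablaJ x (X 0 x) (X 2 x))) (X 1 x) (X 3 x)
        + F x (S.J x (S.nablaJ x (X 0 x) (X 3 x))) (X 1 x) (X 2 x)
        + F x (S.J x (S.nablaJ x (X 1 x) (X 2 x))) (X 0 x) (X 3 x)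
        - F x (S.J x (S.nablaJ x (X 1 x) (X 3 x))) (X 0 x) (X 2 x)
        + F x (S.J x (S.nablaJ x (X 2 x) (X 3 x))) (X 0 x) (X 1 x)) := by
  have hT : ∀ i j, ∀ v w, F x (S.J x (S.nablaJ x (X i x) (X j x))) v w =
      F x (S.canonicalConnection (X i) x (X j x)) v w -
        F x (S.canonicalConnection (X j) x (X i x)) v w := fun i j v w ↦ by
    have := hS.canonicalConnection_torsion (hX i) (hX j) (hXX i j)
    rw [← neg_neg (S.J x (S.nablaJ x (X i x) (X j x))), ← this]
    simp
  have h2 : ∀ u v w, F x u v w = -F x v u w := h12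
  have h3 : ∀ u v w, F x u v w = F x w u v := fun u v w ↦ by rw [h23, h12, neg_neg]
  rw [(h.apply (hX 1) (hX 2) (hX 3)).2, (h.apply (hX 0) (hX 2) (hX 3)).2,
    (h.apply (hX 0) (hX 1) (hX 3)).2, (h.apply (hX 0) (hX 1) (hX 2)).2]
  simp only [hT]
  rw [h2 (X 1 x) (S.canonicalConnection _ _ _), h2 (X 0 x) (S.canonicalConnection (X 2) x (X 1 x)),
    h2 (X 0 x) (S.canonicalConnection (X 1) x (X 2 x)),
    h2 (X 0 x) (S.canonicalConnection (X 1) x (X 3 x)),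
    h3 (X 1 x) (X 2 x) (S.canonicalConnection _ _ _),
    h3 (X 0 x) (X 2 x) (S.canonicalConnection (X 3) x (X 1 x)),
    h3 (X 0 x) (X 1 x) (S.canonicalConnection (X 3) x (X 2 x)),
    h3 (X 0 x) (X 1 x) (S.canonicalConnection (X 2) x (X 3 x))]
  ring

variable [I.Boundaryless]

lemma alternation_mvfderiv_kahlerTensor (hS : S.IsNearlyKahler) {x : M}
    {X Y Z : Π x : M, TangentSpace I x} (hX : MDiffAt (T% X) x) (hY : MDiffAt (T% Y) x)
    (hZ : MDiffAt (T% Z) x) (hXY : VectorField.mlieBracket I X Y x = 0)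
    (hYZ : VectorField.mlieBracket I Y Z x = 0) (hZX : VectorField.mlieBracket I Z X x = 0) :
    mvfderiv I (fun y ↦ S.kahlerTensor y (Y y) (Z y)) x (X x)
      + mvfderiv I (fun y ↦ S.kahlerTensor y (Z y) (X y)) x (Y x)
      + mvfderiv I (fun y ↦ S.kahlerTensor y (X y) (Y y)) x (Z x) =
      -3 * S.torsionForm x (X x) (Y x) (Z x) := by
  have t1 := (CovariantDerivative.torsion_eq_zero_iff _).1
    (leviCivita_torsion (I := I) (M := M)) hX hY
  have t2 := (CovariantDerivative.torsion_eq_zero_iff _).1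
    (leviCivita_torsion (I := I) (M := M)) hY hZ
  have t3 := (CovariantDerivative.torsion_eq_zero_iff _).1
    (leviCivita_torsion (I := I) (M := M)) hZ hX
  rw [hXY, sub_eq_zero] at t1
  rw [hYZ, sub_eq_zero] at t2
  rw [hZX, sub_eq_zero] at t3
  rw [(mvfderiv_kahlerTensor hY hZ).2, (mvfderiv_kahlerTensor hZ hX).2,
    (mvfderiv_kahlerTensor hX hY).2, t1, t2, t3, kahlerTensor_swap x (leviCivita I M X x (Y x)),
    kahlerTensor_swap x (leviCivita I M Y x (Z x)), kahlerTensor_swap x (leviCivita I M Z x (X x)),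
    torsionForm_swap_right x (X x) (Z x), torsionForm_swap_left hS x (Y x) (X x),
    torsionForm_swap_right x (Z x) (Y x), torsionForm_swap_left hS x (Z x) (X x),
    torsionForm_swap_right x (X x) (Z x)]
  ring

lemma torsionForm_extend_eventuallyEq (hS : S.IsNearlyKahler) {x : M} (b c d : TangentSpace I x) :
    ∀ᶠ y in 𝓝 x, S.torsionForm y (FiberBundle.extend E b y) (FiberBundle.extend E c y)
        (FiberBundle.extend E d y) = -(1 / 3 : ℝ) *
      (mvfderiv I (fun z ↦ S.kahlerTensor z (FiberBundle.extend E c z) (FiberBundle.extend E d z)) y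
          (FiberBundle.extend E b y)
        + mvfderiv I (fun z ↦ S.kahlerTensor z (FiberBundle.extend E d z)
          (FiberBundle.extend E b z)) y (FiberBundle.extend E c y)
        + mvfderiv I (fun z ↦ S.kahlerTensor z (FiberBundle.extend E b z)
          (FiberBundle.extend E c z)) y (FiberBundle.extend E d y)) := by
  filter_upwards [eventually_mdifferentiableAt_extend b, eventually_mdifferentiableAt_extend c,
    eventually_mdifferentiableAt_extend d, eventually_mlieBracket_extend_eq_zero b c,
    eventually_mlieBracket_extend_eq_zero c d, eventually_mlieBracket_extend_eq_zero d b]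
    with y hb hc hd h1 h2 h3
  rw [alternation_mvfderiv_kahlerTensor hS hb hc hd h1 h2 h3]
  ring

end AlmostHermitianStructure

end NearlyKahler

end
noncomputable section

namespace NearlyKahler

namespace AlmostHermitianStructure

variable {E : Type*} [NormedAddCommGroup E] [NormedSpace ℝ E] [FiniteDimensional ℝ E]
  [CompleteSpace E]
  {H : Type*} [TopologicalSpace H] {I : ModelWithCorners ℝ E H} [I.Boundaryless]
  {M : Type*} [TopologicalSpace M] [ChartedSpace H M] [IsManifold I ∞ M]
  [RiemannianBundle (fun x : M ↦ TangentSpace I x)]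
  [IsContMDiffRiemannianBundle I ∞ E (fun x : M ↦ TangentSpace I x)]
  {S : AlmostHermitianStructure I M}

variable (S) in
/-- The second derivative of a component of the Kähler form along coordinate fields. -/
def kahlerHessian (x : M) (a b c d : TangentSpace I x) : ℝ :=
  mvfderiv I (fun y ↦ mvfderiv I (fun z ↦ S.kahlerTensor z (FiberBundle.extend E c z)
    (FiberBundle.extend E d z)) y (FiberBundle.extend E b y)) x a

lemma contMDiffAt_kahlerTensor_extend (x : M) (c d : TangentSpace I x) :
    ContMDiffAt I 𝓘(ℝ, ℝ) ∞ (fun z ↦ S.kahlerTensor z (FiberBundle.extend E c z)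
      (FiberBundle.extend E d z)) x :=
  contMDiffAt_kahlerTensor (eventually_contMDiffAt_extend c).self_of_nhds
    (eventually_contMDiffAt_extend d).self_of_nhds

lemma kahlerHessian_comm (x : M) (a b c d : TangentSpace I x) :
    S.kahlerHessian x a b c d = S.kahlerHessian x b a c d :=
  mvfderiv_mvfderiv_extend_comm
    ((contMDiffAt_kahlerTensor_extend x c d).of_le (by norm_cast)) _ _

lemma kahlerHessian_swap (x : M) (a b c d : TangentSpace I x) :
    S.kahlerHessian x a b c d = -S.kahlerHessian x a b d c := by
  simp only [kahlerHessian]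
  rw [funext fun z ↦ kahlerTensor_swap z (FiberBundle.extend E c z) (FiberBundle.extend E d z)]
  simp only [mvfderiv_fun_neg, neg_apply]

lemma mvfderiv_torsionForm_extend (hS : S.IsNearlyKahler) (x : M) (a b c d : TangentSpace I x) :
    mvfderiv I (fun y ↦ S.torsionForm y (FiberBundle.extend E b y) (FiberBundle.extend E c y)
      (FiberBundle.extend E d y)) x a = -(1 / 3 : ℝ) * (S.kahlerHessian x a b c d
        + S.kahlerHessian x a c d b + S.kahlerHessian x a d b c) := by
  have hd : ∀ b c d : TangentSpace I x, MDifferentiableAt I 𝓘(ℝ, ℝ) (fun y ↦ mvfderiv I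
      (fun z ↦ S.kahlerTensor z (FiberBundle.extend E c z) (FiberBundle.extend E d z)) y
      (FiberBundle.extend E b y)) x := fun b c d ↦
    mdifferentiableAt_mvfderiv_extend
      ((contMDiffAt_kahlerTensor_extend x c d).of_le (by norm_cast)) _
  have key : ∀ {f g h : M → ℝ}, MDifferentiableAt I 𝓘(ℝ, ℝ) f x → MDifferentiableAt I 𝓘(ℝ, ℝ) g x →
      MDifferentiableAt I 𝓘(ℝ, ℝ) h x → mvfderiv I (fun y ↦ -(1 / 3 : ℝ) * (f y + g y + h y)) x a =
      -(1 / 3 : ℝ) * (mvfderiv I f x a + mvfderiv I g x a + mvfderiv I h x a) := by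
    intro f g h hf hg hh
    have hfg : MDifferentiableAt I 𝓘(ℝ, ℝ) (fun y ↦ f y + g y) x := hf.add hg
    have hfgh : MDifferentiableAt I 𝓘(ℝ, ℝ) (fun y ↦ f y + g y + h y) x := hfg.add hh
    rw [mvfderiv_fun_mul mdifferentiableAt_const hfgh, mvfderiv_fun_add hfg hh,
      mvfderiv_fun_add hf hg, mvfderiv_const]
    simp
    ring
  rw [mvfderiv_congr_of_eventuallyEq (torsionForm_extend_eventuallyEq hS b c d)]
  exact key (hd _ _ _) (hd _ _ _) (hd _ _ _)

lemma alternation_nablaTorsion (hS : S.IsNearlyKahler) (x : M) (a b c d : TangentSpace I x) :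
    S.nablaTorsion x a b c d - S.nablaTorsion x b a c d + S.nablaTorsion x c a b d
      - S.nablaTorsion x d a b c = 0 := by
  have h := alternation_mvfderiv hS (hasCovDerivAt_torsionForm (S := S) x)
    (torsionForm_swap_left hS x) (torsionForm_swap_right x)
    (X := fun i ↦ FiberBundle.extend E (![a, b, c, d] i))
    (fun i ↦ FiberBundle.mdifferentiableAt_extend I E _)
    (fun i j ↦ (eventually_mlieBracket_extend_eq_zero _ _).self_of_nhds)
  have hA : ∀ u v w z, S.torsionForm x (S.J x (S.nablaJ x u v)) w z =
      -S.torsionForm x (S.J x (S.nablaJ x w z)) u v := by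
    intro u v w z
    have h1 := torsionForm_swap_left hS x (S.J x (S.nablaJ x u v)) w z
    have h2 := torsionForm_swap_right (S := S) x w (S.J x (S.nablaJ x u v)) z
    have h3 := torsionForm_swap_left hS x (S.J x (S.nablaJ x w z)) u v
    have h4 := torsionForm_swap_right (S := S) x u (S.J x (S.nablaJ x w z)) v
    simp only [torsionForm_apply] at *
    have h5 := (S.isOrthogonalComplexStructure x).inner_left (S.nablaJ x u v) (S.nablaJ x w z)
    simp only [ContinuousLinearMap.coe_coe] at h5
    rw [real_inner_comm] at h5
    linarith
  simp only [FiberBundle.extend_apply_self] at h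
  simp at h
  simp only [mvfderiv_torsionForm_extend hS] at h
  rw [hA a b c d, hA a c b d, hA a d b c] at h
  have hs := kahlerHessian_swap (S := S) x
  rw [kahlerHessian_comm x b a c d, kahlerHessian_comm x b c d a, kahlerHessian_comm x b d a c,
    kahlerHessian_comm x c a b d, kahlerHessian_comm x c d a b, kahlerHessian_comm x d a b c] at h
  linarith [hs a b c d, hs a c b d, hs a d b c, hs b c a d, hs b d a c, hs c d a b,
    hs c b d a, hs d b a c, hs d c a b]

lemma nablaTorsion_neg (hS : S.IsNearlyKahler) (x : M) (a b c d : TangentSpace I x) :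
    S.nablaTorsion x a (-b) c d = -S.nablaTorsion x a b c d := by
  rw [nablaTorsion_swap_left hS, nablaTorsion_swap_right,
    (hasCovDerivAt_torsionForm (S := S) x).isLinearMap a c d |>.map_neg,
    nablaTorsion_swap_left hS x a b, nablaTorsion_swap_right x a c b]

lemma nablaTorsion_map (hS : S.IsNearlyKahler) (x : M) (a b c d : TangentSpace I x) :
    S.nablaTorsion x (S.J x a) b c d = S.nablaTorsion x a (S.J x b) c d :=
  map_left_of_alternation_eq_zero (S.isOrthogonalComplexStructure x) (nablaTorsion_swap_left hS x)
    (nablaTorsion_swap_right x) (nablaTorsion_map_left hS x) (nablaTorsion_neg hS x)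
    (alternation_nablaTorsion hS x) a b c d

variable (S) in
/-- The three-form `A(Ju, v, w)`, where `A` is the torsion form. -/
def conjTorsionForm (x : M) :
    TangentSpace I x →ₗ[ℝ] TangentSpace I x →ₗ[ℝ] TangentSpace I x →ₗ[ℝ] ℝ :=
  (S.torsionForm x).comp (S.J x).toLinearMap

lemma conjTorsionForm_apply (x : M) (u v w : TangentSpace I x) :
    S.conjTorsionForm x u v w = S.torsionForm x (S.J x u) v w := rfl

lemma conjTorsionForm_swap_left (hS : S.IsNearlyKahler) (x : M) (u v w : TangentSpace I x) :
    S.conjTorsionForm x u v w = -S.conjTorsionForm x v u w := by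
  rw [conjTorsionForm_apply, conjTorsionForm_apply, torsionForm_map_left hS,
    torsionForm_swap_left hS]

lemma conjTorsionForm_swap_right (x : M) (u v w : TangentSpace I x) :
    S.conjTorsionForm x u v w = -S.conjTorsionForm x u w v := by
  rw [conjTorsionForm_apply, conjTorsionForm_apply, torsionForm_swap_right]

lemma hasCovDerivAt_conjTorsionForm (x : M) :
    HasCovDerivAt₃ S.canonicalConnection S.conjTorsionForm x
      (fun a b c d ↦ S.nablaTorsion x a (S.J x b) c d) := by
  intro b c d
  have hb := FiberBundle.mdifferentiableAt_extend I E b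
  have hc := FiberBundle.mdifferentiableAt_extend I E c
  have hd := FiberBundle.mdifferentiableAt_extend I E d
  have h := (hasCovDerivAt_torsionForm (S := S) x).apply (S.mdifferentiableAt_mapField hb) hc hd
  refine ⟨h.1, fun a ↦ (h.2 a).trans ?_⟩
  rw [canonicalConnection_mapField hb]
  simp only [mapField, FiberBundle.extend_apply_self, conjTorsionForm_apply]

/-- The exterior derivative of the three-form `A(Ju, v, w)`. -/
lemma alternation_mvfderiv_conjTorsionForm (hS : S.IsNearlyKahler) {x : M}
    {X : Fin 4 → Π x : M, TangentSpace I x} (hX : ∀ i, MDiffAt (T% (X i)) x)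
    (hXX : ∀ i j, VectorField.mlieBracket I (X i) (X j) x = 0) :
    mvfderiv I (fun y ↦ S.conjTorsionForm y (X 1 y) (X 2 y) (X 3 y)) x (X 0 x)
      - mvfderiv I (fun y ↦ S.conjTorsionForm y (X 0 y) (X 2 y) (X 3 y)) x (X 1 x)
      + mvfderiv I (fun y ↦ S.conjTorsionForm y (X 0 y) (X 1 y) (X 3 y)) x (X 2 x)
      - mvfderiv I (fun y ↦ S.conjTorsionForm y (X 0 y) (X 1 y) (X 2 y)) x (X 3 x) =
    2 * (inner ℝ (S.nablaJ x (X 0 x) (X 1 x)) (S.nablaJ x (X 2 x) (X 3 x))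
      - inner ℝ (S.nablaJ x (X 0 x) (X 2 x)) (S.nablaJ x (X 1 x) (X 3 x))
      + inner ℝ (S.nablaJ x (X 0 x) (X 3 x)) (S.nablaJ x (X 1 x) (X 2 x))) := by
  rw [alternation_mvfderiv hS (hasCovDerivAt_conjTorsionForm (S := S) x)
    (conjTorsionForm_swap_left hS x) (conjTorsionForm_swap_right x) hX hXX]
  have hA : ∀ u v w z, S.conjTorsionForm x (S.J x (S.nablaJ x u v)) w z =
      -inner ℝ (S.nablaJ x u v) (S.nablaJ x w z) := by
    intro u v w z
    rw [conjTorsionForm_apply, S.sq, map_neg, LinearMap.neg_apply, LinearMap.neg_apply,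
      torsionForm_swap_left hS, torsionForm_swap_right, neg_neg, torsionForm_apply,
      real_inner_comm]
  have h := alternation_nablaTorsion hS x (S.J x (X 0 x)) (X 1 x) (X 2 x) (X 3 x)
  rw [nablaTorsion_map hS] at h
  simp only [hA]
  rw [real_inner_comm (S.nablaJ x (X 0 x) (X 1 x)) (S.nablaJ x (X 2 x) (X 3 x)),
    real_inner_comm (S.nablaJ x (X 0 x) (X 2 x)) (S.nablaJ x (X 1 x) (X 3 x)),
    real_inner_comm (S.nablaJ x (X 0 x) (X 3 x)) (S.nablaJ x (X 1 x) (X 2 x))]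
  linarith

end AlmostHermitianStructure

end NearlyKahler

end
noncomputable section

namespace NearlyKahler

section Extrema

variable {E : Type*} [NormedAddCommGroup E] [NormedSpace ℝ E]
  {H : Type*} [TopologicalSpace H] {I : ModelWithCorners ℝ E H} [I.Boundaryless]
  {M : Type*} [TopologicalSpace M] [ChartedSpace H M] [IsManifold I ∞ M]

lemma tendsto_extChartAt_symm (x : M) :
    Filter.Tendsto (extChartAt I x).symm (𝓝 (extChartAt I x x)) (𝓝 x) := by
  have := continuousAt_extChartAt_symm (I := I) x
  rwa [ContinuousAt, extChartAt_to_inv] at this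

lemma mvfderiv_eq_zero_of_isLocalMin {h : M → ℝ} {x : M} (hh : MDifferentiableAt I 𝓘(ℝ, ℝ) h x)
    (hmin : ∀ᶠ y in 𝓝 x, h x ≤ h y) (u : TangentSpace I x) : mvfderiv I h x u = 0 := by
  have h1 := mvfderiv_apply_extend (I := I) (mem_chart_source H x) u hh
  rw [FiberBundle.extend_apply_self] at h1
  have h2 : IsLocalMin (h ∘ (extChartAt I x).symm) (extChartAt I x x) := by
    filter_upwards [(tendsto_extChartAt_symm (I := I) x).eventually hmin] with z hz
    simpa using hz
  rw [h1, h2.fderiv_eq_zero]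
  rfl

lemma eq_of_mvfderiv_eq_zero [PreconnectedSpace M] {h : M → ℝ}
    (hh : ∀ x, MDifferentiableAt I 𝓘(ℝ, ℝ) h x) (h0 : ∀ (x : M) (u : TangentSpace I x),
      mvfderiv I h x u = 0) (x y : M) : h x = h y := by
  have hloc : IsLocallyConstant h := by
    rw [IsLocallyConstant.iff_eventually_eq]
    intro x
    obtain ⟨r, hr, hball⟩ := Metric.mem_nhds_iff.1 (extChartAt_target_mem_nhds (I := I) x)
    have hs : ∀ z ∈ (extChartAt I x).target,
        MDifferentiableAt 𝓘(ℝ, E) I (extChartAt I x).symm z := by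
      intro z hz
      have := mdifferentiableWithinAt_extChartAt_symm (I := I) hz
      rwa [I.range_eq_univ, mdifferentiableWithinAt_univ] at this
    have hd : ∀ z ∈ (extChartAt I x).target,
        HasFDerivAt (h ∘ (extChartAt I x).symm) (0 : E →L[ℝ] ℝ) z := by
      intro z hz
      have h1 := ((hh _).comp z (hs z hz)).differentiableAt.hasFDerivAt
      have h2 : fderiv ℝ (h ∘ (extChartAt I x).symm) z = 0 := by
        rw [← mfderiv_eq_fderiv, mfderiv_comp z (hh _) (hs z hz)]
        ext u
        exact h0 ((extChartAt I x).symm z) _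
      rwa [h2] at h1
    have hconst : ∀ z ∈ Metric.ball (extChartAt I x x) r,
        (h ∘ (extChartAt I x).symm) z = h x := by
      intro z hz
      have := (convex_ball (extChartAt I x x) r).is_const_of_fderivWithin_eq_zero (𝕜 := ℝ)
        (f := h ∘ (extChartAt I x).symm)
        (fun w hw ↦ (hd w (hball hw)).differentiableAt.differentiableWithinAt)
        (fun w hw ↦ by
          rw [fderivWithin_of_isOpen Metric.isOpen_ball hw]
          exact (hd w (hball hw)).fderiv) hz (Metric.mem_ball_self hr)
      simpa using this
    filter_upwards [extChartAt_source_mem_nhds (I := I) x,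
      (continuousAt_extChartAt (I := I) x).preimage_mem_nhds (Metric.ball_mem_nhds _ hr)]
      with y hy hy'
    have := hconst _ hy'
    rwa [Function.comp_apply, (extChartAt I x).left_inv hy] at this
  exact hloc.apply_eq_of_isPreconnected isPreconnected_univ (Set.mem_univ x) (Set.mem_univ y)

end Extrema

namespace AlmostHermitianStructure

variable {E : Type*} [NormedAddCommGroup E] [NormedSpace ℝ E] [FiniteDimensional ℝ E]
  [CompleteSpace E]
  {H : Type*} [TopologicalSpace H] {I : ModelWithCorners ℝ E H} [I.Boundaryless]
  {M : Type*} [TopologicalSpace M] [ChartedSpace H M] [IsManifold I ∞ M]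
  [RiemannianBundle (fun x : M ↦ TangentSpace I x)]
  [IsContMDiffRiemannianBundle I ∞ E (fun x : M ↦ TangentSpace I x)]
  {S : AlmostHermitianStructure I M}

variable (S) in
/-- The structure has type `N`:
`g((∇_a J)b, (∇_c J)d) = N (g(a,c) g(b,d) - g(a,d) g(b,c) - Ω(a,c) Ω(b,d) + Ω(a,d) Ω(b,c))`. -/
def HasTypeFunction (N : M → ℝ) : Prop :=
  ∀ (x : M) (a b c d : TangentSpace I x), inner ℝ (S.nablaJ x a b) (S.nablaJ x c d) =
    N x * (inner ℝ a c * inner ℝ b d - inner ℝ a d * inner ℝ b c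
      - S.kahlerTensor x a c * S.kahlerTensor x b d + S.kahlerTensor x a d * S.kahlerTensor x b c)

lemma exists_isUnitaryFrame_of_finrank_eq (hE : finrank ℝ E = 6) {x : M} {u : TangentSpace I x}
    (hu : ‖u‖ = 1) : ∃ e : Fin 3 → TangentSpace I x, e 0 = u ∧
      IsUnitaryFrame (S.J x).toLinearMap e :=
  (S.isOrthogonalComplexStructure x).exists_isUnitaryFrame hE hu

lemma exists_isUnitaryFrame (hE : finrank ℝ E = 6) (x : M) :
    ∃ e : Fin 3 → TangentSpace I x, IsUnitaryFrame (S.J x).toLinearMap e := by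
  obtain ⟨u, hu, -⟩ := exists_unit_orthogonal (V := TangentSpace I x) ∅
    (by rw [show finrank ℝ (TangentSpace I x) = 6 from hE]; simp)
  obtain ⟨e, -, he⟩ := exists_isUnitaryFrame_of_finrank_eq (S := S) hE hu
  exact ⟨e, he⟩

lemma IsNearlyKahler.exists_hasTypeFunction (hS : S.IsNearlyKahler) (hE : finrank ℝ E = 6) :
    ∃ N : M → ℝ, (∀ x, 0 ≤ N x) ∧ S.HasTypeFunction N := by
  choose e he using exists_isUnitaryFrame (S := S) hE
  exact ⟨fun x ↦ inner ℝ (S.nablaJ x (e x 0) (e x 1)) (e x 2) ^ 2 +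
    inner ℝ (S.nablaJ x (e x 0) (e x 1)) (S.J x (e x 2)) ^ 2, fun x ↦ by positivity,
    fun x a b c d ↦ (hS.isNearlyKahlerTensor x).exists_constantType
      (S.isOrthogonalComplexStructure x) hE (he x) a b c d⟩

variable (S) in
/-- Half the square of the Kähler form. -/
def kahlerSq (x : M) (a b c d : TangentSpace I x) : ℝ :=
  S.kahlerTensor x a b * S.kahlerTensor x c d - S.kahlerTensor x a c * S.kahlerTensor x b d
    + S.kahlerTensor x a d * S.kahlerTensor x b c

lemma contMDiffAt_conjTorsionForm_extend (x : M) (b c d : TangentSpace I x) :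
    ContMDiffAt I 𝓘(ℝ, ℝ) ∞ (fun y ↦ S.conjTorsionForm y (FiberBundle.extend E b y)
      (FiberBundle.extend E c y) (FiberBundle.extend E d y)) x :=
  (contMDiffAt_torsionForm (contMDiffAt_mapField (eventually_contMDiffAt_extend b).self_of_nhds)
    (eventually_contMDiffAt_extend c).self_of_nhds
    (eventually_contMDiffAt_extend d).self_of_nhds).congr_of_eventuallyEq
      (.of_forall fun y ↦ conjTorsionForm_apply y _ _ _)

variable (S) in
/-- The first derivative of a component of the conjugate torsion form along a coordinate field. -/
def conjTorsionDeriv (x : M) (a b c d : TangentSpace I x) (y : M) : ℝ :=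
  mvfderiv I (fun z ↦ S.conjTorsionForm z (FiberBundle.extend E b z) (FiberBundle.extend E c z)
    (FiberBundle.extend E d z)) y (FiberBundle.extend E a y)

lemma mdifferentiableAt_conjTorsionDeriv (x : M) (a b c d : TangentSpace I x) :
    MDifferentiableAt I 𝓘(ℝ, ℝ) (S.conjTorsionDeriv x a b c d) x :=
  mdifferentiableAt_mvfderiv_extend
    ((contMDiffAt_conjTorsionForm_extend x b c d).of_le (by norm_cast)) _

lemma mvfderiv_conjTorsionDeriv_comm (x : M) (a b c d e : TangentSpace I x) :
    mvfderiv I (S.conjTorsionDeriv x b c d e) x a = mvfderiv I (S.conjTorsionDeriv x a c d e) x b :=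
  mvfderiv_mvfderiv_extend_comm
    ((contMDiffAt_conjTorsionForm_extend x c d e).of_le (by norm_cast)) _ _

lemma HasTypeFunction.eventually_eq (hS : S.IsNearlyKahler) {N : M → ℝ} (hN : S.HasTypeFunction N)
    (x : M) (a b c d : TangentSpace I x) : ∀ᶠ y in 𝓝 x,
      S.conjTorsionDeriv x a b c d y - S.conjTorsionDeriv x b a c d y
        + S.conjTorsionDeriv x c a b d y - S.conjTorsionDeriv x d a b c y =
      4 * (N y * S.kahlerSq y (FiberBundle.extend E a y) (FiberBundle.extend E b y)
        (FiberBundle.extend E c y) (FiberBundle.extend E d y)) := by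
  have h1 : ∀ᶠ y in 𝓝 x, ∀ i : Fin 4,
      MDiffAt (T% (FiberBundle.extend E (![a, b, c, d] i))) y :=
    Filter.eventually_all.2 fun i ↦ eventually_mdifferentiableAt_extend _
  have h2 : ∀ᶠ y in 𝓝 x, ∀ i j : Fin 4, VectorField.mlieBracket I
      (FiberBundle.extend E (![a, b, c, d] i)) (FiberBundle.extend E (![a, b, c, d] j)) y = 0 :=
    Filter.eventually_all.2 fun i ↦ Filter.eventually_all.2 fun j ↦
      eventually_mlieBracket_extend_eq_zero _ _
  filter_upwards [h1, h2] with y h1 h2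
  have h := alternation_mvfderiv_conjTorsionForm hS h1 h2
  rw [hN, hN, hN] at h
  refine h.trans ?_
  simp only [Matrix.cons_val, kahlerSq]
  rw [real_inner_comm (FiberBundle.extend E b y) (FiberBundle.extend E c y),
    real_inner_comm (FiberBundle.extend E b y) (FiberBundle.extend E d y),
    real_inner_comm (FiberBundle.extend E c y) (FiberBundle.extend E d y),
    kahlerTensor_swap y (FiberBundle.extend E c y) (FiberBundle.extend E b y),
    kahlerTensor_swap y (FiberBundle.extend E d y) (FiberBundle.extend E b y),
    kahlerTensor_swap y (FiberBundle.extend E d y) (FiberBundle.extend E c y)]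
  ring

end AlmostHermitianStructure

end NearlyKahler

end
noncomputable section

namespace NearlyKahler

section Products

variable {E : Type*} [NormedAddCommGroup E] [NormedSpace ℝ E]
  {H : Type*} [TopologicalSpace H] {I : ModelWithCorners ℝ E H}
  {M : Type*} [TopologicalSpace M] [ChartedSpace H M]

lemma mvfderiv_mul_apply {f g : M → ℝ} {x : M} (hf : MDifferentiableAt I 𝓘(ℝ, ℝ) f x)
    (hg : MDifferentiableAt I 𝓘(ℝ, ℝ) g x) (u : TangentSpace I x) :
    mvfderiv I (fun y ↦ f y * g y) x u = mvfderiv I f x u * g x + f x * mvfderiv I g x u := by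
  rw [mvfderiv_fun_mul hf hg]
  simp
  ring

lemma mvfderiv_add_apply {f g : M → ℝ} {x : M} (hf : MDifferentiableAt I 𝓘(ℝ, ℝ) f x)
    (hg : MDifferentiableAt I 𝓘(ℝ, ℝ) g x) (u : TangentSpace I x) :
    mvfderiv I (fun y ↦ f y + g y) x u = mvfderiv I f x u + mvfderiv I g x u := by
  rw [mvfderiv_fun_add hf hg]
  simp

lemma mvfderiv_sub_apply {f g : M → ℝ} {x : M} (hf : MDifferentiableAt I 𝓘(ℝ, ℝ) f x)
    (hg : MDifferentiableAt I 𝓘(ℝ, ℝ) g x) (u : TangentSpace I x) :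
    mvfderiv I (fun y ↦ f y - g y) x u = mvfderiv I f x u - mvfderiv I g x u := by
  rw [mvfderiv_fun_sub hf hg]
  simp

lemma mdifferentiableAt_fun_mul {f g : M → ℝ} {x : M} (hf : MDifferentiableAt I 𝓘(ℝ, ℝ) f x)
    (hg : MDifferentiableAt I 𝓘(ℝ, ℝ) g x) :
    MDifferentiableAt I 𝓘(ℝ, ℝ) (fun y ↦ f y * g y) x := hf.mul hg

lemma mdifferentiableAt_fun_add {f g : M → ℝ} {x : M} (hf : MDifferentiableAt I 𝓘(ℝ, ℝ) f x)
    (hg : MDifferentiableAt I 𝓘(ℝ, ℝ) g x) :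
    MDifferentiableAt I 𝓘(ℝ, ℝ) (fun y ↦ f y + g y) x := hf.add hg

lemma mdifferentiableAt_fun_sub {f g : M → ℝ} {x : M} (hf : MDifferentiableAt I 𝓘(ℝ, ℝ) f x)
    (hg : MDifferentiableAt I 𝓘(ℝ, ℝ) g x) :
    MDifferentiableAt I 𝓘(ℝ, ℝ) (fun y ↦ f y - g y) x := hf.sub hg

end Products

namespace AlmostHermitianStructure

variable {E : Type*} [NormedAddCommGroup E] [NormedSpace ℝ E] [FiniteDimensional ℝ E]
  [CompleteSpace E]
  {H : Type*} [TopologicalSpace H] {I : ModelWithCorners ℝ E H} [I.Boundaryless]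
  {M : Type*} [TopologicalSpace M] [ChartedSpace H M] [IsManifold I ∞ M]
  [RiemannianBundle (fun x : M ↦ TangentSpace I x)]
  [IsContMDiffRiemannianBundle I ∞ E (fun x : M ↦ TangentSpace I x)]
  {S : AlmostHermitianStructure I M}

variable (S) in
/-- The derivative of a component of the Kähler form in the coordinates at `x`. -/
def kahlerDeriv (x : M) (a b c : TangentSpace I x) : ℝ :=
  mvfderiv I (fun y ↦ S.kahlerTensor y (FiberBundle.extend E b y) (FiberBundle.extend E c y)) x a

lemma kahlerDeriv_swap (x : M) (a b c : TangentSpace I x) :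
    S.kahlerDeriv x a b c = -S.kahlerDeriv x a c b := by
  simp only [kahlerDeriv]
  rw [funext fun z ↦ kahlerTensor_swap z (FiberBundle.extend E b z) (FiberBundle.extend E c z),
    mvfderiv_fun_neg, neg_apply]

lemma kahlerDeriv_cyclic (hS : S.IsNearlyKahler) (x : M) (a b c : TangentSpace I x) :
    S.kahlerDeriv x a b c + S.kahlerDeriv x b c a + S.kahlerDeriv x c a b =
      -3 * S.torsionForm x a b c := by
  have h := alternation_mvfderiv_kahlerTensor hS (FiberBundle.mdifferentiableAt_extend I E a)
    (FiberBundle.mdifferentiableAt_extend I E b) (FiberBundle.mdifferentiableAt_extend I E c)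
    (eventually_mlieBracket_extend_eq_zero _ _).self_of_nhds
    (eventually_mlieBracket_extend_eq_zero _ _).self_of_nhds
    (eventually_mlieBracket_extend_eq_zero _ _).self_of_nhds
  simpa only [FiberBundle.extend_apply_self, kahlerDeriv] using h

lemma mdifferentiableAt_kahlerTensor_extend (x : M) (b c : TangentSpace I x) :
    MDifferentiableAt I 𝓘(ℝ, ℝ) (fun y ↦ S.kahlerTensor y (FiberBundle.extend E b y)
      (FiberBundle.extend E c y)) x :=
  (contMDiffAt_kahlerTensor_extend x b c).mdifferentiableAt (by simp)

lemma mdifferentiableAt_kahlerSq_extend (x : M) (b c d e : TangentSpace I x) :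
    MDifferentiableAt I 𝓘(ℝ, ℝ) (fun y ↦ S.kahlerSq y (FiberBundle.extend E b y)
      (FiberBundle.extend E c y) (FiberBundle.extend E d y) (FiberBundle.extend E e y)) x :=
  (((mdifferentiableAt_kahlerTensor_extend x b c).mul
    (mdifferentiableAt_kahlerTensor_extend x d e)).sub
    ((mdifferentiableAt_kahlerTensor_extend x b d).mul
    (mdifferentiableAt_kahlerTensor_extend x c e))).add
    ((mdifferentiableAt_kahlerTensor_extend x b e).mul
    (mdifferentiableAt_kahlerTensor_extend x c d))

lemma mvfderiv_kahlerSq_extend (x : M) (a b c d e : TangentSpace I x) :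
    mvfderiv I (fun y ↦ S.kahlerSq y (FiberBundle.extend E b y)
      (FiberBundle.extend E c y) (FiberBundle.extend E d y) (FiberBundle.extend E e y)) x a =
    S.kahlerDeriv x a b c * S.kahlerTensor x d e + S.kahlerTensor x b c * S.kahlerDeriv x a d e
      - (S.kahlerDeriv x a b d * S.kahlerTensor x c e
        + S.kahlerTensor x b d * S.kahlerDeriv x a c e)
      + (S.kahlerDeriv x a b e * S.kahlerTensor x c d
        + S.kahlerTensor x b e * S.kahlerDeriv x a c d) := by
  have h := mdifferentiableAt_kahlerTensor_extend (S := S) x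
  have hm : ∀ b c d e : TangentSpace I x, MDifferentiableAt I 𝓘(ℝ, ℝ)
      (fun y ↦ S.kahlerTensor y (FiberBundle.extend E b y) (FiberBundle.extend E c y) *
        S.kahlerTensor y (FiberBundle.extend E d y) (FiberBundle.extend E e y)) x :=
    fun b c d e ↦ (h b c).mul (h d e)
  simp only [kahlerSq]
  rw [mvfderiv_add_apply (mdifferentiableAt_fun_sub (hm _ _ _ _) (hm _ _ _ _)) (hm _ _ _ _),
    mvfderiv_sub_apply (hm _ _ _ _) (hm _ _ _ _), mvfderiv_mul_apply (h _ _) (h _ _),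
    mvfderiv_mul_apply (h _ _) (h _ _), mvfderiv_mul_apply (h _ _) (h _ _)]
  simp only [FiberBundle.extend_apply_self, kahlerDeriv]

lemma kahlerTensor_frame {x : M} {e : Fin 3 → TangentSpace I x}
    (he : IsUnitaryFrame (S.J x).toLinearMap e) (i j : Fin 3) :
    S.kahlerTensor x (e i) (e j) = 0 ∧ S.kahlerTensor x (S.J x (e i)) (S.J x (e j)) = 0 ∧
      S.kahlerTensor x (e i) (S.J x (e j)) = (if i = j then -1 else 0) ∧
      S.kahlerTensor x (S.J x (e i)) (e j) = (if i = j then 1 else 0) := by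
  have h1 := he.inner_map i j
  have h2 := he.map_inner i j
  have h3 := he.inner_eq i j
  have h4 := he.map_inner_map i j
  simp only [ContinuousLinearMap.coe_coe] at h1 h2 h4
  simp only [kahlerTensor_apply, S.sq, inner_neg_right, h1, h2, h3, h4]
  split <;> simp

lemma HasTypeFunction.mdifferentiableAt (hS : S.IsNearlyKahler) (hE : finrank ℝ E = 6)
    {N : M → ℝ} (hN : S.HasTypeFunction N) (x : M) : MDifferentiableAt I 𝓘(ℝ, ℝ) N x := by
  obtain ⟨e, he⟩ := exists_isUnitaryFrame (S := S) hE x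
  have hQ := mdifferentiableAt_kahlerSq_extend (S := S) x (e 1) (S.J x (e 1)) (e 2) (S.J x (e 2))
  have hR : MDifferentiableAt I 𝓘(ℝ, ℝ) (fun y ↦
      S.conjTorsionDeriv x (e 1) (S.J x (e 1)) (e 2) (S.J x (e 2)) y
        - S.conjTorsionDeriv x (S.J x (e 1)) (e 1) (e 2) (S.J x (e 2)) y
        + S.conjTorsionDeriv x (e 2) (e 1) (S.J x (e 1)) (S.J x (e 2)) y
        - S.conjTorsionDeriv x (S.J x (e 2)) (e 1) (S.J x (e 1)) (e 2) y) x :=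
    (((mdifferentiableAt_conjTorsionDeriv x _ _ _ _).sub
      (mdifferentiableAt_conjTorsionDeriv x _ _ _ _)).add
      (mdifferentiableAt_conjTorsionDeriv x _ _ _ _)).sub
      (mdifferentiableAt_conjTorsionDeriv x _ _ _ _)
  have h1 : S.kahlerSq x (e 1) (S.J x (e 1)) (e 2) (S.J x (e 2)) ≠ 0 := by
    simp [kahlerSq, kahlerTensor_frame he]
  have h1' : S.kahlerSq x (FiberBundle.extend E (e 1) x) (FiberBundle.extend E (S.J x (e 1)) x)
      (FiberBundle.extend E (e 2) x) (FiberBundle.extend E (S.J x (e 2)) x) ≠ 0 := by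
    simpa only [FiberBundle.extend_apply_self] using h1
  have hc : MDifferentiableAt I 𝓘(ℝ, ℝ) (fun _ : M ↦ (4⁻¹ : ℝ)) x := mdifferentiableAt_const
  refine ((hc.mul hR).mul (hQ.inv h1')).congr_of_eventuallyEq ?_
  filter_upwards [hN.eventually_eq hS x (e 1) (S.J x (e 1)) (e 2) (S.J x (e 2)),
    hQ.continuousAt.eventually_ne h1'] with y hy hy0
  simp only [Pi.mul_apply, Pi.inv_apply, hy]
  field_simp

lemma HasTypeFunction.mvfderiv_eq_zero (hS : S.IsNearlyKahler) (hE : finrank ℝ E = 6)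
    {N : M → ℝ} (hN : S.HasTypeFunction N) (x : M) (u : TangentSpace I x) :
    mvfderiv I N x u = 0 := by
  have hunit : ∀ u : TangentSpace I x, ‖u‖ = 1 → mvfderiv I N x u = 0 := by
    intro u hu
    obtain ⟨e, rfl, he⟩ := exists_isUnitaryFrame_of_finrank_eq (S := S) hE hu
    have key : ∀ a b c d f : TangentSpace I x,
        mvfderiv I (S.conjTorsionDeriv x b c d f) x a - mvfderiv I (S.conjTorsionDeriv x c b d f) x a
        + mvfderiv I (S.conjTorsionDeriv x d b c f) x a
        - mvfderiv I (S.conjTorsionDeriv x f b c d) x a =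
        4 * (mvfderiv I N x a * S.kahlerSq x b c d f + N x *
          (S.kahlerDeriv x a b c * S.kahlerTensor x d f
            + S.kahlerTensor x b c * S.kahlerDeriv x a d f
          - (S.kahlerDeriv x a b d * S.kahlerTensor x c f
            + S.kahlerTensor x b d * S.kahlerDeriv x a c f)
          + (S.kahlerDeriv x a b f * S.kahlerTensor x c d
            + S.kahlerTensor x b f * S.kahlerDeriv x a c d))) := by
      intro a b c d f
      have hK := mdifferentiableAt_conjTorsionDeriv (S := S) x
      have hNQ := mdifferentiableAt_fun_mul (hN.mdifferentiableAt hS hE x)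
        (mdifferentiableAt_kahlerSq_extend (S := S) x b c d f)
      have h := congrFun (mvfderiv_congr_of_eventuallyEq (I := I)
        (hN.eventually_eq hS x b c d f)) a
      rw [mvfderiv_sub_apply (mdifferentiableAt_fun_add (mdifferentiableAt_fun_sub (hK _ _ _ _)
          (hK _ _ _ _)) (hK _ _ _ _)) (hK _ _ _ _), mvfderiv_add_apply
          (mdifferentiableAt_fun_sub (hK _ _ _ _) (hK _ _ _ _)) (hK _ _ _ _),
        mvfderiv_sub_apply (hK _ _ _ _) (hK _ _ _ _),
        mvfderiv_mul_apply mdifferentiableAt_const hNQ,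
        mvfderiv_mul_apply (hN.mdifferentiableAt hS hE x)
          (mdifferentiableAt_kahlerSq_extend x b c d f), mvfderiv_kahlerSq_extend,
        mvfderiv_const] at h
      simpa only [FiberBundle.extend_apply_self, zero_apply, zero_mul, zero_add] using h
    have hB := hS.isNearlyKahlerTensor x
    have hJ := S.isOrthogonalComplexStructure x
    have hA : ∀ i, S.torsionForm x (e 0) (e i) (S.J x (e i)) = 0 := fun i ↦
      hB.inner_map_right hJ _ _
    have k1 := key (e 0) (e 1) (S.J x (e 1)) (e 2) (S.J x (e 2))
    have k2 := key (e 1) (e 0) (S.J x (e 1)) (e 2) (S.J x (e 2))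
    have k3 := key (S.J x (e 1)) (e 0) (e 1) (e 2) (S.J x (e 2))
    have k4 := key (e 2) (e 0) (e 1) (S.J x (e 1)) (S.J x (e 2))
    have k5 := key (S.J x (e 2)) (e 0) (e 1) (S.J x (e 1)) (e 2)
    have hc := mvfderiv_conjTorsionDeriv_comm (S := S) x
    have c1 := kahlerDeriv_cyclic hS x (e 0) (e 1) (S.J x (e 1))
    have c2 := kahlerDeriv_cyclic hS x (e 0) (e 2) (S.J x (e 2))
    rw [hA, kahlerDeriv_swap x (e 1)] at c1
    rw [hA, kahlerDeriv_swap x (e 2)] at c2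
    simp [kahlerSq, kahlerTensor_frame he] at k1 k2 k3 k4 k5
    have hsum : mvfderiv I N x (e 0) + N x * (-(S.kahlerDeriv x (e 0) (e 1) (S.J x (e 1))
        - S.kahlerDeriv x (e 1) (e 0) (S.J x (e 1)) + S.kahlerDeriv x (S.J x (e 1)) (e 0) (e 1))
        - (S.kahlerDeriv x (e 0) (e 2) (S.J x (e 2))
        - S.kahlerDeriv x (e 2) (e 0) (S.J x (e 2))
        + S.kahlerDeriv x (S.J x (e 2)) (e 0) (e 2))) = 0 := by
      rw [hc (e 0) (e 1), hc (e 0) (S.J x (e 1)), hc (e 0) (e 2), hc (e 0) (S.J x (e 2))] at k1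
      rw [hc (e 1) (S.J x (e 1)), hc (e 1) (e 2), hc (e 1) (S.J x (e 2))] at k2
      rw [hc (S.J x (e 1)) (e 2), hc (S.J x (e 1)) (S.J x (e 2))] at k3
      rw [hc (e 2) (S.J x (e 2))] at k4
      linarith
    have hz : S.kahlerDeriv x (e 0) (e 1) (S.J x (e 1))
        - S.kahlerDeriv x (e 1) (e 0) (S.J x (e 1)) + S.kahlerDeriv x (S.J x (e 1)) (e 0) (e 1)
        = 0 := by linarith
    have hz' : S.kahlerDeriv x (e 0) (e 2) (S.J x (e 2))
        - S.kahlerDeriv x (e 2) (e 0) (S.J x (e 2)) + S.kahlerDeriv x (S.J x (e 2)) (e 0) (e 2)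
        = 0 := by linarith
    rw [hz, hz'] at hsum
    linarith
  by_cases hu : u = 0
  · rw [hu, map_zero]
  · have h := hunit ((‖u‖⁻¹ : ℝ) • u) (by
      rw [norm_smul, norm_inv, norm_norm, inv_mul_cancel₀ (norm_ne_zero_iff.2 hu)])
    rw [map_smul, smul_eq_zero] at h
    exact h.resolve_left (inv_ne_zero (norm_ne_zero_iff.2 hu))

/-- A nearly Kähler structure in dimension six has constant type. -/
lemma IsNearlyKahler.exists_const_type [PreconnectedSpace M] [Nonempty M] (hS : S.IsNearlyKahler)
    (hE : finrank ℝ E = 6) : ∃ N : ℝ, 0 ≤ N ∧ S.HasTypeFunction fun _ ↦ N := by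
  obtain ⟨N, hN0, hN⟩ := hS.exists_hasTypeFunction hE
  obtain ⟨x₀⟩ := ‹Nonempty M›
  refine ⟨N x₀, hN0 x₀, fun x ↦ ?_⟩
  rw [eq_of_mvfderiv_eq_zero (hN.mdifferentiableAt hS hE) (hN.mvfderiv_eq_zero hS hE) x₀ x]
  exact hN x

end AlmostHermitianStructure

end NearlyKahler

end
noncomputable section

namespace NearlyKahler

section TrilinearForms

variable {V : Type*} [NormedAddCommGroup V] [InnerProductSpace ℝ V] [FiniteDimensional ℝ V]
  {J : V →ₗ[ℝ] V} {B : V →ₗ[ℝ] V →ₗ[ℝ] V}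

local notation "⟪" x ", " y "⟫" => inner ℝ x y

/-- In dimension six, a three-form of the same type as that of `B ≠ 0` that vanishes against both
`B` and `JB` is zero. -/
lemma IsNearlyKahlerTensor.form_eq_zero (hB : IsNearlyKahlerTensor J B)
    (hJ : IsOrthogonalComplexStructure J) (hV : finrank ℝ V = 6) {C : V → V → V → ℝ}
    (hl : ∀ u v, IsLinearMap ℝ (C u v)) (h12 : ∀ u v w, C u v w = -C v u w)
    (h23 : ∀ u v w, C u v w = -C u w v) (hJC : ∀ u v w, C (J u) v w = C u (J v) w) (h0 : B ≠ 0)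
    (h1 : ∀ u v, C u v (B u v) = 0) (h2 : ∀ u v, C u v (J (B u v)) = 0) (u v w : V) :
    C u v w = 0 := by
  set f : V → V → V := fun u v ↦
    (InnerProductSpace.toDual ℝ V).symm (LinearMap.toContinuousLinearMap ((hl u v).mk' _)) with hf
  have hfC : ∀ u v w, ⟪f u v, w⟫ = C u v w := fun u v w ↦ by
    rw [hf, InnerProductSpace.toDual_symm_apply]
    rfl
  have hadd : ∀ u v v' w, C u (v + v') w = C u v w + C u v' w := fun u v v' w ↦ by
    rw [h23, (hl u w).map_add, h23 u v, h23 u v']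
    ring
  have hsmul : ∀ (r : ℝ) u v w, C u (r • v) w = r * C u v w := fun r u v w ↦ by
    rw [h23, (hl u w).map_smul, h23 u v, smul_eq_mul]
    ring
  set B' : V →ₗ[ℝ] V →ₗ[ℝ] V := LinearMap.mk₂ ℝ f
    (fun u u' v ↦ ext_inner_right ℝ fun w ↦ by
      rw [inner_add_left, hfC, hfC, hfC, h12, hadd, h12 u, h12 u']
      ring)
    (fun r u v ↦ ext_inner_right ℝ fun w ↦ by
      rw [real_inner_smul_left, hfC, hfC, h12, hsmul, h12 u]
      ring)
    (fun u v v' ↦ ext_inner_right ℝ fun w ↦ by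
      rw [inner_add_left, hfC, hfC, hfC, hadd])
    (fun r u v ↦ ext_inner_right ℝ fun w ↦ by
      rw [real_inner_smul_left, hfC, hfC, hsmul]) with hB'
  have hBC : ∀ u v w, ⟪B' u v, w⟫ = C u v w := hfC
  have hJ23 : ∀ u v w, C u (J v) w = C u v (J w) := fun u v w ↦ by
    rw [h23 u v (J w), ← hJC u w v, h23 (J u) w v, neg_neg, hJC]
  have htype : IsNearlyKahlerTensor J B' :=
    { swap := fun u v ↦ ext_inner_right ℝ fun w ↦ by rw [inner_neg_left, hBC, hBC, h12]
      skew := fun u v w ↦ by rw [hBC, hBC, h23]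
      map_right := fun u v ↦ ext_inner_right ℝ fun w ↦ by
        rw [inner_neg_left, hJ.inner_left, neg_neg, hBC, hBC, hJ23] }
  have hz := hB.eq_zero_of_inner_eq_zero hJ hV htype h0 (fun u v ↦ by rw [hBC, h1])
    (fun u v ↦ by rw [hBC, h2])
  rw [← hBC, hz]
  simp

end TrilinearForms

namespace AlmostHermitianStructure

variable {E : Type*} [NormedAddCommGroup E] [NormedSpace ℝ E] [FiniteDimensional ℝ E]
  [CompleteSpace E]
  {H : Type*} [TopologicalSpace H] {I : ModelWithCorners ℝ E H} [I.Boundaryless]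
  {M : Type*} [TopologicalSpace M] [ChartedSpace H M] [IsManifold I ∞ M]
  [RiemannianBundle (fun x : M ↦ TangentSpace I x)]
  [IsContMDiffRiemannianBundle I ∞ E (fun x : M ↦ TangentSpace I x)]
  {S : AlmostHermitianStructure I M}

lemma isKahler_of_nablaJ_eq_zero (h : ∀ x, S.nablaJ x = 0) : S.IsKahler := by
  intro x Y hY
  ext u
  rw [← S.nablaJ_apply hY, h]
  simp

lemma HasTypeFunction.nablaJ_ne_zero {N : ℝ} (hK : ¬ S.IsKahler)
    (hN : S.HasTypeFunction fun _ ↦ N) : N ≠ 0 := by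
  rintro rfl
  refine hK (isKahler_of_nablaJ_eq_zero fun x ↦ ?_)
  ext a b : 2
  have := hN x a b a b
  rw [zero_mul, inner_self_eq_zero] at this
  simpa using this

lemma mvfderiv_kahlerTensor_canonicalConnection (hS : S.IsNearlyKahler) {x : M}
    {Y Z : Π x : M, TangentSpace I x} (hY : MDiffAt (T% Y) x) (hZ : MDiffAt (T% Z) x)
    (u : TangentSpace I x) :
    mvfderiv I (fun y ↦ S.kahlerTensor y (Y y) (Z y)) x u =
      S.kahlerTensor x (S.canonicalConnection Y x u) (Z x)
        + S.kahlerTensor x (Y x) (S.canonicalConnection Z x u) := by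
  have h := hS.isMetricConnection x Y (S.mapField Z) hY (S.mdifferentiableAt_mapField hZ) u
  rw [canonicalConnection_mapField hZ] at h
  exact h

/-- The key identity for a nearly Kähler structure of constant type. -/
lemma HasTypeFunction.nablaTorsion_apply_self (hS : S.IsNearlyKahler) {N : ℝ}
    (hN : S.HasTypeFunction fun _ ↦ N) (x : M) (a b c : TangentSpace I x) :
    S.nablaTorsion x a b c (S.nablaJ x b c) = 0 := by
  set v := S.nablaJ x b c with hv
  by_cases h0 : v = 0
  · rw [h0, ((hasCovDerivAt_torsionForm (S := S) x).isLinearMap a b c).map_zero]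
  set Y := FiberBundle.extend E b
  set Z := FiberBundle.extend E c
  set V := FiberBundle.extend E v
  have hY : MDiffAt (T% Y) x := FiberBundle.mdifferentiableAt_extend I E b
  have hZ : MDiffAt (T% Z) x := FiberBundle.mdifferentiableAt_extend I E c
  have hV : MDiffAt (T% V) x := FiberBundle.mdifferentiableAt_extend I E v
  have eY : Y x = b := FiberBundle.extend_apply_self ..
  have eZ : Z x = c := FiberBundle.extend_apply_self ..
  have eV : V x = v := FiberBundle.extend_apply_self ..
  have hm := hS.isMetricConnection
  have hself : ∀ y (a b : TangentSpace I y), inner ℝ (S.nablaJ y a b) (S.nablaJ y a b) =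
      N * (inner ℝ a a * inner ℝ b b - inner ℝ a b * inner ℝ a b
        - S.kahlerTensor y a b * S.kahlerTensor y a b) := fun y a b ↦ by
    have ha := kahlerTensor_swap (S := S) y a a
    have hb := kahlerTensor_swap (S := S) y b a
    rw [hN, hb, real_inner_comm a b, show S.kahlerTensor y a a = 0 by linarith]
    ring
  set q : M → ℝ := fun y ↦ inner ℝ (Y y) (Y y) * inner ℝ (Z y) (Z y)
    - inner ℝ (Y y) (Z y) * inner ℝ (Y y) (Z y)
    - S.kahlerTensor y (Y y) (Z y) * S.kahlerTensor y (Y y) (Z y) with hq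
  have iYY := mdifferentiableAt_inner hY hY
  have iZZ := mdifferentiableAt_inner hZ hZ
  have iYZ := mdifferentiableAt_inner hY hZ
  have iVV := mdifferentiableAt_inner hV hV
  have iO := (mvfderiv_kahlerTensor (S := S) hY hZ).1
  have hA := (hasCovDerivAt_torsionForm (S := S) x).apply hY hZ hV
  have dq1 := mdifferentiableAt_fun_sub (mdifferentiableAt_fun_mul iYY iZZ)
    (mdifferentiableAt_fun_mul iYZ iYZ)
  have dq : MDifferentiableAt I 𝓘(ℝ, ℝ) q x :=
    mdifferentiableAt_fun_sub dq1 (mdifferentiableAt_fun_mul iO iO)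
  have hc : MDifferentiableAt I 𝓘(ℝ, ℝ) (fun _ : M ↦ N) x := mdifferentiableAt_const
  have dNq := mdifferentiableAt_fun_mul hc dq
  have dh1 := mdifferentiableAt_fun_mul dNq iVV
  have dh2 := mdifferentiableAt_fun_mul hA.1 hA.1
  have hmin := mvfderiv_eq_zero_of_isLocalMin (mdifferentiableAt_fun_sub dh1 dh2)
    (.of_forall fun y ↦ by
      have h1 : N * q x * inner ℝ (V x) (V x)
          - S.torsionForm x (Y x) (Z x) (V x) * S.torsionForm x (Y x) (Z x) (V x) = 0 := by
        simp only [hq]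
        rw [← hself, eY, eZ, eV, ← hv, torsionForm_apply, ← hv]
        ring
      rw [h1]
      simp only [hq]
      rw [← hself, torsionForm_apply, sub_nonneg]
      exact real_inner_mul_inner_self_le _ _) a
  rw [mvfderiv_sub_apply dh1 dh2, mvfderiv_mul_apply dNq iVV, mvfderiv_mul_apply hA.1 hA.1,
    mvfderiv_mul_apply hc dq, mvfderiv_sub_apply dq1 (mdifferentiableAt_fun_mul iO iO),
    mvfderiv_sub_apply (mdifferentiableAt_fun_mul iYY iZZ) (mdifferentiableAt_fun_mul iYZ iYZ),
    mvfderiv_mul_apply iYY iZZ, mvfderiv_mul_apply iYZ iYZ, mvfderiv_mul_apply iO iO, hA.2,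
    hm x Y Y hY hY, hm x Z Z hZ hZ, hm x Y Z hY hZ, hm x V V hV hV,
    mvfderiv_kahlerTensor_canonicalConnection hS hY hZ, mvfderiv_const] at hmin
  simp only [hq, eY, eZ, eV, zero_apply] at hmin
  set y' := S.canonicalConnection Y x a
  set z' := S.canonicalConnection Z x a
  set v' := S.canonicalConnection V x a
  have hm0 := hself x b c
  have e1 : S.torsionForm x b c v = inner ℝ v v := by rw [torsionForm_apply, ← hv]
  have e2 : S.torsionForm x b c v' = inner ℝ v v' := by rw [torsionForm_apply, ← hv]
  have e3 : S.torsionForm x y' c v = _ := hN x y' c b c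
  have e4 : S.torsionForm x b z' v = _ := hN x b z' b c
  have s1 := kahlerTensor_swap (S := S) x c b
  have s2 : S.kahlerTensor x c c = 0 := by linarith [kahlerTensor_swap (S := S) x c c]
  have s3 : S.kahlerTensor x b b = 0 := by linarith [kahlerTensor_swap (S := S) x b b]
  have s4 := kahlerTensor_swap (S := S) x z' b
  rw [← hv] at hm0
  rw [e1, e2, e3, e4, s1, s2, s3, s4, real_inner_comm z' c,
    real_inner_comm y' b, real_inner_comm z' b, real_inner_comm b c, real_inner_comm v' v] at hmin
  have hfin : inner ℝ v v * S.nablaTorsion x a b c v = 0 := by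
    linear_combination (-1 / 2 : ℝ) * hmin - inner ℝ v' v * hm0
  exact (mul_eq_zero.1 hfin).resolve_left fun h ↦ h0 (inner_self_eq_zero.1 h)

end AlmostHermitianStructure

end NearlyKahler

end
noncomputable section

namespace NearlyKahler

namespace AlmostHermitianStructure

variable {E : Type*} [NormedAddCommGroup E] [NormedSpace ℝ E] [FiniteDimensional ℝ E]
  [CompleteSpace E]
  {H : Type*} [TopologicalSpace H] {I : ModelWithCorners ℝ E H} [I.Boundaryless]
  {M : Type*} [TopologicalSpace M] [ChartedSpace H M] [IsManifold I ∞ M]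
  [RiemannianBundle (fun x : M ↦ TangentSpace I x)]
  [IsContMDiffRiemannianBundle I ∞ E (fun x : M ↦ TangentSpace I x)]
  {S : AlmostHermitianStructure I M}

lemma nablaTorsion_map_right (hS : S.IsNearlyKahler) (x : M) (a b c d : TangentSpace I x) :
    S.nablaTorsion x a b c (S.J x d) = S.nablaTorsion x (S.J x a) b c d := by
  rw [nablaTorsion_swap_right, nablaTorsion_swap_left hS, neg_neg, nablaTorsion_map_left hS,
    nablaTorsion_swap_left hS, nablaTorsion_map hS, nablaTorsion_swap_right,
    nablaTorsion_map_left hS, nablaTorsion_swap_left hS, neg_neg]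

/-- The torsion of a strictly nearly Kähler structure in dimension six is parallel. -/
lemma HasTypeFunction.nablaTorsion_eq_zero (hS : S.IsNearlyKahler) (hE : finrank ℝ E = 6) {N : ℝ}
    (hN : S.HasTypeFunction fun _ ↦ N) (hN0 : N ≠ 0) (x : M) (a b c d : TangentSpace I x) :
    S.nablaTorsion x a b c d = 0 := by
  refine (hS.isNearlyKahlerTensor x).form_eq_zero (S.isOrthogonalComplexStructure x) hE
    (fun b c ↦ (hasCovDerivAt_torsionForm (S := S) x).isLinearMap a b c)
    (nablaTorsion_swap_left hS x a) (nablaTorsion_swap_right x a) (nablaTorsion_map_left hS x a) ?_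
    (hN.nablaTorsion_apply_self hS x a) (fun u v ↦ ?_) b c d
  · intro h
    obtain ⟨e, he⟩ := exists_isUnitaryFrame (S := S) hE x
    have h1 := hN x (e 0) (e 1) (e 0) (e 1)
    rw [h] at h1
    simp only [LinearMap.zero_apply, inner_zero_left, he.inner_eq,
      (kahlerTensor_frame he _ _).1] at h1
    simp at h1
    exact hN0 h1.symm
  · exact (nablaTorsion_map_right hS x a u v _).trans (hN.nablaTorsion_apply_self hS x _ u v)

lemma HasTypeFunction.hasCovDerivAt_torsionForm (hS : S.IsNearlyKahler) (hE : finrank ℝ E = 6)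
    {N : ℝ} (hN : S.HasTypeFunction fun _ ↦ N) (hN0 : N ≠ 0) (x : M) :
    HasCovDerivAt₃ S.canonicalConnection S.torsionForm x (fun _ _ _ _ ↦ 0) := by
  have h := AlmostHermitianStructure.hasCovDerivAt_torsionForm (S := S) x
  rwa [show S.nablaTorsion x = fun _ _ _ _ ↦ 0 from funext fun a ↦ funext fun b ↦ funext fun c ↦
    funext fun d ↦ hN.nablaTorsion_eq_zero hS hE hN0 x a b c d] at h

lemma mvfderiv_smul_add_smul {f g : M → ℝ} {x : M} (hf : MDifferentiableAt I 𝓘(ℝ, ℝ) f x)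
    (hg : MDifferentiableAt I 𝓘(ℝ, ℝ) g x) (z w : ℂ) (u : TangentSpace I x) :
    mvfderiv I (fun y ↦ f y • z + g y • w) x u =
      (mvfderiv I f x u) • z + (mvfderiv I g x u) • w := by
  have hz : MDifferentiableAt I 𝓘(ℝ, ℂ) (fun _ : M ↦ z) x := mdifferentiableAt_const
  have hw : MDifferentiableAt I 𝓘(ℝ, ℂ) (fun _ : M ↦ w) x := mdifferentiableAt_const
  have h1 : MDifferentiableAt I 𝓘(ℝ, ℂ) (fun y ↦ f y • z) x := hf.smul hz
  have h2 : MDifferentiableAt I 𝓘(ℝ, ℂ) (fun y ↦ g y • w) x := hg.smul hw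
  rw [mvfderiv_fun_add h1 h2, mvfderiv_fun_smul hf hz, mvfderiv_fun_smul hg hw, mvfderiv_const,
    mvfderiv_const]
  simp

/-- The complex `(3,0)`-form of a nearly Kähler structure, normalised by the constant `N`. -/
def volumeForm (hS : S.IsNearlyKahler) (N : ℝ) (x : M) : TangentSpace I x [⋀^Fin 3]→ₗ[ℝ] ℂ :=
  (√N)⁻¹ • (hS.isNearlyKahlerTensor x).complexForm (S.isOrthogonalComplexStructure x)

lemma volumeForm_apply (hS : S.IsNearlyKahler) (N : ℝ) (x : M) (v : Fin 3 → TangentSpace I x) :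
    volumeForm hS N x v = S.torsionForm x (v 0) (v 1) (S.J x (v 2)) • (((√N)⁻¹ : ℝ) : ℂ)
      + S.torsionForm x (v 0) (v 1) (v 2) • ((((√N)⁻¹ : ℝ) : ℂ) * Complex.I) := by
  rw [volumeForm, AlternatingMap.smul_apply, IsNearlyKahlerTensor.complexForm_apply]
  simp only [torsionForm_apply, Complex.real_smul, ContinuousLinearMap.coe_coe]
  ring

lemma norm_volumeForm_sq (hS : S.IsNearlyKahler) {N : ℝ} (hN0 : 0 < N) (x : M)
    (v : Fin 3 → TangentSpace I x) : ‖volumeForm hS N x v‖ ^ 2 = N⁻¹ *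
      ‖(hS.isNearlyKahlerTensor x).complexForm (S.isOrthogonalComplexStructure x) v‖ ^ 2 := by
  rw [volumeForm, AlternatingMap.smul_apply, norm_smul, mul_pow, norm_inv, Real.norm_eq_abs,
    abs_of_nonneg (Real.sqrt_nonneg N), inv_pow, Real.sq_sqrt hN0.le]

lemma HasTypeFunction.norm_volumeForm_eq_one (hS : S.IsNearlyKahler) (hE : finrank ℝ E = 6) {N : ℝ}
    (hN : S.HasTypeFunction fun _ ↦ N) (hN0 : 0 < N) {x : M} {e : Fin 3 → TangentSpace I x}
    (he : Orthonormal ℝ (Sum.elim e fun i ↦ S.J x (e i))) : ‖volumeForm hS N x e‖ = 1 := by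
  have h := norm_volumeForm_sq hS hN0 x e
  rw [(hS.isNearlyKahlerTensor x).norm_complexForm_sq_eq (S.isOrthogonalComplexStructure x) hE
    (hN x) he, inv_mul_cancel₀ hN0.ne'] at h
  exact (pow_eq_one_iff_of_nonneg (norm_nonneg _) two_ne_zero).1 h

lemma HasTypeFunction.isGeneralizedCalibration (hS : S.IsNearlyKahler) {N : ℝ}
    (hN : S.HasTypeFunction fun _ ↦ N) (hN0 : 0 < N) :
    IsGeneralizedCalibration (reForm (volumeForm hS N)) := by
  intro x e he
  have h := norm_volumeForm_sq hS hN0 x e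
  have h2 := (hS.isNearlyKahlerTensor x).norm_complexForm_sq_le (S.isOrthogonalComplexStructure x)
    hN0.le (hN x) he
  have h3 : ‖volumeForm hS N x e‖ ^ 2 ≤ 1 := by
    rw [h, inv_mul_le_one₀ hN0]
    exact h2
  exact (Complex.re_le_norm _).trans ((sq_le_one_iff₀ (norm_nonneg _)).1 h3)

lemma HasTypeFunction.isParallelVolumeForm (hS : S.IsNearlyKahler) (hE : finrank ℝ E = 6) {N : ℝ}
    (hN : S.HasTypeFunction fun _ ↦ N) (hN0 : 0 < N) :
    S.IsParallelVolumeForm S.canonicalConnection (volumeForm hS N) where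
  isMetricConnection := hS.isMetricConnection
  isParallelJ := S.isParallelJ_canonicalConnection
  contMDiff x X hX := by
    simp only [volumeForm_apply]
    exact ((contMDiffAt_torsionForm (hX 0) (hX 1) (contMDiffAt_mapField (hX 2))).smul
      contMDiffAt_const).add ((contMDiffAt_torsionForm (hX 0) (hX 1) (hX 2)).smul contMDiffAt_const)
  parallel x X hX u := by
    have h := hN.hasCovDerivAt_torsionForm hS hE hN0.ne' x
    have h1 := h.apply (hX 0) (hX 1) (hX 2)
    have h2 := h.apply (hX 0) (hX 1) (S.mdifferentiableAt_mapField (hX 2))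
    simp only [volumeForm_apply]
    refine (mvfderiv_smul_add_smul h2.1 h1.1 _ _ u).trans ?_
    rw [h1.2, h2.2, canonicalConnection_mapField (hX 2), Fin.sum_univ_three]
    simp [mapField, Function.update]
    ring
  type_n_zero x v i := by
    have h := (hS.isNearlyKahlerTensor x).complexForm_update (S.isOrthogonalComplexStructure x) v i
    simp only [volumeForm, AlternatingMap.smul_apply]
    simp only [ContinuousLinearMap.coe_coe] at h
    rw [h, Complex.real_smul, Complex.real_smul]
    ring
  norm_eq_one x e he := hN.norm_volumeForm_eq_one hS hE hN0 he

end AlmostHermitianStructure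

end NearlyKahler

end
noncomputable section

namespace NearlyKahler

section Immersions

variable {E : Type*} [NormedAddCommGroup E] [NormedSpace ℝ E] [FiniteDimensional ℝ E]
  [CompleteSpace E]
  {H : Type*} [TopologicalSpace H] {I : ModelWithCorners ℝ E H} [I.Boundaryless]
  {M : Type*} [TopologicalSpace M] [ChartedSpace H M] [IsManifold I ∞ M]
  {E' : Type*} [NormedAddCommGroup E'] [NormedSpace ℝ E']
  {H' : Type*} [TopologicalSpace H'] {I' : ModelWithCorners ℝ E' H'} [I'.Boundaryless]
  {L : Type*} [TopologicalSpace L] [ChartedSpace H' L] [IsManifold I' ∞ L]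

variable (I I') in
/-- The image under `df` of the coordinate vector field at `p` that extends `v`. -/
def pushExtend (f : L → M) {p : L} (v : TangentSpace I' p) (q : L) : TangentSpace I (f q) :=
  mfderiv I' I f q (FiberBundle.extend E' v q)

@[simp]
lemma pushExtend_self (f : L → M) {p : L} (v : TangentSpace I' p) :
    pushExtend I I' f v p = mfderiv I' I f p v := by
  rw [pushExtend, FiberBundle.extend_apply_self]

variable {f : L → M} (hf : ContMDiff I' I ∞ f)
include hf

lemma pushExtend_coord_eventuallyEq {p : L} (v : TangentSpace I' p) :
    (fun q ↦ (trivializationAt E (fun x : M ↦ TangentSpace I x) (f p)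
      ⟨f q, pushExtend I I' f v q⟩).2) =ᶠ[𝓝 p] fun q ↦
    mvfderiv I' (fun q ↦ extChartAt I (f p) (f q)) q (FiberBundle.extend E' v q) := by
  filter_upwards [hf.continuous.continuousAt.preimage_mem_nhds
    ((chartAt H (f p)).open_source.mem_nhds (mem_chart_source H (f p)))] with q hq
  rw [trivializationAt_snd_eq_mvfderiv hq, mvfderiv_comp_apply (mdifferentiableAt_extChartAt hq)
    (hf.mdifferentiableAt (by simp))]
  rfl

lemma contMDiffAt_extChartAt_comp (p : L) :
    ContMDiffAt I' 𝓘(ℝ, E) 2 (fun q ↦ extChartAt I (f p) (f q)) p :=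
  ((contMDiffAt_extChartAt (I := I) (n := ∞)).comp p hf.contMDiffAt).of_le (by norm_cast)

lemma differentiableAlongAt_pushExtend {p : L} (v : TangentSpace I' p) :
    DifferentiableAlongAt I I' f (pushExtend I I' f v) p :=
  (mdifferentiableAt_mvfderiv_extend (contMDiffAt_extChartAt_comp hf p) v).congr_of_eventuallyEq
    (pushExtend_coord_eventuallyEq hf v)

variable [RiemannianBundle (fun x : M ↦ TangentSpace I x)]
  [IsContMDiffRiemannianBundle I ∞ E (fun x : M ↦ TangentSpace I x)]

lemma covDerivAlong_pushExtend_comm {p : L} (v w : TangentSpace I' p) :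
    covDerivAlong (leviCivita I M) f (pushExtend I I' f v) p w =
      covDerivAlong (leviCivita I M) f (pushExtend I I' f w) p v := by
  rw [covDerivAlong, covDerivAlong,
    mvfderiv_congr_of_eventuallyEq (pushExtend_coord_eventuallyEq hf v),
    mvfderiv_congr_of_eventuallyEq (pushExtend_coord_eventuallyEq hf w),
    mvfderiv_mvfderiv_extend_comm (contMDiffAt_extChartAt_comp hf p)]
  have h := (CovariantDerivative.torsion_eq_zero_iff _).1 (leviCivita_torsion (I := I) (M := M))
    (FiberBundle.mdifferentiableAt_extend I E (pushExtend I I' f w p))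
    (FiberBundle.mdifferentiableAt_extend I E (pushExtend I I' f v p))
  rw [(eventually_mlieBracket_extend_eq_zero _ _).self_of_nhds, sub_eq_zero] at h
  simp only [FiberBundle.extend_apply_self, pushExtend_self] at h ⊢
  rw [h]

end Immersions

section Algebra

variable {V : Type*} [NormedAddCommGroup V] [InnerProductSpace ℝ V] [FiniteDimensional ℝ V]
  {J : V →ₗ[ℝ] V} {B : V →ₗ[ℝ] V →ₗ[ℝ] V}

lemma IsNearlyKahlerTensor.inner_apply_of_eq_zero (hB : IsNearlyKahlerTensor J B)
    (hJ : IsOrthogonalComplexStructure J) (hV : finrank ℝ V = 6) {e : Fin 3 → V}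
    (he : IsUnitaryFrame J e) (h : inner ℝ (B (e 0) (e 1)) (e 2) = 0) (w : V) :
    inner ℝ (B w (e 1)) (e 2) = inner ℝ (J (e 0)) w * inner ℝ (B (e 0) (e 1)) (J (e 2)) ∧
    inner ℝ (B (e 0) w) (e 2) = inner ℝ (J (e 1)) w * inner ℝ (B (e 0) (e 1)) (J (e 2)) ∧
    inner ℝ (B (e 0) (e 1)) w = inner ℝ (J (e 2)) w * inner ℝ (B (e 0) (e 1)) (J (e 2)) := by
  have h1 : inner ℝ (B (e 2) (e 1)) (e 2) = 0 := hB.inner_left _ _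
  have h2 : inner ℝ (B (e 0) (e 2)) (e 2) = 0 := hB.inner_right _ _
  refine ⟨?_, ?_, ?_⟩
  all_goals
    conv_lhs => rw [he.eq_ofCoords hV w]
    simp [ofCoords, hB.map_left, hB.map_right, hB.self, inner_add_left, inner_add_right,
      real_inner_smul_left, real_inner_smul_right, hJ.inner_left, h, hB.inner_left, hB.inner_right,
      hB.inner_map_left hJ, hB.inner_map_right hJ]

end Algebra

namespace AlmostHermitianStructure

variable {E : Type*} [NormedAddCommGroup E] [NormedSpace ℝ E] [FiniteDimensional ℝ E]
  [CompleteSpace E]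
  {H : Type*} [TopologicalSpace H] {I : ModelWithCorners ℝ E H}
  {M : Type*} [TopologicalSpace M] [ChartedSpace H M] [IsManifold I ∞ M]
  [RiemannianBundle (fun x : M ↦ TangentSpace I x)]
  [IsContMDiffRiemannianBundle I ∞ E (fun x : M ↦ TangentSpace I x)]
  {E' : Type*} [NormedAddCommGroup E'] [NormedSpace ℝ E']
  {H' : Type*} [TopologicalSpace H'] {I' : ModelWithCorners ℝ E' H'}
  {L : Type*} [TopologicalSpace L] [ChartedSpace H' L] [IsManifold I' ∞ L]
  {S : AlmostHermitianStructure I M}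

lemma covDerivAlong_canonicalConnection (f : L → M) (W : Π q : L, TangentSpace I (f q)) (p : L)
    (u : TangentSpace I' p) : covDerivAlong S.canonicalConnection f W p u =
      covDerivAlong (leviCivita I M) f W p u
        - (1 / 2 : ℝ) • S.J (f p) (S.nablaJ (f p) (mfderiv I' I f p u) (W p)) := by
  rw [covDerivAlong, S.canonicalConnection_apply (FiberBundle.mdifferentiableAt_extend I E (W p)),
    FiberBundle.extend_apply_self, covDerivAlong]
  module

end AlmostHermitianStructure

namespace IsLagrangianImmersion

variable {E : Type*} [NormedAddCommGroup E] [NormedSpace ℝ E] [FiniteDimensional ℝ E]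
  [CompleteSpace E]
  {H : Type*} [TopologicalSpace H] {I : ModelWithCorners ℝ E H} [I.Boundaryless]
  {M : Type*} [TopologicalSpace M] [ChartedSpace H M] [IsManifold I ∞ M]
  [RiemannianBundle (fun x : M ↦ TangentSpace I x)]
  [IsContMDiffRiemannianBundle I ∞ E (fun x : M ↦ TangentSpace I x)]
  {E' : Type*} [NormedAddCommGroup E'] [NormedSpace ℝ E']
  {H' : Type*} [TopologicalSpace H'] {I' : ModelWithCorners ℝ E' H'} [I'.Boundaryless]
  {L : Type*} [TopologicalSpace L] [ChartedSpace H' L] [IsManifold I' ∞ L]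
  {S : AlmostHermitianStructure I M} {f : L → M}

lemma isUnitaryFrame (hf : IsLagrangianImmersion (I' := I') S f) {p : L}
    {b : Fin 3 → TangentSpace I' p} (hb : Orthonormal ℝ fun i ↦ mfderiv I' I f p (b i)) :
    IsUnitaryFrame (S.J (f p)).toLinearMap fun i ↦ mfderiv I' I f p (b i) :=
  (S.isOrthogonalComplexStructure (f p)).isUnitaryFrame hb fun i j ↦
    hf.pullback_eq_zero p (b i) (b j)

/-- The second fundamental form paired with the normal vectors `J df(c)`. -/
lemma torsionForm_eq (hf : IsLagrangianImmersion (I' := I') S f) (p : L)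
    (a b c : TangentSpace I' p) :
    S.torsionForm (f p) (mfderiv I' I f p a) (mfderiv I' I f p b) (mfderiv I' I f p c) =
      S.kahlerTensor (f p) (covDerivAlong (leviCivita I M) f (pushExtend I I' f b) p a)
        (mfderiv I' I f p c)
      - S.kahlerTensor (f p) (covDerivAlong (leviCivita I M) f (pushExtend I I' f c) p a)
        (mfderiv I' I f p b) := by
  have h := ((AlmostHermitianStructure.hasCovDerivAt_kahlerTensor (S := S) (f p)).along
    (hf.contMDiff.mdifferentiableAt (by simp))
    (differentiableAlongAt_pushExtend hf.contMDiff b)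
    (differentiableAlongAt_pushExtend hf.contMDiff c)).2 a
  have h0 : (fun q ↦ S.kahlerTensor (f q) (pushExtend I I' f b q) (pushExtend I I' f c q)) =
      fun _ ↦ 0 := funext fun q ↦ hf.pullback_eq_zero q _ _
  rw [h0, mvfderiv_const, zero_apply, AlmostHermitianStructure.torsionForm_swap_right,
    AlmostHermitianStructure.kahlerTensor_swap (f p) (pushExtend I I' f b p)] at h
  simp only [pushExtend_self] at h
  linarith

lemma torsionForm_eq_zero (hf : IsLagrangianImmersion (I' := I') S f) (hS : S.IsNearlyKahler)
    (p : L) (a b c : TangentSpace I' p) :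
    S.torsionForm (f p) (mfderiv I' I f p a) (mfderiv I' I f p b) (mfderiv I' I f p c) = 0 := by
  have h1 := hf.torsionForm_eq p a b c
  have h2 := hf.torsionForm_eq p b c a
  have h3 := hf.torsionForm_eq p c a b
  have s := AlmostHermitianStructure.torsionForm_swap_left hS (f p)
  have s' := AlmostHermitianStructure.torsionForm_swap_right (S := S) (f p)
  have hc : ∀ u v w, S.torsionForm (f p) u v w = S.torsionForm (f p) v w u := fun u v w ↦ by
    rw [s u v, s' v u, neg_neg]
  rw [← hc] at h2
  rw [hc] at h3
  rw [covDerivAlong_pushExtend_comm hf.contMDiff a b] at h2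
  rw [covDerivAlong_pushExtend_comm hf.contMDiff a c,
    covDerivAlong_pushExtend_comm hf.contMDiff b c] at h3
  linarith

lemma kahlerTensor_covDerivAlong_comm (hf : IsLagrangianImmersion (I' := I') S f)
    (hS : S.IsNearlyKahler) (p : L) (a b c : TangentSpace I' p) :
    S.kahlerTensor (f p) (covDerivAlong (leviCivita I M) f (pushExtend I I' f b) p a)
        (mfderiv I' I f p c) =
      S.kahlerTensor (f p) (covDerivAlong (leviCivita I M) f (pushExtend I I' f c) p a)
        (mfderiv I' I f p b) := by
  have := hf.torsionForm_eq p a b c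
  rw [hf.torsionForm_eq_zero hS] at this
  linarith

lemma torsionForm_map_ne_zero (hf : IsLagrangianImmersion (I' := I') S f) (hS : S.IsNearlyKahler)
    (hE : finrank ℝ E = 6) {N : ℝ} (hN : S.HasTypeFunction fun _ ↦ N) (hN0 : N ≠ 0) {p : L}
    {b : Fin 3 → TangentSpace I' p} (hb : Orthonormal ℝ fun i ↦ mfderiv I' I f p (b i)) :
    S.torsionForm (f p) (S.J (f p) (mfderiv I' I f p (b 0))) (mfderiv I' I f p (b 1))
      (mfderiv I' I f p (b 2)) ≠ 0 := by
  intro h0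
  have hB := hS.isNearlyKahlerTensor (f p)
  have hJ := S.isOrthogonalComplexStructure (f p)
  have h := hB.norm_complexForm_sq_eq hJ hE (hN (f p)) (hf.isUnitaryFrame hb)
  rw [hB.norm_complexForm_sq] at h
  have h1 := hf.torsionForm_eq_zero hS p (b 0) (b 1) (b 2)
  rw [AlmostHermitianStructure.torsionForm_map_left hS,
    ← AlmostHermitianStructure.torsionForm_map_right hS] at h0
  rw [AlmostHermitianStructure.torsionForm_apply] at h0 h1
  rw [ContinuousLinearMap.coe_coe, h0, h1] at h
  exact hN0 (by simpa using h.symm)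

/-- The trace of the second fundamental form vanishes when paired with `J df(d)`. -/
lemma sum_kahlerTensor_eq_zero (hf : IsLagrangianImmersion (I' := I') S f) (hS : S.IsNearlyKahler)
    (hE : finrank ℝ E = 6) {N : ℝ} (hN : S.HasTypeFunction fun _ ↦ N) (hN0 : N ≠ 0) {p : L}
    {b : Fin 3 → TangentSpace I' p} (hb : Orthonormal ℝ fun i ↦ mfderiv I' I f p (b i))
    (d : TangentSpace I' p) :
    ∑ i, S.kahlerTensor (f p) (covDerivAlong (leviCivita I M) f (pushExtend I I' f (b i)) p (b i))
      (mfderiv I' I f p d) = 0 := by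
  have h := ((hN.hasCovDerivAt_torsionForm hS hE hN0 (f p)).along
    (hf.contMDiff.mdifferentiableAt (by simp))
    (differentiableAlongAt_pushExtend hf.contMDiff (b 0))
    (differentiableAlongAt_pushExtend hf.contMDiff (b 1))
    (differentiableAlongAt_pushExtend hf.contMDiff (b 2))).2 d
  have h0 : (fun q ↦ S.torsionForm (f q) (pushExtend I I' f (b 0) q) (pushExtend I I' f (b 1) q)
      (pushExtend I I' f (b 2) q)) = fun _ ↦ 0 :=
    funext fun q ↦ hf.torsionForm_eq_zero hS q _ _ _
  rw [h0, mvfderiv_const, zero_apply] at h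
  simp only [pushExtend_self] at h
  have hu := hf.isUnitaryFrame hb
  have hB := hS.isNearlyKahlerTensor (f p)
  have hJ := S.isOrthogonalComplexStructure (f p)
  have hne := hf.torsionForm_map_ne_zero hS hE hN hN0 hb
  rw [AlmostHermitianStructure.torsionForm_map_left hS,
    ← AlmostHermitianStructure.torsionForm_map_right hS] at hne
  have hz := hf.torsionForm_eq_zero hS p (b 0) (b 1) (b 2)
  have hw := fun w ↦ hB.inner_apply_of_eq_zero hJ hE hu hz w
  simp only [ContinuousLinearMap.coe_coe, ← AlmostHermitianStructure.torsionForm_apply] at hw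
  rw [(hw (covDerivAlong S.canonicalConnection f (pushExtend I I' f (b 0)) p d)).1,
    (hw (covDerivAlong S.canonicalConnection f (pushExtend I I' f (b 1)) p d)).2.1,
    (hw (covDerivAlong S.canonicalConnection f (pushExtend I I' f (b 2)) p d)).2.2, zero_add, ← add_mul, ← add_mul] at h
  have hsum := (mul_eq_zero.1 h.symm).resolve_right hne
  have hpair : ∀ i, inner ℝ (S.J (f p) (mfderiv I' I f p (b i)))
      (covDerivAlong S.canonicalConnection f (pushExtend I I' f (b i)) p d) =
      S.kahlerTensor (f p) (covDerivAlong (leviCivita I M) f (pushExtend I I' f (b i)) p (b i))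
        (mfderiv I' I f p d) := by
    intro i
    rw [hf.kahlerTensor_covDerivAlong_comm hS, covDerivAlong_pushExtend_comm hf.contMDiff,
      AlmostHermitianStructure.covDerivAlong_canonicalConnection, inner_sub_right,
      real_inner_smul_right, S.inner_map, pushExtend_self,
      real_inner_comm _ (mfderiv I' I f p (b i)), hB.inner_right,
      AlmostHermitianStructure.kahlerTensor_apply, real_inner_comm]
    simp
  rw [hpair, hpair, hpair] at hsum
  rw [Fin.sum_univ_three, hsum]

/-- A three-dimensional Lagrangian immersion into a strictly nearly Kähler six-manifold is
minimal. -/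
lemma isMinimalImmersion (hf : IsLagrangianImmersion (I' := I') S f) (hS : S.IsNearlyKahler)
    (hE : finrank ℝ E = 6) {N : ℝ} (hN : S.HasTypeFunction fun _ ↦ N) (hN0 : N ≠ 0) :
    IsMinimalImmersion I I' f := by
  intro p k b hb
  have hk : k = 3 := by
    have h1 : finrank ℝ E' = k := by
      have := Module.finrank_eq_card_basis b
      rw [Fintype.card_fin] at this
      exact this
    have := hf.finrank_eq
    omega
  subst hk
  have hu := hf.isUnitaryFrame hb
  set w := ∑ i, covDerivAlong (leviCivita I M) f (pushExtend I I' f (b i)) p (b i) with hw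
  have h1 : ∀ i, inner ℝ (S.J (f p) (mfderiv I' I f p (b i))) w = 0 := by
    intro i
    rw [hw, inner_sum, ← hf.sum_kahlerTensor_eq_zero hS hE hN hN0 hb (b i)]
    exact Finset.sum_congr rfl fun j _ ↦ real_inner_comm _ _
  have h2 : w ∈ LinearMap.range (mfderiv I' I f p).toLinearMap := by
    rw [hu.eq_ofCoords (hE : finrank ℝ (TangentSpace I (f p)) = 6) w]
    simp only [ContinuousLinearMap.coe_coe, h1, ofCoords, zero_smul, add_zero]
    have hmem : ∀ (r : ℝ) (i : Fin 3), r • mfderiv I' I f p (b i) ∈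
        LinearMap.range (mfderiv I' I f p).toLinearMap := fun r i ↦
      Submodule.smul_mem _ _ ⟨b i, rfl⟩
    exact add_mem (add_mem (hmem _ 0) (hmem _ 1)) (hmem _ 2)
  change ∑ i, (LinearMap.range (mfderiv I' I f p).toLinearMap)ᗮ.starProjection
    (covDerivAlong (leviCivita I M) f (pushExtend I I' f (b i)) p (b i)) = 0
  rw [← map_sum, Submodule.starProjection_apply_eq_zero_iff]
  exact Submodule.le_orthogonal_orthogonal _ h2

end IsLagrangianImmersion

end NearlyKahler

end
noncomputable section

namespace NearlyKahler

section Orientations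

lemma _root_.Module.Basis.orientation_eq_rayOfNeZero_iff {V ι : Type*} [AddCommGroup V]
    [Module ℝ V] [Fintype ι] [DecidableEq ι] (b : Basis ι ℝ V) {η : V [⋀^ι]→ₗ[ℝ] ℝ} (hη : η ≠ 0) :
    b.orientation = rayOfNeZero ℝ η hη ↔ 0 < η b := by
  rw [Basis.orientation, ray_eq_iff]
  constructor
  · intro h
    obtain ⟨r, hr, e⟩ := h.exists_pos_left b.det_ne_zero hη
    rw [← e]
    rw [AlternatingMap.smul_apply, b.det_self, smul_eq_mul, mul_one]
    exact hr
  · intro h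
    rw [η.eq_smul_basis_det b]
    exact SameRay.sameRay_pos_smul_right _ h

variable {E' : Type*} [NormedAddCommGroup E'] [NormedSpace ℝ E'] [FiniteDimensional ℝ E']
  {H' : Type*} [TopologicalSpace H'] {I' : ModelWithCorners ℝ E' H'}
  {L : Type*} [TopologicalSpace L] [ChartedSpace H' L] [IsManifold I' ∞ L]

lemma isLocalFrameOn_extend {k : ℕ} {p : L} (b : Basis (Fin k) ℝ (TangentSpace I' p)) :
    IsLocalFrameOn I' E' ∞ (fun i ↦ FiberBundle.extend E' (b i))
      (trivializationAt E' (fun p : L ↦ TangentSpace I' p) p).baseSet := by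
  set e := trivializationAt E' (fun p : L ↦ TangentSpace I' p) p
  have hp : p ∈ e.baseSet := FiberBundle.mem_baseSet_trivializationAt' p
  refine (e.isLocalFrameOn_localFrame_baseSet I' ∞
    (b.map (e.linearEquivAt ℝ p hp))).congr fun i q hq ↦ ?_
  rw [Trivialization.localFrame_apply_of_mem_baseSet _ _ hq, Trivialization.basisAt, Basis.map_apply,
    Basis.map_apply]
  rfl

/-- The orientation defined by a nowhere vanishing continuous form of top degree. -/
def ManifoldOrientation.ofForm {k : ℕ} [NeZero k] (hk : finrank ℝ E' = k)
    (η : Π p : L, TangentSpace I' p [⋀^Fin k]→ₗ[ℝ] ℝ) (hη : ∀ p, η p ≠ 0)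
    (hc : ∀ (p : L) (v : Fin k → TangentSpace I' p),
      ContinuousAt (fun q ↦ η q (fun i ↦ FiberBundle.extend E' (v i) q)) p) :
    ManifoldOrientation I' L k where
  orientation p := rayOfNeZero ℝ (η p) (hη p)
  locally_frame p := by
    have : Nonempty (Fin k) := ⟨0⟩
    let b₀ : Basis (Fin k) ℝ (TangentSpace I' p) := Module.finBasisOfFinrankEq ℝ E' hk
    let b := b₀.adjustToOrientation (rayOfNeZero ℝ (η p) (hη p))
    have hb : 0 < η p b := by
      rw [← b.orientation_eq_rayOfNeZero_iff (hη p)]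
      exact b₀.orientation_adjustToOrientation _
    refine ⟨(trivializationAt E' (fun p : L ↦ TangentSpace I' p) p).baseSet ∩
      {q | 0 < η q (fun i ↦ FiberBundle.extend E' (b i) q)}, Filter.inter_mem
        ((trivializationAt E' (fun p : L ↦ TangentSpace I' p) p).open_baseSet.mem_nhds
          (FiberBundle.mem_baseSet_trivializationAt' p))
        ((hc p b).eventually (lt_mem_nhds (by simpa only [FiberBundle.extend_apply_self] using hb))),
      _, (isLocalFrameOn_extend b).mono Set.inter_subset_left, fun q hq ↦ ?_⟩
    rw [Basis.orientation_eq_rayOfNeZero_iff]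
    have e : ⇑(((isLocalFrameOn_extend b).mono Set.inter_subset_left).toBasisAt hq) =
        fun i ↦ FiberBundle.extend E' (b i) q :=
      funext fun i ↦ IsLocalFrameOn.toBasisAt_coe _ _ i
    rw [e]
    exact hq.2

end Orientations

namespace IsLagrangianImmersion

open AlmostHermitianStructure

variable {E : Type*} [NormedAddCommGroup E] [NormedSpace ℝ E] [FiniteDimensional ℝ E]
  [CompleteSpace E]
  {H : Type*} [TopologicalSpace H] {I : ModelWithCorners ℝ E H} [I.Boundaryless]
  {M : Type*} [TopologicalSpace M] [ChartedSpace H M] [IsManifold I ∞ M]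
  [RiemannianBundle (fun x : M ↦ TangentSpace I x)]
  [IsContMDiffRiemannianBundle I ∞ E (fun x : M ↦ TangentSpace I x)]
  {E' : Type*} [NormedAddCommGroup E'] [NormedSpace ℝ E'] [FiniteDimensional ℝ E']
  {H' : Type*} [TopologicalSpace H'] {I' : ModelWithCorners ℝ E' H'} [I'.Boundaryless]
  {L : Type*} [TopologicalSpace L] [ChartedSpace H' L] [IsManifold I' ∞ L]
  {S : AlmostHermitianStructure I M} {f : L → M}

variable (I') in
/-- The pullback of the real part of the volume form. -/
def pullbackForm (hS : S.IsNearlyKahler) (N : ℝ) (f : L → M) (p : L) :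
    TangentSpace I' p [⋀^Fin 3]→ₗ[ℝ] ℝ :=
  (reForm (volumeForm hS N) (f p)).compLinearMap (mfderiv I' I f p).toLinearMap

lemma pullbackForm_apply (hS : S.IsNearlyKahler) (N : ℝ) (p : L) (v : Fin 3 → TangentSpace I' p) :
    pullbackForm I' hS N f p v =
      reForm (volumeForm hS N) (f p) (fun i ↦ mfderiv I' I f p (v i)) := rfl

lemma reForm_volumeForm (hS : S.IsNearlyKahler) (N : ℝ) (x : M) (v : Fin 3 → TangentSpace I x) :
    reForm (volumeForm hS N) x v = S.conjTorsionForm x (v 0) (v 1) (v 2) * (√N)⁻¹ := by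
  change (volumeForm hS N x v).re = _
  rw [volumeForm_apply, torsionForm_map_right hS, conjTorsionForm_apply, torsionForm_map_left hS]
  simp

lemma im_volumeForm_eq_zero (hf : IsLagrangianImmersion (I' := I') S f) (hS : S.IsNearlyKahler)
    (N : ℝ) (p : L) (v : Fin 3 → TangentSpace I' p) :
    (volumeForm hS N (f p) (fun i ↦ mfderiv I' I f p (v i))).im = 0 := by
  rw [volumeForm_apply, hf.torsionForm_eq_zero hS]
  simp

lemma abs_pullbackForm (hf : IsLagrangianImmersion (I' := I') S f) (hS : S.IsNearlyKahler)
    (hE : finrank ℝ E = 6) {N : ℝ} (hN : S.HasTypeFunction fun _ ↦ N) (hN0 : 0 < N) {p : L}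
    {b : Fin 3 → TangentSpace I' p} (hb : Orthonormal ℝ fun i ↦ mfderiv I' I f p (b i)) :
    |pullbackForm I' hS N f p b| = 1 := by
  have h1 := hN.norm_volumeForm_eq_one hS hE hN0 (hf.isUnitaryFrame hb)
  rw [← Complex.abs_re_eq_norm.2 (hf.im_volumeForm_eq_zero hS N p b)] at h1
  exact h1

lemma exists_basis_orthonormal (hf : IsLagrangianImmersion (I' := I') S f) (hE : finrank ℝ E = 6)
    (p : L) : ∃ b : Basis (Fin 3) ℝ (TangentSpace I' p),
      Orthonormal ℝ fun i ↦ mfderiv I' I f p (b i) := by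
  set T := (mfderiv I' I f p).toLinearMap with hT
  let φ := LinearEquiv.ofInjective T (hf.injective_mfderiv p)
  have hr : finrank ℝ (LinearMap.range T) = 3 := by
    rw [LinearMap.finrank_range_of_inj (hf.injective_mfderiv p)]
    have := hf.finrank_eq
    rw [hE] at this
    have h2 : finrank ℝ (TangentSpace I' p) = finrank ℝ E' := rfl
    omega
  let o : OrthonormalBasis (Fin 3) ℝ (LinearMap.range T) :=
    (stdOrthonormalBasis ℝ (LinearMap.range T)).reindex (finCongr hr)
  refine ⟨o.toBasis.map φ.symm, ?_⟩
  have he : (fun i ↦ mfderiv I' I f p (o.toBasis.map φ.symm i)) =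
      (LinearMap.range T).subtypeₗᵢ ∘ o := by
    funext i
    have := LinearEquiv.ofInjective_apply (f := T) (h := hf.injective_mfderiv p) (φ.symm (o i))
    rw [Basis.map_apply]
    simp only [OrthonormalBasis.coe_toBasis]
    change T (φ.symm (o i)) = _
    rw [← this]
    change ((φ (φ.symm (o i)) : LinearMap.range T) : TangentSpace I (f p)) = _
    rw [LinearEquiv.apply_symm_apply]
    rfl
  rw [he]
  exact o.orthonormal.comp_linearIsometry _

/-- A Lagrangian immersion into a strictly nearly Kähler six-manifold is calibrated. -/
lemma exists_isCalibratedBy (hf : IsLagrangianImmersion (I' := I') S f) (hS : S.IsNearlyKahler)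
    (hE : finrank ℝ E = 6) {N : ℝ} (hN : S.HasTypeFunction fun _ ↦ N) (hN0 : 0 < N) :
    ∃ o : ManifoldOrientation I' L 3, IsCalibratedBy (reForm (volumeForm hS N)) f o := by
  have hE' : finrank ℝ E' = 3 := by
    have := hf.finrank_eq
    omega
  have hη : ∀ p, pullbackForm I' hS N f p ≠ 0 := by
    intro p h
    obtain ⟨b, hb⟩ := hf.exists_basis_orthonormal hE p
    have := hf.abs_pullbackForm hS hE hN hN0 hb
    rw [h] at this
    simp at this
  have hc : ∀ (p : L) (v : Fin 3 → TangentSpace I' p), ContinuousAt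
      (fun q ↦ pullbackForm I' hS N f q (fun i ↦ FiberBundle.extend E' (v i) q)) p := by
    intro p v
    simp only [pullbackForm_apply, reForm_volumeForm]
    exact ((hasCovDerivAt_conjTorsionForm (S := S) (f p)).along
      (hf.contMDiff.mdifferentiableAt (by simp))
      (differentiableAlongAt_pushExtend hf.contMDiff (v 0))
      (differentiableAlongAt_pushExtend hf.contMDiff (v 1))
      (differentiableAlongAt_pushExtend hf.contMDiff (v 2))).1.continuousAt.mul continuousAt_const
  refine ⟨.ofForm hE' _ hη hc, fun p b hb hbo ↦ ?_⟩
  have hpos := (b.orientation_eq_rayOfNeZero_iff (hη p)).1 hb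
  have habs := hf.abs_pullbackForm hS hE hN hN0 hbo
  rwa [abs_of_pos hpos] at habs

end IsLagrangianImmersion

end NearlyKahler

end

open NearlyKahler
theorem mainTheorem8 {M : Type*} [TopologicalSpace M] [T2Space M] [ConnectedSpace M]
    [ChartedSpace (EuclideanSpace ℝ (Fin 6)) M] [IsManifold (𝓡 6) ∞ M]
    [RiemannianBundle (fun x : M ↦ TangentSpace (𝓡 6) x)]
    [IsContMDiffRiemannianBundle (𝓡 6) ∞ (EuclideanSpace ℝ (Fin 6))
      (fun x : M ↦ TangentSpace (𝓡 6) x)]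
    (S : AlmostHermitianStructure (𝓡 6) M) (hS : S.IsNearlyKahler) (hK : ¬ S.IsKahler) :
    ∃ ψ : Π x : M, TangentSpace (𝓡 6) x [⋀^Fin 3]→ₗ[ℝ] ℂ,
      S.IsParallelVolumeForm S.canonicalConnection ψ ∧
      IsGeneralizedCalibration (reForm ψ) ∧
      ∀ (L : Type*) [TopologicalSpace L] [T2Space L] [ChartedSpace (EuclideanSpace ℝ (Fin 3)) L]
        [IsManifold (𝓡 3) ∞ L] (f : L → M),
        IsLagrangianImmersion (I' := 𝓡 3) S f →
        (∃ o : ManifoldOrientation (𝓡 3) L 3, IsCalibratedBy (reForm ψ) f o) ∧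
        IsMinimalImmersion (𝓡 6) (𝓡 3) f ∧
        IsOrientable (𝓡 3) L 3 := by
  have hE : finrank ℝ (EuclideanSpace ℝ (Fin 6)) = 6 := finrank_euclideanSpace_fin
  obtain ⟨N, hN0, hN⟩ := hS.exists_const_type hE
  have hN0' : N ≠ 0 := hN.nablaJ_ne_zero hK
  have hpos : 0 < N := lt_of_le_of_ne hN0 hN0'.symm
  refine ⟨AlmostHermitianStructure.volumeForm hS N, hN.isParallelVolumeForm hS hE hpos,
    hN.isGeneralizedCalibration hS hpos, ?_⟩
  intro L _ _ _ _ f hf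
  obtain ⟨o, ho⟩ := hf.exists_isCalibratedBy hS hE hN hpos
  exact ⟨⟨o, ho⟩, hf.isMinimalImmersion hS hE hN hN0', ⟨o⟩⟩
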